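/- **Setting.** For a finite set $S$ of letters let $\pi(S)$ be the free prounipotent group over $\mathbb{Q}$ on $S$. Its coordinate ring $A(S)$ has the basis $(f_w)$ dual to the words $w$ in $S$, with the shuffle product and the deconcatenation coproduct $\Delta f_w=\sum_{w=uv}f_u\otimes f_v$; for $x=\sum a_i w_i\in\mathbb{Q}\langle S\rangle$ write $f_x=\sum a_i f_{w_i}$. When the letters carry negative weights, $A(S)$ is graded (equivalently $\mathbb{G}_m$ acts on $\pi(S)$), $f_w$ having degree minus the weight of $w$. Let $\tau,\upsilon,\sigma$ have weights $-1,-1,-3$, and let $K=K(\tau,\upsilon,\sigma)$ be the fraction field of $A(\tau,\upsilon,\sigma)$. Let $\Gamma=\{e_1,e_{11},e_2,e_{22},e_{12}\}$, all letters of weight $-1$. Let $L$ be the Lie algebra over $\mathbb{Q}$ with generators $\Gamma$ and relations $[e_1,e_2]=[e_{11},e_2]=[e_1,e_{22}]=0$ and $[e_{11},e_{22}]=-[e_{11},e_{12}]=[e_{22},e_{12}]=[e_2-e_1,e_{12}]$, let $N\subset L$ be the Lie ideal generated by $e_{11},e_{22},e_{12}$, and let $L^{\mathrm{PL}}=L/[N,N]$.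 Let $\pi^{\mathrm{PL}}$ be the prounipotent group associated to $L^{\mathrm{PL}}$ and $A^{\mathrm{PL}}\subset A(\Gamma)$ its graded coordinate ring. Let $\pi^{\mathrm{PL}}_{\ge -4}=\operatorname{Spec}A^{\mathrm{PL}}_{[\le 4]}$, where $A^{\mathrm{PL}}_{[\le 4]}$ is the Hopf subalgebra of $A^{\mathrm{PL}}$ generated by the elements of degree $\le 4$. Let $\mathbf{Z}^1(\pi(\tau,\upsilon,\sigma),\pi^{\mathrm{PL}}_{\ge-4})^{\mathbb{G}_m}$ be the functor sending a $\mathbb{Q}$-algebra $R$ to the set of $\mathbb{G}_m$-equivariant cocycles $c:\pi(\tau,\upsilon,\sigma)_R\to(\pi^{\mathrm{PL}}_{\ge-4})_R$ for the trivial action of $\pi(\tau,\upsilon,\sigma)$, i.e. of $\mathbb{G}_m$-equivariant homomorphisms of $R$-group schemes. Let $$\mathfrak{ev}:\ \pi(\tau,\upsilon,\sigma)\times\mathbf{Z}^1(\pi(\tau,\upsilon,\sigma),\pi^{\mathrm{PL}}_{\ge-4})^{\mathbb{G}_m}\to\pi(\tau,\upsilon,\sigma)\times\pi^{\mathrm{PL}}_{\ge-4},\qquad(\gamma,c)\mapsto(\gamma,c(\gamma)),$$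 and let $\mathfrak{ev}_K:\mathbf{Z}^1(\pi(\tau,\upsilon,\sigma),\pi^{\mathrm{PL}}_{\ge-4})^{\mathbb{G}_m}_K\to(\pi^{\mathrm{PL}}_{\ge-4})_K$ be its base change along the generic point $\operatorname{Spec}K\to\pi(\tau,\upsilon,\sigma)$. Let $\Lambda\subset\mathbb{Q}\langle\Gamma\rangle$ consist of the 14 elements $e_1$, $e_2$ (of weight $-1$) and $e_{11}e_1^n$, $e_{22}e_2^n$, $e_{12}(e_1+e_2)^n$ for $0\le n\le3$ (of weight $-n-1$). Let $\mathcal{A}=K[\{f_\lambda\}_{\lambda\in\Lambda}]$ be the polynomial ring in 14 variables $f_\lambda$, and let $\mathcal{S}=K[\{\Phi^\rho_\lambda\}]$ be the polynomial ring in the 13 variables $\Phi^\rho_\lambda$ with $\rho\in\{\tau,\upsilon,\sigma\}$, $\lambda\in\Lambda$ of equal weight. Put $\Phi^\rho_{e_1+e_2}=\Phi^\rho_{e_1}+\Phi^\rho_{e_2}$ for $\rho\in\{\tau,\upsilon\}$. Define the homomorphism of $K$-algebras $\theta:\mathcal{A}\to\mathcal{S}$ by $\theta(f_{e_i})=f_\tau\Phi^\tau_{e_i}+f_\upsilon\Phi^\upsilon_{e_i}$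 for $i=1,2$ and, for $(h,t)\in\{(e_{11},e_1),(e_{22},e_2),(e_{12},e_1+e_2)\}$ and $0\le n\le 3$, $$\theta(f_{ht^n})=\sum_{\rho_0,\dots,\rho_n\in\{\tau,\upsilon\}}f_{\rho_0\rho_1\cdots\rho_n}\,\Phi^{\rho_0}_{h}\Phi^{\rho_1}_{t}\cdots\Phi^{\rho_n}_{t}+\varepsilon_n,$$ where $\varepsilon_0=\varepsilon_1=0$, $\varepsilon_2=f_\sigma\Phi^\sigma_{ht^2}$ and $\varepsilon_3=f_{\sigma\tau}\Phi^\sigma_{ht^2}\Phi^\tau_t+f_{\sigma\upsilon}\Phi^\sigma_{ht^2}\Phi^\upsilon_t$. **Proposition.** The functions $f_\lambda$, $\lambda\in\Lambda$, on $\pi(\Gamma)$ belong to $A^{\mathrm{PL}}_{[\le4]}$, and there is a commuting square of functors on $K$-algebras $$\begin{array}{ccc}\mathbf{Z}^1(\pi(\tau,\upsilon,\sigma),\pi^{\mathrm{PL}}_{\ge-4})^{\mathbb{G}_m}_K&\xrightarrow{\ \mathfrak{ev}_K\ }&(\pi^{\mathrm{PL}}_{\ge-4})_K\\ {\scriptstyle\sim}\uparrow&&\uparrow{\scriptstyle\sim}\\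 \operatorname{Spec}K[\{\Phi^\rho_\lambda\}]&\xrightarrow{\operatorname{Spec}\theta}&\operatorname{Spec}K[\{f_\lambda\}]\end{array}$$ whose vertical maps are isomorphisms. Under the right-hand isomorphism the variable $f_\lambda$ corresponds to the function $f_\lambda$ on $\pi^{\mathrm{PL}}_{\ge-4}$; under the left-hand one the variable $\Phi^\rho_\lambda$ corresponds to the function sending a cocycle $c$ to the coefficient of $f_\rho$ in $c^\sharp f_\lambda$. -/

import Mathlib

open CategoryTheory
open scoped TensorProduct

universe u

noncomputable section

/-- The coordinate ring of the free prounipotent group over `ℚ` on the alphabet `α`, i.e. the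
topological dual of the completed universal enveloping algebra `ℚ⟨⟨α⟩⟩` of the free Lie algebra
on `α`. It has the basis `f_w` dual to the words `w` in `α`; product and coproduct (the transposes
of the coproduct and the product of `ℚ⟨⟨α⟩⟩`) are the shuffle product and deconcatenation. -/
def Sh (α : Type) : Type := List α →₀ ℚ

namespace Sh

variable {α : Type}

instance : AddCommGroup (Sh α) := inferInstanceAs (AddCommGroup (List α →₀ ℚ))

instance : Module ℚ (Sh α) := inferInstanceAs (Module ℚ (List α →₀ ℚ))

/-- The basis of words. -/
def basis (α : Type) : Module.Basis (List α) ℚ (Sh α) := .ofRepr (.refl ℚ (List α →₀ ℚ))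

/-- The function `f_w` attached to the word `w`. -/
def word (w : List α) : Sh α := basis α w

/-- The coefficient of `f_w`. -/
def coeff (w : List α) : Sh α →ₗ[ℚ] ℚ := (basis α).coord w

lemma coeff_word [DecidableEq α] (v w : List α) :
    coeff v (word w) = if w = v then 1 else 0 := by
  simp [coeff, word, Finsupp.single_apply]

lemma coeff_word_self (w : List α) : coeff w (word w) = 1 := by
  simp [coeff, word]

lemma coeff_word_ne {v w : List α} (h : w ≠ v) : coeff v (word w) = 0 := by
  classical
  rw [coeff_word, if_neg h]

lemma ext_coeff {f g : Sh α} (h : ∀ w, coeff w f = coeff w g) : f = g :=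
  (basis α).ext_elem h

lemma hom_ext {M : Type*} [AddCommMonoid M] [Module ℚ M] {F G : Sh α →ₗ[ℚ] M}
    (h : ∀ w, F (word w) = G (word w)) : F = G :=
  (basis α).ext h

/-- All shuffles of two words, with multiplicity. -/
def shuffles : List α → List α → List (List α)
  | [], v => [v]
  | a :: u, [] => [a :: u]
  | a :: u, b :: v =>
      (shuffles u (b :: v)).map (List.cons a) ++ (shuffles (a :: u) v).map (List.cons b)
  termination_by u v => u.length + v.length

/-- The shuffle product `f_u ⧢ f_v = ∑ f_w`, over all shuffles `w` of `u` and `v`. -/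
def mulL : Sh α →ₗ[ℚ] Sh α →ₗ[ℚ] Sh α :=
  (basis α).constr ℚ fun u => (basis α).constr ℚ fun v => ((shuffles u v).map word).sum

instance : Mul (Sh α) := ⟨fun f g => mulL f g⟩

instance : One (Sh α) := ⟨word []⟩

lemma mul_eq (f g : Sh α) : f * g = mulL f g := rfl

lemma one_eq : (1 : Sh α) = word [] := rfl

lemma word_mul_word (u v : List α) : word u * word v = ((shuffles u v).map word).sum := by
  simp [mul_eq, mulL, word]

/-- Prepending the letter `a` to every word. -/
def pre (a : α) : Sh α →ₗ[ℚ] Sh α := (basis α).constr ℚ fun w => word (a :: w)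

lemma pre_word (a : α) (w : List α) : pre a (word w) = word (a :: w) := by
  simp [pre, word]

/-- The transpose of left multiplication by the word `u`: it sends `f_w` to `f_v` if `w = uv`,
and to `0` if `w` does not begin with `u`. -/
def lsl (u : List α) : Sh α →ₗ[ℚ] Sh α :=
  (Finsupp.lcomapDomain (fun v => u ++ v) (List.append_right_injective u) :
    (List α →₀ ℚ) →ₗ[ℚ] (List α →₀ ℚ))

/-- The transpose of right multiplication by the word `v`. -/
def rsl (v : List α) : Sh α →ₗ[ℚ] Sh α :=
  (Finsupp.lcomapDomain (fun u => u ++ v) (List.append_left_injective v) :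
    (List α →₀ ℚ) →ₗ[ℚ] (List α →₀ ℚ))

lemma coeff_lsl (u w : List α) (f : Sh α) : coeff w (lsl u f) = coeff (u ++ w) f := rfl

lemma coeff_rsl (v w : List α) (f : Sh α) : coeff w (rsl v f) = coeff (w ++ v) f := rfl

lemma coeff_pre_nil (a : α) (f : Sh α) : coeff [] (pre a f) = 0 := by
  suffices h : coeff [] ∘ₗ pre a = 0 from LinearMap.congr_fun h f
  apply hom_ext
  intro w
  simp [pre_word, coeff_word_ne]

lemma lsl_pre (a : α) (f : Sh α) : lsl [a] (pre a f) = f := by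
  suffices h : lsl [a] ∘ₗ pre a = .id from LinearMap.congr_fun h f
  apply hom_ext
  intro w
  classical
  apply ext_coeff
  intro v
  simp [coeff_lsl, pre_word, coeff_word]

lemma lsl_pre_ne {a b : α} (hab : a ≠ b) (f : Sh α) : lsl [a] (pre b f) = 0 := by
  suffices h : lsl [a] ∘ₗ pre b = 0 from LinearMap.congr_fun h f
  apply hom_ext
  intro w
  classical
  apply ext_coeff
  intro v
  simp [coeff_lsl, pre_word, coeff_word, Ne.symm hab]

lemma sum_map_pre (a : α) (l : List (List α)) :
    ((l.map (List.cons a)).map word).sum = pre a (l.map word).sum := by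
  induction l with
  | nil => simp
  | cons w l ih => simp [pre_word] at ih ⊢; rw [ih]

lemma word_cons_mul_word_cons (a b : α) (u v : List α) :
    word (a :: u) * word (b :: v) =
      pre a (word u * word (b :: v)) + pre b (word (a :: u) * word v) := by
  rw [word_mul_word, shuffles, List.map_append, List.sum_append, sum_map_pre, sum_map_pre,
    word_mul_word, word_mul_word]

lemma one_word_mul (v : List α) : word [] * word v = word v := by
  simp [word_mul_word, shuffles]

lemma mul_one_word (v : List α) : word v * word [] = word v := by
  cases v <;> simp [word_mul_word, shuffles]

lemma coeff_nil_mul (f g : Sh α) : coeff [] (f * g) = coeff [] f * coeff [] g := by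
  suffices h : (mulL (α := α)).compr₂ (coeff []) =
      (LinearMap.mul ℚ ℚ).compl₁₂ (coeff []) (coeff []) from
    LinearMap.congr_fun₂ h f g
  apply hom_ext
  intro u
  apply hom_ext
  intro v
  change coeff [] (word u * word v) = coeff [] (word u) * coeff [] (word v)
  rcases u with _ | ⟨a, u⟩
  · rw [one_word_mul, coeff_word_self, one_mul]
  rcases v with _ | ⟨b, v⟩
  · rw [mul_one_word, coeff_word_self, mul_one]
  · rw [word_cons_mul_word_cons, map_add, coeff_pre_nil, coeff_pre_nil, coeff_word_ne (by simp)]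
    simp

lemma lsl_one (a : α) : lsl [a] (1 : Sh α) = 0 := by
  apply ext_coeff
  intro v
  rw [coeff_lsl, one_eq, coeff_word_ne (by simp), map_zero]

protected lemma mul_add' (f g h : Sh α) : f * (g + h) = f * g + f * h := map_add (mulL f) g h

protected lemma add_mul' (f g h : Sh α) : (f + g) * h = f * h + g * h := by
  simp [mul_eq]

/-- Removing an initial letter is a derivation of the shuffle product. -/
lemma lsl_mul (a : α) (f g : Sh α) :
    lsl [a] (f * g) = lsl [a] f * g + f * lsl [a] g := by
  suffices h : (mulL (α := α)).compr₂ (lsl [a]) =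
      mulL.compl₁₂ (lsl [a]) .id + mulL.compl₁₂ .id (lsl [a]) from
    LinearMap.congr_fun₂ h f g
  apply hom_ext
  intro u
  apply hom_ext
  intro v
  change lsl [a] (word u * word v) = lsl [a] (word u) * word v + word u * lsl [a] (word v)
  rcases u with _ | ⟨b, u⟩
  · rw [one_word_mul, ← one_eq, lsl_one]
    simp only [mul_eq, map_zero, LinearMap.zero_apply, zero_add]
    suffices h : mulL (1 : Sh α) = .id by rw [h]; rfl
    exact hom_ext one_word_mul
  rcases v with _ | ⟨c, v⟩
  · rw [mul_one_word, ← one_eq, lsl_one]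
    simp only [mul_eq, map_zero, add_zero]
    suffices h : (mulL (α := α)).flip 1 = .id from (LinearMap.congr_fun h _).symm
    exact hom_ext mul_one_word
  · rw [word_cons_mul_word_cons, map_add, ← pre_word b u, ← pre_word c v]
    by_cases hb : a = b <;> by_cases hc : a = c
    · subst hb; subst hc; simp [lsl_pre]
    · subst hb; rw [lsl_pre, lsl_pre, lsl_pre_ne hc, lsl_pre_ne hc]; simp [mul_eq]
    · subst hc; rw [lsl_pre, lsl_pre, lsl_pre_ne hb, lsl_pre_ne hb]; simp [mul_eq]
    · rw [lsl_pre_ne hb, lsl_pre_ne hb, lsl_pre_ne hc, lsl_pre_ne hc]; simp [mul_eq]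

lemma coeff_cons (a : α) (w : List α) (f : Sh α) : coeff (a :: w) f = coeff w (lsl [a] f) := rfl

protected lemma mul_comm' (f g : Sh α) : f * g = g * f := by
  apply ext_coeff
  intro w
  induction w generalizing f g with
  | nil => rw [coeff_nil_mul, coeff_nil_mul, mul_comm]
  | cons a w ih =>
    rw [coeff_cons, coeff_cons, lsl_mul, lsl_mul, map_add, map_add, ih, ih f, add_comm]

protected lemma mul_assoc' (f g h : Sh α) : f * g * h = f * (g * h) := by
  apply ext_coeff
  intro w
  induction w generalizing f g h with
  | nil => simp only [coeff_nil_mul, mul_assoc]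
  | cons a w ih =>
    simp only [coeff_cons, lsl_mul, map_add, Sh.add_mul', Sh.mul_add', ih, add_assoc]

protected lemma one_mul' (f : Sh α) : 1 * f = f := by
  apply ext_coeff
  intro w
  induction w generalizing f with
  | nil => rw [coeff_nil_mul, one_eq, coeff_word_self, one_mul]
  | cons a w ih =>
    rw [coeff_cons, coeff_cons, lsl_mul, map_add, lsl_one, ih]
    simp [mul_eq]

instance : CommRing (Sh α) where
  __ := (inferInstance : AddCommGroup (Sh α))
  mul_assoc := Sh.mul_assoc'
  mul_comm := Sh.mul_comm'
  one_mul := Sh.one_mul'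
  mul_one f := by rw [Sh.mul_comm', Sh.one_mul']
  left_distrib := Sh.mul_add'
  right_distrib := Sh.add_mul'
  zero_mul f := by simp [mul_eq]
  mul_zero f := by simp [mul_eq]

instance : Algebra ℚ (Sh α) :=
  Algebra.ofModule (fun r f g => by simp [mul_eq]) (fun r f g => by simp [mul_eq])

/-! Deconcatenation. -/

/-- The linear map underlying the deconcatenation coproduct
`Δ f_w = ∑ f_u ⊗ f_v`, over all ways of writing `w = uv`. -/
def comulL : Sh α →ₗ[ℚ] Sh α ⊗[ℚ] Sh α :=
  (basis α).constr ℚ fun w =>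
    ∑ i ∈ Finset.range (w.length + 1), word (w.take i) ⊗ₜ[ℚ] word (w.drop i)

lemma comulL_word (w : List α) : comulL (word w) =
    ∑ i ∈ Finset.range (w.length + 1), word (w.take i) ⊗ₜ[ℚ] word (w.drop i) := by
  simp [comulL, word]

lemma comulL_pre (a : α) (f : Sh α) :
    comulL (pre a f) = 1 ⊗ₜ pre a f + (pre a).rTensor (Sh α) (comulL f) := by
  suffices h : comulL ∘ₗ pre a = TensorProduct.mk ℚ _ _ 1 ∘ₗ pre a +
      (pre a).rTensor (Sh α) ∘ₗ comulL from LinearMap.congr_fun h f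
  apply hom_ext
  intro w
  simp only [LinearMap.comp_apply, LinearMap.add_apply, pre_word, comulL_word, map_sum,
    LinearMap.rTensor_tmul, TensorProduct.mk_apply]
  rw [List.length_cons, Finset.sum_range_succ', add_comm]
  simp [one_eq]

lemma comulL_one : comulL (1 : Sh α) = 1 := by
  rw [one_eq, comulL_word]
  simp [Algebra.TensorProduct.one_def, one_eq]

lemma pre_mul_pre (a b : α) (f g : Sh α) :
    pre a f * pre b g = pre a (f * pre b g) + pre b (pre a f * g) := by
  suffices h : (mulL (α := α)).compl₁₂ (pre a) (pre b) =
      (mulL.compl₁₂ .id (pre b)).compr₂ (pre a) + (mulL.compl₁₂ (pre a) .id).compr₂ (pre b) from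
    LinearMap.congr_fun₂ h f g
  apply hom_ext
  intro u
  apply hom_ext
  intro v
  change pre a (word u) * pre b (word v) =
    pre a (word u * pre b (word v)) + pre b (pre a (word u) * word v)
  rw [pre_word, pre_word, word_cons_mul_word_cons]

lemma rTensor_pre_mul (a : α) (s : Sh α ⊗[ℚ] Sh α) (h : Sh α) :
    (pre a).rTensor (Sh α) (s * (1 ⊗ₜ h)) = (pre a).rTensor (Sh α) s * (1 ⊗ₜ h) := by
  induction s with
  | zero => simp
  | add s t hs ht => simp only [add_mul, map_add, hs, ht]
  | tmul x y => simp

lemma rTensor_pre_mul_pre (a b : α) (s t : Sh α ⊗[ℚ] Sh α) :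
    (pre a).rTensor (Sh α) s * (pre b).rTensor (Sh α) t =
      (pre a).rTensor (Sh α) (s * (pre b).rTensor (Sh α) t) +
      (pre b).rTensor (Sh α) ((pre a).rTensor (Sh α) s * t) := by
  induction s with
  | zero => simp
  | add s s' hs hs' =>
    simp only [add_mul, map_add, hs, hs']; abel
  | tmul x y =>
    induction t with
    | zero => simp
    | add t t' ht ht' => simp only [mul_add, map_add, ht, ht']; abel
    | tmul z w => simp [pre_mul_pre, TensorProduct.add_tmul]

lemma comulL_mul_word (u v : List α) :
    comulL (word u * word v) = comulL (word u) * comulL (word v) := by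
  induction u generalizing v with
  | nil => rw [← one_eq, one_mul, comulL_one, one_mul]
  | cons a u ihu =>
    induction v with
    | nil => rw [← one_eq, mul_one, comulL_one, mul_one]
    | cons b v ihv =>
      rw [word_cons_mul_word_cons, map_add, comulL_pre, comulL_pre, ihu, ihv,
        ← pre_word a u, ← pre_word b v, comulL_pre, comulL_pre]
      have h1 : (1 : Sh α) ⊗ₜ[ℚ] (pre a (word u) * pre b (word v)) =
          (1 ⊗ₜ pre a (word u)) * (1 ⊗ₜ pre b (word v)) := by simp
      have h2 := rTensor_pre_mul_pre a b (comulL (word u)) (comulL (word v))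
      have h3 := rTensor_pre_mul a (comulL (word u)) (pre b (word v))
      have h4 := rTensor_pre_mul b (comulL (word v)) (pre a (word u))
      rw [mul_comm, mul_comm _ ((1 : Sh α) ⊗ₜ[ℚ] pre a (word u))] at h4
      rw [pre_mul_pre, TensorProduct.tmul_add] at h1
      simp only [mul_add, add_mul, map_add]
      rw [h2, ← h1, h3, ← h4, mul_comm (1 ⊗ₜ[ℚ] pre a (word u)) (comulL (word v))]
      abel

lemma comulL_mul (f g : Sh α) : comulL (f * g) = comulL f * comulL g := by
  suffices h : (mulL (α := α)).compr₂ comulL =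
      (LinearMap.mul ℚ (Sh α ⊗[ℚ] Sh α)).compl₁₂ comulL comulL from
    LinearMap.congr_fun₂ h f g
  exact hom_ext fun u => hom_ext fun v => comulL_mul_word u v

/-- The deconcatenation coproduct. -/
def comulA : Sh α →ₐ[ℚ] Sh α ⊗[ℚ] Sh α := .ofLinearMap comulL comulL_one comulL_mul

/-- The counit: the coefficient of the empty word. -/
def counitA : Sh α →ₐ[ℚ] ℚ := .ofLinearMap (coeff []) (coeff_word_self []) coeff_nil_mul

lemma assoc_rTensor_pre (a : α) (t : Sh α ⊗[ℚ] Sh α) :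
    TensorProduct.assoc ℚ (Sh α) (Sh α) (Sh α)
        (comulL.rTensor (Sh α) ((pre a).rTensor (Sh α) t)) =
      1 ⊗ₜ (pre a).rTensor (Sh α) t + (pre a).rTensor (Sh α ⊗[ℚ] Sh α)
        (TensorProduct.assoc ℚ (Sh α) (Sh α) (Sh α) (comulL.rTensor (Sh α) t)) := by
  induction t with
  | zero => simp
  | add s t hs ht => simp only [map_add, hs, ht, TensorProduct.tmul_add]; abel
  | tmul x y =>
    simp only [LinearMap.rTensor_tmul, comulL_pre, TensorProduct.add_tmul, map_add,
      TensorProduct.assoc_tmul]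
    congr 1
    generalize comulL x = s
    induction s with
    | zero => simp
    | add s t hs ht => simp only [map_add, hs, ht, TensorProduct.add_tmul]
    | tmul z w => simp

lemma lTensor_rTensor_pre (a : α) (t : Sh α ⊗[ℚ] Sh α) :
    comulL.lTensor (Sh α) ((pre a).rTensor (Sh α) t) =
      (pre a).rTensor (Sh α ⊗[ℚ] Sh α) (comulL.lTensor (Sh α) t) := by
  rw [← LinearMap.comp_apply, ← LinearMap.comp_apply, LinearMap.lTensor_comp_rTensor,
    LinearMap.rTensor_comp_lTensor]

lemma coassoc_word (w : List α) :
    TensorProduct.assoc ℚ (Sh α) (Sh α) (Sh α) (comulL.rTensor (Sh α) (comulL (word w))) =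
      comulL.lTensor (Sh α) (comulL (word w)) := by
  induction w with
  | nil => simp [← one_eq, comulL_one, Algebra.TensorProduct.one_def]
  | cons a w ih =>
    rw [← pre_word, comulL_pre, map_add, map_add, map_add, assoc_rTensor_pre, ih,
      lTensor_rTensor_pre]
    simp only [LinearMap.rTensor_tmul, LinearMap.lTensor_tmul, comulL_one, comulL_pre,
      Algebra.TensorProduct.one_def, TensorProduct.assoc_tmul, TensorProduct.tmul_add]
    abel

lemma counit_word_left (w : List α) :
    (coeff []).rTensor (Sh α) (comulL (word w)) = 1 ⊗ₜ word w := by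
  rcases w with _ | ⟨a, w⟩
  · simp [← one_eq, comulL_one, Algebra.TensorProduct.one_def]
    simp [one_eq, coeff_word_self]
  · rw [← pre_word, comulL_pre, map_add]
    have : (coeff []).rTensor (Sh α) ((pre a).rTensor (Sh α) (comulL (word w))) = 0 := by
      rw [← LinearMap.comp_apply, ← LinearMap.rTensor_comp]
      have : (coeff [] ∘ₗ pre a : Sh α →ₗ[ℚ] ℚ) = 0 := by
        ext f; exact coeff_pre_nil a f
      rw [this]; simp
    rw [this, add_zero, LinearMap.rTensor_tmul, one_eq, coeff_word_self]

lemma counit_word_right (w : List α) :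
    (coeff []).lTensor (Sh α) (comulL (word w)) = word w ⊗ₜ 1 := by
  induction w with
  | nil =>
    simp [← one_eq, comulL_one, Algebra.TensorProduct.one_def]
    simp [one_eq, coeff_word_self]
  | cons a w ih =>
    have h : (coeff []).lTensor (Sh α) ((pre a).rTensor (Sh α) (comulL (word w))) =
        (pre a).rTensor ℚ ((coeff []).lTensor (Sh α) (comulL (word w))) := by
      generalize comulL (word w) = t
      induction t with
      | zero => simp
      | add s t hs ht => simp only [map_add, hs, ht]
      | tmul x y => simp
    rw [← pre_word, comulL_pre, map_add, h, ih]
    simp [coeff_pre_nil]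

/-- The shuffle bialgebra: shuffle product and deconcatenation coproduct. It is a Hopf algebra;
the antipode is not recorded, since it is determined by the rest of the structure and is
automatically preserved by homomorphisms of bialgebras. -/
instance : Bialgebra ℚ (Sh α) :=
  Bialgebra.ofAlgHom comulA counitA
    (AlgHom.toLinearMap_injective (hom_ext coassoc_word))
    (AlgHom.toLinearMap_injective (hom_ext counit_word_left))
    (AlgHom.toLinearMap_injective (hom_ext counit_word_right))

lemma comul_eq (f : Sh α) : Coalgebra.comul (R := ℚ) f = comulL f := rfl

end Sh

namespace Sh

variable {α : Type}

/-! The coordinate ring of a free prounipotent group is a domain. -/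

lemma length_of_mem_shuffles (u v : List α) :
    ∀ w ∈ shuffles u v, w.length = u.length + v.length := by
  fun_induction shuffles u v with
  | case1 v => simp
  | case2 a u => simp
  | case3 a u b v ih1 ih2 =>
    intro w hw
    simp only [List.mem_append, List.mem_map] at hw
    rcases hw with ⟨x, hx, rfl⟩ | ⟨x, hx, rfl⟩
    · simp [ih1 x hx]; omega
    · simp [ih2 x hx]; omega

lemma shuffles_ne_nil (u v : List α) : shuffles u v ≠ [] := by
  fun_induction shuffles u v <;> simp_all

lemma shuffles_nil_right (u : List α) : shuffles u [] = [u] := by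
  cases u <;> simp [shuffles]

lemma coeff_word_mul_word [DecidableEq α] (u v w : List α) :
    coeff w (word u * word v) = ((shuffles u v).count w : ℚ) := by
  rw [word_mul_word]
  induction shuffles u v with
  | nil => simp
  | cons x l ih =>
    simp only [List.map_cons, List.sum_cons, map_add, ih, coeff_word, List.count_cons]
    by_cases h : x = w <;> simp [h, add_comm]

lemma mem_shuffles_comm {u v w : List α} (h : w ∈ shuffles u v) : w ∈ shuffles v u := by
  classical
  have h1 : coeff w (word u * word v) = coeff w (word v * word u) := by rw [Sh.mul_comm']
  rw [coeff_word_mul_word, coeff_word_mul_word, Nat.cast_inj] at h1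
  rw [← List.count_pos_iff] at h ⊢
  omega

lemma shuffles_mono [LinearOrder α] (u v : List α) : ∀ u' : List α, u.length = u'.length → u < u' →
    ∀ w ∈ shuffles u v, ∃ w' ∈ shuffles u' v, w < w' := by
  fun_induction shuffles u v with
  | case1 v =>
    intro u' hl hu
    obtain rfl : u' = [] := List.length_eq_zero_iff.mp hl.symm
    exact absurd hu (lt_irrefl _)
  | case2 a u =>
    intro u' hl hu w hw
    rw [shuffles_nil_right]
    simp_all
  | case3 a u b v ih1 ih2 =>
    intro u' hl hu w hw
    rcases u' with _ | ⟨a', u'⟩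
    · simp at hl
    simp only [shuffles, List.mem_append, List.mem_map] at hw ⊢
    rcases hw with ⟨x, hx, rfl⟩ | ⟨x, hx, rfl⟩
    · rcases List.cons_lt_cons_iff.mp hu with h | ⟨rfl, h⟩
      · obtain ⟨y, hy⟩ := List.exists_mem_of_ne_nil _ (shuffles_ne_nil u' (b :: v))
        exact ⟨a' :: y, Or.inl ⟨y, hy, rfl⟩, List.cons_lt_cons_iff.mpr (Or.inl h)⟩
      · obtain ⟨y, hy, hxy⟩ := ih1 u' (by simpa using hl) h x hx
        exact ⟨a :: y, Or.inl ⟨y, hy, rfl⟩, List.cons_lt_cons_iff.mpr (Or.inr ⟨rfl, hxy⟩)⟩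
    · obtain ⟨y, hy, hxy⟩ := ih2 (a' :: u') hl hu x hx
      exact ⟨b :: y, Or.inr ⟨y, hy, rfl⟩, List.cons_lt_cons_iff.mpr (Or.inr ⟨rfl, hxy⟩)⟩

lemma shuffles_mono' [LinearOrder α] {u v u' v' : List α} (hul : u.length = u'.length)
    (hvl : v.length = v'.length) (hu : u ≤ u') (hv : v ≤ v') (hne : u ≠ u' ∨ v ≠ v') :
    ∀ w ∈ shuffles u v, ∃ w' ∈ shuffles u' v', w < w' := by
  have left : ∀ {v : List α}, u ≠ u' → ∀ w ∈ shuffles u v, ∃ w' ∈ shuffles u' v, w < w' :=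
    fun h => shuffles_mono _ _ _ hul (lt_of_le_of_ne hu h)
  have right : ∀ {u : List α}, v ≠ v' → ∀ w ∈ shuffles u v, ∃ w' ∈ shuffles u v', w < w' := by
    intro u h w hw
    obtain ⟨w', h1, h2⟩ := shuffles_mono v u v' hvl (lt_of_le_of_ne hv h) w (mem_shuffles_comm hw)
    exact ⟨w', mem_shuffles_comm h1, h2⟩
  intro w hw
  by_cases h1 : u = u'
  · subst h1
    exact right (hne.resolve_left (by simp)) w hw
  · obtain ⟨w', hw', hlt⟩ := left h1 w hw
    by_cases h2 : v = v'
    · subst h2; exact ⟨w', hw', hlt⟩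
    · obtain ⟨w'', hw'', hlt'⟩ := right h2 w' hw'
      exact ⟨w'', hw'', hlt.trans hlt'⟩

lemma exists_leading [LinearOrder α] {f : Sh α} (hf : f ≠ 0) :
    ∃ u, coeff u f ≠ 0 ∧ ∀ v, coeff v f ≠ 0 →
      v.length ≤ u.length ∧ (v.length = u.length → v ≤ u) := by
  have hs : ((basis α).repr f).support.Nonempty := by
    rw [Finsupp.support_nonempty_iff]
    simpa using hf
  obtain ⟨u, hu, hmax⟩ := Finset.exists_max_image _
    (fun v : List α => (toLex (v.length, v) : ℕ ×ₗ List α)) hs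
  refine ⟨u, by simpa [coeff] using hu, fun v hv => ?_⟩
  have := hmax v (by simpa [coeff] using hv)
  rw [Prod.Lex.toLex_le_toLex] at this
  rcases this with h | ⟨h, h'⟩
  · exact ⟨h.le, fun h' => absurd h' h.ne⟩
  · exact ⟨h.le, fun _ => h'⟩

instance : IsDomain (Sh α) := by
  classical
  let _ : LinearOrder α := linearOrderOfSTO (WellOrderingRel)
  have : Nontrivial (Sh α) := ⟨0, 1, fun h => by
    have := congrArg (coeff []) h
    rw [map_zero, one_eq, coeff_word_self] at this
    exact zero_ne_one this⟩
  have : NoZeroDivisors (Sh α) := ⟨by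
    intro f g hfg
    by_contra! hne
    obtain ⟨u, hu, hu'⟩ := exists_leading hne.1
    obtain ⟨v, hv, hv'⟩ := exists_leading hne.2
    obtain ⟨w, hw, hmax⟩ := Finset.exists_max_image (shuffles u v).toFinset id
      (by simpa [Finset.Nonempty, ← List.ne_nil_iff_exists_cons] using
        List.exists_mem_of_ne_nil _ (shuffles_ne_nil u v))
    simp only [List.mem_toFinset, id] at hw hmax
    have hfs : f = ∑ x ∈ ((basis α).repr f).support, coeff x f • word x :=
      ((basis α).linearCombination_repr f).symm
    have hgs : g = ∑ x ∈ ((basis α).repr g).support, coeff x g • word x :=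
      ((basis α).linearCombination_repr g).symm
    have h0 : coeff w (f * g) = coeff u f * (coeff v g * ((shuffles u v).count w : ℚ)) := by
      have key : ∀ x y, coeff x f ≠ 0 → coeff y g ≠ 0 → (x ≠ u ∨ y ≠ v) →
          (shuffles x y).count w = 0 := by
        intro x y hx hy hxy
        rw [List.count_eq_zero]
        intro hmem
        have l1 := length_of_mem_shuffles _ _ _ hmem
        have l2 := length_of_mem_shuffles _ _ _ hw
        have l3 := hu' x hx
        have l4 := hv' y hy
        obtain ⟨w', hw', hlt⟩ := shuffles_mono' (by omega) (by omega) (l3.2 (by omega))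
          (l4.2 (by omega)) hxy w hmem
        exact absurd (hmax w' hw') (not_le.mpr hlt)
      conv_lhs => rw [hfs, hgs, Finset.sum_mul_sum]
      simp only [map_sum, smul_mul_smul_comm, map_smul, coeff_word_mul_word, smul_eq_mul]
      rw [Finset.sum_eq_single u, Finset.sum_eq_single v]
      · ring
      · intro y hy hyv
        rw [key u y hu (by simpa [coeff] using hy) (Or.inr hyv)]; simp
      · intro h
        exact absurd (by simpa [coeff] using h) hv
      · intro x hx hxu
        apply Finset.sum_eq_zero
        intro y hy
        rw [key x y (by simpa [coeff] using hx) (by simpa [coeff] using hy) (Or.inl hxu)]; simp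
      · intro h
        exact absurd (by simpa [coeff] using h) hu
    rw [hfg, map_zero] at h0
    have hc : ((shuffles u v).count w : ℚ) ≠ 0 := by
      rw [Nat.cast_ne_zero, ← Nat.pos_iff_ne_zero, List.count_pos_iff]
      exact hw
    exact (mul_ne_zero hu (mul_ne_zero hv hc)) h0.symm⟩
  exact NoZeroDivisors.to_isDomain _

end Sh

namespace Sh

variable {α : Type}

/-- The identification of noncommutative polynomials with finite linear combinations of words,
`∑ aᵢ wᵢ ↦ f_{∑ aᵢ wᵢ} = ∑ aᵢ f_{wᵢ}`. -/
def fn : FreeAlgebra ℚ α →ₗ[ℚ] Sh α where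
  toFun x := ((FreeAlgebra.equivMonoidAlgebraFreeMonoid x).coeff : List α →₀ ℚ)
  map_add' x y := by rw [map_add]; rfl
  map_smul' r x := by rw [map_smul]; rfl

/-- The associative word `a₁ ⋯ aₙ` as an element of the free associative algebra. -/
def asc (w : List α) : FreeAlgebra ℚ α := (w.map (FreeAlgebra.ι ℚ)).prod

lemma fn_asc (w : List α) : fn (asc w) = word w := by
  have : FreeAlgebra.equivMonoidAlgebraFreeMonoid (asc w) =
      MonoidAlgebra.of ℚ (FreeMonoid α) (FreeMonoid.ofList w) := by
    induction w with
    | nil => simp [asc, MonoidAlgebra.one_def]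
    | cons a w ih =>
      simp only [asc, List.map_cons, List.prod_cons, map_mul] at ih ⊢
      rw [ih, FreeMonoid.ofList_cons, map_mul]
      simp [FreeAlgebra.equivMonoidAlgebraFreeMonoid]
  change ((FreeAlgebra.equivMonoidAlgebraFreeMonoid (asc w)).coeff : List α →₀ ℚ) = _
  rw [this]
  rfl

lemma asc_hom_ext {M : Type*} [AddCommMonoid M] [Module ℚ M] {F G : FreeAlgebra ℚ α →ₗ[ℚ] M}
    (h : ∀ w, F (asc w) = G (asc w)) : F = G := by
  have h1 : ∀ x, fn (α := α) x = 0 → x = 0 := by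
    intro x hx
    apply (FreeAlgebra.equivMonoidAlgebraFreeMonoid (R := ℚ) (X := α)).injective
    rw [map_zero]
    exact MonoidAlgebra.coeff_injective hx
  have h2 : Function.Injective (fn (α := α)) := by
    intro x y hxy
    rw [← sub_eq_zero]; apply h1; rw [map_sub, hxy, sub_self]
  let S : Sh α →ₗ[ℚ] FreeAlgebra ℚ α := (basis α).constr ℚ asc
  have hS : ∀ w, S (word w) = asc w := fun w => by simp [S, word]
  have h3 : ∀ x, S (fn x) = x := by
    intro x
    apply h2
    suffices hh : fn ∘ₗ S = .id from LinearMap.congr_fun hh (fn x)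
    apply hom_ext
    intro w
    simp [hS, fn_asc]
  have h4 : F ∘ₗ S = G ∘ₗ S := hom_ext fun w => by simp [hS, h]
  ext x
  rw [← h3 x]
  exact LinearMap.congr_fun h4 (fn x)

/-- The pairing between the coordinate ring and the free associative algebra `ℚ⟨α⟩`, whose
completion is the completed universal enveloping algebra of the free Lie algebra on `α`:
`⟨f_v, w⟩ = δ_{v,w}` for words `v`, `w`. -/
def pairing : Sh α →ₗ[ℚ] FreeAlgebra ℚ α →ₗ[ℚ] ℚ :=
  ((basis α).constr ℚ fun v => coeff v ∘ₗ fn)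

lemma pairing_asc (f : Sh α) (w : List α) : pairing f (asc w) = coeff w f := by
  suffices h : pairing.flip (asc w) = coeff w from LinearMap.congr_fun h f
  classical
  apply hom_ext
  intro v
  simp [pairing, word]
  rw [fn_asc, ← word, coeff_word, coeff_word]
  simp [eq_comm]

lemma asc_append (u v : List α) : asc (u ++ v) = asc u * asc v := by simp [asc]

lemma pairing_lsl (u : List α) (f : Sh α) (x : FreeAlgebra ℚ α) :
    pairing (lsl u f) x = pairing f (asc u * x) := by
  suffices h : pairing (lsl u f) = pairing f ∘ₗ LinearMap.mulLeft ℚ (asc u) from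
    LinearMap.congr_fun h x
  apply asc_hom_ext
  intro w
  simp [pairing_asc, coeff_lsl, ← asc_append]

lemma pairing_rsl (v : List α) (f : Sh α) (x : FreeAlgebra ℚ α) :
    pairing (rsl v f) x = pairing f (x * asc v) := by
  suffices h : pairing (rsl v f) = pairing f ∘ₗ LinearMap.mulRight ℚ (asc v) from
    LinearMap.congr_fun h x
  apply asc_hom_ext
  intro w
  simp [pairing_asc, coeff_rsl, ← asc_append]

/-- The coproduct of `ℚ⟨α⟩`, for which the letters are primitive. -/
def unsh : FreeAlgebra ℚ α →ₐ[ℚ] FreeAlgebra ℚ α ⊗[ℚ] FreeAlgebra ℚ α :=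
  FreeAlgebra.lift ℚ fun a => FreeAlgebra.ι ℚ a ⊗ₜ 1 + 1 ⊗ₜ FreeAlgebra.ι ℚ a

lemma pairing_mul (f g : Sh α) (x : FreeAlgebra ℚ α) :
    pairing (f * g) x =
      LinearMap.mul' ℚ ℚ (TensorProduct.map (pairing f) (pairing g) (unsh x)) := by
  suffices h : pairing (f * g) =
      LinearMap.mul' ℚ ℚ ∘ₗ TensorProduct.map (pairing f) (pairing g) ∘ₗ unsh.toLinearMap from
    LinearMap.congr_fun h x
  apply asc_hom_ext
  intro w
  rw [pairing_asc]
  simp only [LinearMap.comp_apply, AlgHom.toLinearMap_apply]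
  induction w generalizing f g with
  | nil =>
    have h1 : (1 : FreeAlgebra ℚ α) = asc [] := by simp [asc]
    have h2 : asc ([] : List α) = 1 := by simp [asc]
    rw [h2, map_one, Algebra.TensorProduct.one_def, TensorProduct.map_tmul, h1,
      pairing_asc, pairing_asc, coeff_nil_mul]
    simp
  | cons a w ih =>
    have h1 : asc (a :: w) = FreeAlgebra.ι ℚ a * asc w := by simp [asc]
    have h2 : asc [a] = FreeAlgebra.ι ℚ a := by simp [asc]
    have h3 : unsh (FreeAlgebra.ι ℚ a) =
        FreeAlgebra.ι ℚ a ⊗ₜ 1 + 1 ⊗ₜ FreeAlgebra.ι ℚ a := by simp [unsh]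
    rw [coeff_cons, lsl_mul, map_add, ih, ih, h1, map_mul, h3, ← map_add]
    congr 1
    generalize unsh (asc w) = t
    induction t with
    | zero => simp
    | add s t hs ht => simp only [mul_add, map_add, ← hs, ← ht]; abel
    | tmul y z => simp [add_mul, pairing_lsl, h2]

lemma coeff_rTensor_comulL (u : List α) (f : Sh α) :
    (coeff u).rTensor (Sh α) (comulL f) = 1 ⊗ₜ lsl u f := by
  induction u generalizing f with
  | nil =>
    have h : lsl [] f = f := ext_coeff fun w => by rw [coeff_lsl, List.nil_append]
    rw [h]
    suffices hh : (coeff []).rTensor (Sh α) ∘ₗ comulL = TensorProduct.mk ℚ ℚ _ 1 from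
      LinearMap.congr_fun hh f
    exact hom_ext counit_word_left
  | cons a u ih =>
    have h : lsl (a :: u) f = lsl u (lsl [a] f) := ext_coeff fun w => rfl
    rw [h, ← ih]
    suffices hh : (coeff (a :: u)).rTensor (Sh α) ∘ₗ comulL =
        (coeff u).rTensor (Sh α) ∘ₗ comulL ∘ₗ lsl [a] from LinearMap.congr_fun hh f
    apply hom_ext
    intro w
    simp only [LinearMap.comp_apply]
    rcases w with _ | ⟨b, w⟩
    · rw [← one_eq, comulL_one, lsl_one, Algebra.TensorProduct.one_def, LinearMap.rTensor_tmul,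
        one_eq, coeff_word_ne (by simp)]
      simp
    · rw [← pre_word, comulL_pre, map_add, LinearMap.rTensor_tmul, one_eq,
        coeff_word_ne (by simp), ← LinearMap.comp_apply, ← LinearMap.rTensor_comp]
      have h5 : coeff (a :: u) ∘ₗ pre b = coeff u ∘ₗ lsl [a] ∘ₗ pre b := rfl
      rw [h5]
      by_cases hab : a = b
      · subst hab
        have h6 : lsl [a] ∘ₗ pre a = (.id : Sh α →ₗ[ℚ] Sh α) := LinearMap.ext (lsl_pre a)
        rw [h6, lsl_pre]; simp
      · have h6 : lsl [a] ∘ₗ pre b = (0 : Sh α →ₗ[ℚ] Sh α) := LinearMap.ext (lsl_pre_ne hab)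
        rw [h6, lsl_pre_ne hab]; simp

lemma coeff_lTensor_comulL (v : List α) (f : Sh α) :
    (coeff v).lTensor (Sh α) (comulL f) = rsl v f ⊗ₜ 1 := by
  apply (TensorProduct.rid ℚ (Sh α)).injective
  apply ext_coeff
  intro u
  have key : ∀ t : Sh α ⊗[ℚ] Sh α,
      coeff u (TensorProduct.rid ℚ (Sh α) ((coeff v).lTensor (Sh α) t)) =
        coeff v (TensorProduct.lid ℚ (Sh α) ((coeff u).rTensor (Sh α) t)) := by
    intro t
    induction t with
    | zero => simp
    | add s t hs ht => simp only [map_add, hs, ht]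
    | tmul x y => simp [mul_comm]
  rw [key, coeff_rTensor_comulL]
  simp [coeff_lsl, coeff_rsl]

/-- Elements of a tensor product `M ⊗ W` are detected on coefficients. -/
lemma tensor_ext_left {W : Type} [AddCommGroup W] [Module ℚ W] (t : Sh α ⊗[ℚ] W)
    (h : ∀ u, (coeff u).rTensor W t = 0) : t = 0 := by
  apply ((basis α).repr.rTensor W).injective
  classical
  apply (TensorProduct.finsuppScalarLeft ℚ W (List α)).injective
  rw [map_zero, map_zero]
  ext u
  have key : ∀ t : Sh α ⊗[ℚ] W,
      TensorProduct.finsuppScalarLeft ℚ W (List α) ((basis α).repr.rTensor W t) u =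
        TensorProduct.lid ℚ W ((coeff u).rTensor W t) := by
    intro t
    induction t with
    | zero => simp
    | add s t hs ht => simp only [map_add, Finsupp.add_apply, hs, ht]
    | tmul x y => simp [coeff]
  rw [key, h]
  simp

/-- If a subspace is stable under the transposes of left and right multiplications, then it is
stable under the coproduct. -/
lemma comulL_mem (V : Submodule ℚ (Sh α)) (hl : ∀ u, ∀ f ∈ V, lsl u f ∈ V)
    (hr : ∀ u, ∀ f ∈ V, rsl u f ∈ V) {f : Sh α} (hf : f ∈ V) :
    comulL f ∈ LinearMap.range (TensorProduct.map V.subtype V.subtype) := by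
  have h1 : V.mkQ.lTensor (Sh α) (comulL f) = 0 := by
    apply tensor_ext_left
    intro u
    rw [← LinearMap.comp_apply, LinearMap.rTensor_comp_lTensor, ← LinearMap.lTensor_comp_rTensor,
      LinearMap.comp_apply, coeff_rTensor_comulL, LinearMap.lTensor_tmul]
    rw [(Submodule.Quotient.mk_eq_zero V).mpr (hl u f hf : lsl u f ∈ V) |> fun h => (h : V.mkQ _ = 0)]
    simp
  have h2 : V.mkQ.rTensor (Sh α) (comulL f) = 0 := by
    apply (TensorProduct.comm ℚ _ _).injective
    rw [map_zero]
    apply tensor_ext_left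
    intro v
    have : ∀ t : Sh α ⊗[ℚ] Sh α, (coeff v).rTensor _ (TensorProduct.comm ℚ _ _
        (V.mkQ.rTensor (Sh α) t)) =
        TensorProduct.comm ℚ _ _ (V.mkQ.rTensor ℚ ((coeff v).lTensor (Sh α) t)) := by
      intro t
      induction t with
      | zero => simp
      | add s t hs ht => simp only [map_add, hs, ht]
      | tmul x y => simp
    rw [this, coeff_lTensor_comulL, LinearMap.rTensor_tmul]
    rw [(Submodule.Quotient.mk_eq_zero V).mpr (hr v f hf : rsl v f ∈ V) |> fun h => (h : V.mkQ _ = 0)]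
    simp
  have e1 := lTensor_exact (Sh α) (LinearMap.exact_subtype_mkQ V) V.mkQ_surjective
  obtain ⟨s, hs⟩ := (e1 _).mp h1
  have h3 : V.subtype.lTensor (Sh α ⧸ V) (V.mkQ.rTensor V s) = 0 := by
    rw [← LinearMap.comp_apply, LinearMap.lTensor_comp_rTensor, ← LinearMap.rTensor_comp_lTensor,
      LinearMap.comp_apply, hs, h2]
  have h4 : V.mkQ.rTensor V s = 0 := by
    apply Module.Flat.lTensor_preserves_injective_linearMap (M := Sh α ⧸ V) V.subtype
      V.injective_subtype
    rw [h3, map_zero]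
  have e2 := rTensor_exact V (LinearMap.exact_subtype_mkQ V) V.mkQ_surjective
  obtain ⟨r, hr⟩ := (e2 _).mp h4
  refine ⟨r, ?_⟩
  rw [← hs, ← hr, ← LinearMap.comp_apply, LinearMap.lTensor_comp_rTensor]

/-- The part of weight `n`, when the letter `a` has weight `wt a`: the span of the `f_w` with
`w` a word of total weight `n`. -/
def homog (wt : α → ℕ) (n : ℕ) : Submodule ℚ (Sh α) where
  carrier := {f | ∀ w, coeff w f ≠ 0 → (w.map wt).sum = n}
  add_mem' := by
    intro f g hf hg w hw
    by_cases h : coeff w f = 0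
    · apply hg; rwa [map_add, h, zero_add] at hw
    · exact hf w h
  zero_mem' := by simp
  smul_mem' := by
    intro r f hf w hw
    apply hf
    intro h
    simp [h] at hw

end Sh

/-- A subalgebra of a bialgebra over `ℚ` that is stable under the coproduct is a bialgebra. -/
@[reducible] def Subalgebra.toBialgebra {A : Type} [CommRing A] [Bialgebra ℚ A]
    (S : Subalgebra ℚ A)
    (h : ∀ x ∈ S, Coalgebra.comul (R := ℚ) x ∈ (Algebra.TensorProduct.map S.val S.val).range) :
    Bialgebra ℚ S :=
  have inj : Function.Injective (Algebra.TensorProduct.map S.val S.val) :=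
    TensorProduct.map_injective_of_flat_flat _ _ Subtype.val_injective Subtype.val_injective
  let comulS : S →ₐ[ℚ] S ⊗[ℚ] S :=
    (AlgEquiv.ofInjective _ inj).symm.toAlgHom.comp
      (((Bialgebra.comulAlgHom ℚ A).comp S.val).codRestrict _ fun x => h x x.2)
  have hc : ∀ x : S, Algebra.TensorProduct.map S.val S.val (comulS x) =
      Coalgebra.comul (R := ℚ) (x : A) := fun x =>
    congrArg Subtype.val ((AlgEquiv.ofInjective _ inj).apply_symm_apply _)
  Bialgebra.ofAlgHom comulS ((Bialgebra.counitAlgHom ℚ A).comp S.val)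
    (by
      have inj3 : Function.Injective (Algebra.TensorProduct.map S.val
          (Algebra.TensorProduct.map S.val S.val)) :=
        TensorProduct.map_injective_of_flat_flat _ _ Subtype.val_injective inj
      apply AlgHom.ext
      intro x
      apply inj3
      have k1 : ∀ t : S ⊗[ℚ] S, Algebra.TensorProduct.map S.val
          (Algebra.TensorProduct.map S.val S.val)
          (Algebra.TensorProduct.assoc ℚ ℚ ℚ S S S (Algebra.TensorProduct.map comulS (.id ℚ S) t)) =
          TensorProduct.assoc ℚ A A A ((Coalgebra.comul (R := ℚ)).rTensor A
            (Algebra.TensorProduct.map S.val S.val t)) := by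
        intro t
        induction t with
        | zero => simp
        | add s t hs ht => simp only [map_add, hs, ht]
        | tmul y z =>
          simp only [Algebra.TensorProduct.map_tmul, LinearMap.rTensor_tmul, AlgHom.id_apply]
          have := hc y
          rw [Subalgebra.val_apply, ← this]
          generalize comulS y = r
          induction r with
          | zero => simp
          | add s t hs ht => simp only [map_add, TensorProduct.add_tmul, hs, ht]
          | tmul p q => simp
      have k2 : ∀ t : S ⊗[ℚ] S, Algebra.TensorProduct.map S.val
          (Algebra.TensorProduct.map S.val S.val) (Algebra.TensorProduct.map (.id ℚ S) comulS t) =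
          (Coalgebra.comul (R := ℚ)).lTensor A (Algebra.TensorProduct.map S.val S.val t) := by
        intro t
        induction t with
        | zero => simp
        | add s t hs ht => simp only [map_add, hs, ht]
        | tmul y z => simp [hc]
      change Algebra.TensorProduct.map S.val (Algebra.TensorProduct.map S.val S.val)
          (Algebra.TensorProduct.assoc ℚ ℚ ℚ S S S
            (Algebra.TensorProduct.map comulS (.id ℚ S) (comulS x))) =
        Algebra.TensorProduct.map S.val (Algebra.TensorProduct.map S.val S.val)
          (Algebra.TensorProduct.map (.id ℚ S) comulS (comulS x))
      rw [k1, k2, hc]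
      exact Coalgebra.coassoc_apply _)
    (by
      have inj1 : Function.Injective (Algebra.TensorProduct.map (.id ℚ ℚ) S.val) :=
        TensorProduct.map_injective_of_flat_flat _ _ Function.injective_id Subtype.val_injective
      apply AlgHom.ext
      intro x
      apply inj1
      have k : ∀ t : S ⊗[ℚ] S, Algebra.TensorProduct.map (.id ℚ ℚ) S.val
          (Algebra.TensorProduct.map ((Bialgebra.counitAlgHom ℚ A).comp S.val) (.id ℚ S) t) =
          (Coalgebra.counit (R := ℚ)).rTensor A (Algebra.TensorProduct.map S.val S.val t) := by
        intro t
        induction t with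
        | zero => simp
        | add s t hs ht => simp only [map_add, hs, ht]
        | tmul y z => simp
      change Algebra.TensorProduct.map (.id ℚ ℚ) S.val
          (Algebra.TensorProduct.map ((Bialgebra.counitAlgHom ℚ A).comp S.val) (.id ℚ S)
            (comulS x)) = _
      rw [k, hc, Coalgebra.rTensor_counit_comul]
      simp)
    (by
      have inj1 : Function.Injective (Algebra.TensorProduct.map S.val (.id ℚ ℚ)) :=
        TensorProduct.map_injective_of_flat_flat _ _ Subtype.val_injective Function.injective_id
      apply AlgHom.ext
      intro x
      apply inj1
      have k : ∀ t : S ⊗[ℚ] S, Algebra.TensorProduct.map S.val (.id ℚ ℚ)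
          (Algebra.TensorProduct.map (.id ℚ S) ((Bialgebra.counitAlgHom ℚ A).comp S.val) t) =
          (Coalgebra.counit (R := ℚ)).lTensor A (Algebra.TensorProduct.map S.val S.val t) := by
        intro t
        induction t with
        | zero => simp
        | add s t hs ht => simp only [map_add, hs, ht]
        | tmul y z => simp
      change Algebra.TensorProduct.map S.val (.id ℚ ℚ)
          (Algebra.TensorProduct.map (.id ℚ S) ((Bialgebra.counitAlgHom ℚ A).comp S.val)
            (comulS x)) = _
      rw [k, hc, Coalgebra.lTensor_counit_comul]
      simp)

/-! ### The polylogarithmic Lie algebra and its prounipotent group -/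

/-- The alphabet `Γ = {e₁, e₁₁, e₂, e₂₂, e₁₂}`. -/
inductive Gam : Type
  | e1 | e11 | e2 | e22 | e12

/-- All letters of `Γ` have half-weight one (that is, weight `-1`). -/
def Gam.wt (_ : Gam) : ℕ := 1

namespace PL

section

attribute [local instance 100] LieRing.ofAssociativeRing

/-- The free Lie algebra on `Γ`. -/
abbrev FL : Type := FreeLieAlgebra ℚ Gam

/-- A generator of the free Lie algebra on `Γ`. -/
abbrev g (a : Gam) : FL := FreeLieAlgebra.of ℚ a

/-- The defining relators of `L`. -/
def relators : Set FL :=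
  {⁅g .e1, g .e2⁆, ⁅g .e11, g .e2⁆, ⁅g .e1, g .e22⁆,
    ⁅g .e11, g .e22⁆ - -⁅g .e11, g .e12⁆,
    -⁅g .e11, g .e12⁆ - ⁅g .e22, g .e12⁆,
    ⁅g .e22, g .e12⁆ - ⁅g .e2 - g .e1, g .e12⁆}

/-- The ideal of relations. -/
abbrev relIdeal : LieIdeal ℚ FL := LieSubmodule.lieSpan ℚ FL relators

/-- The Lie algebra `L` on the generators `Γ` with the defining relations. -/
abbrev L : Type := FL ⧸ relIdeal

/-- The image of a generator in `L`. -/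
abbrev gL (a : Gam) : L := LieSubmodule.Quotient.mk (N := relIdeal) (g a)

/-- The Lie ideal `N` of `L` generated by `e₁₁`, `e₂₂`, `e₁₂`. -/
abbrev N : LieIdeal ℚ L := LieSubmodule.lieSpan ℚ L {gL .e11, gL .e22, gL .e12}

/-- The polylogarithmic Lie algebra `L^PL = L / [N, N]`. -/
abbrev LPL : Type := L ⧸ (⁅N, N⁆ : LieIdeal ℚ L)

/-- The image of a generator in `L^PL`. -/
abbrev gPL (a : Gam) : LPL := LieSubmodule.Quotient.mk (N := (⁅N, N⁆ : LieIdeal ℚ L)) (gL a)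

/-- The surjection from `ℚ⟨Γ⟩`, the universal enveloping algebra of the free Lie algebra on `Γ`,
to the universal enveloping algebra of `L^PL`. -/
def toU : FreeAlgebra ℚ Gam →ₐ[ℚ] UniversalEnvelopingAlgebra ℚ LPL :=
  FreeAlgebra.lift ℚ fun a => UniversalEnvelopingAlgebra.ι ℚ (gPL a)

/-- The coproduct of the universal enveloping algebra, for which `L^PL` is primitive. -/
def comulU : UniversalEnvelopingAlgebra ℚ LPL →ₐ[ℚ]
    UniversalEnvelopingAlgebra ℚ LPL ⊗[ℚ] UniversalEnvelopingAlgebra ℚ LPL :=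
  UniversalEnvelopingAlgebra.lift ℚ
    { toFun := fun x => UniversalEnvelopingAlgebra.ι ℚ x ⊗ₜ 1 +
        1 ⊗ₜ UniversalEnvelopingAlgebra.ι ℚ x
      map_add' := by
        intro x y
        simp only [map_add, TensorProduct.add_tmul, TensorProduct.tmul_add]; abel
      map_smul' := by
        intro r x
        simp [TensorProduct.smul_tmul']
      map_lie' := by
        intro x y
        simp only [LieHom.map_lie, Ring.lie_def, mul_add, add_mul,
          Algebra.TensorProduct.tmul_mul_tmul, TensorProduct.sub_tmul, TensorProduct.tmul_sub,
          one_mul, mul_one]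
        abel }

lemma comulU_toU (x : FreeAlgebra ℚ Gam) :
    comulU (toU x) = Algebra.TensorProduct.map toU toU (Sh.unsh x) := by
  suffices h : comulU.comp toU = (Algebra.TensorProduct.map toU toU).comp Sh.unsh from
    DFunLike.congr_fun h x
  ext a
  simp [comulU, toU, Sh.unsh]

/-- The functions on the free prounipotent group on `Γ` that descend to `π^PL`: the linear
functionals on words that vanish on the kernel of `ℚ⟨Γ⟩ → U(L^PL)`. As `f` ranges over
finite combinations of words, these are exactly the continuous linear functionals on the
completed universal enveloping algebra of `L^PL`. -/
def annih : Submodule ℚ (Sh Gam) where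
  carrier := {f | ∀ x, toU x = 0 → Sh.pairing f x = 0}
  add_mem' := by
    intro f g hf hg x hx
    rw [map_add, LinearMap.add_apply, hf x hx, hg x hx, add_zero]
  zero_mem' := by intro x _; simp
  smul_mem' := by
    intro r f hf x hx
    rw [map_smul, LinearMap.smul_apply, hf x hx, smul_zero]

lemma exists_factor {f : Sh Gam} (hf : f ∈ annih) :
    ∃ f' : UniversalEnvelopingAlgebra ℚ LPL →ₗ[ℚ] ℚ, Sh.pairing f = f' ∘ₗ toU.toLinearMap := by
  have h : Sh.pairing f ∈ LinearMap.range toU.toLinearMap.dualMap := by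
    rw [LinearMap.range_dualMap_eq_dualAnnihilator_ker, Submodule.mem_dualAnnihilator]
    exact hf
  obtain ⟨f', hf'⟩ := h
  exact ⟨f', hf'.symm⟩

lemma mul_mem_annih {f g : Sh Gam} (hf : f ∈ annih) (hg : g ∈ annih) : f * g ∈ annih := by
  intro x hx
  obtain ⟨f', hf'⟩ := exists_factor hf
  obtain ⟨g', hg'⟩ := exists_factor hg
  rw [Sh.pairing_mul, hf', hg', TensorProduct.map_comp]
  have h : TensorProduct.map toU.toLinearMap toU.toLinearMap (Sh.unsh x) = comulU (toU x) :=
    (comulU_toU x).symm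
  rw [LinearMap.comp_apply, h, hx]
  simp

/-- The augmentation of the universal enveloping algebra. -/
def augU : UniversalEnvelopingAlgebra ℚ LPL →ₐ[ℚ] ℚ :=
  UniversalEnvelopingAlgebra.lift ℚ 0

lemma one_mem_annih : (1 : Sh Gam) ∈ annih := by
  have h : Sh.pairing (1 : Sh Gam) = (augU.comp toU).toLinearMap := by
    apply Sh.asc_hom_ext
    intro w
    rw [Sh.pairing_asc]
    rcases w with _ | ⟨a, w⟩
    · simp [Sh.one_eq, Sh.coeff_word_self, Sh.asc]
    · rw [Sh.one_eq, Sh.coeff_word_ne (by simp)]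
      simp [Sh.asc, augU, toU]
  intro x hx
  rw [h]
  simp [hx]

end

/-- The coordinate ring `A^PL` of `π^PL`, as a subalgebra of the coordinate ring of the free
prounipotent group on `Γ`. -/
def APL : Subalgebra ℚ (Sh Gam) where
  carrier := annih
  mul_mem' := mul_mem_annih
  add_mem' := annih.add_mem
  algebraMap_mem' r := by
    rw [Algebra.algebraMap_eq_smul_one]
    exact annih.smul_mem r one_mem_annih

/-- The elements of `A^PL` of graded degree `m`. -/
def APLdeg (m : ℕ) : Submodule ℚ (Sh Gam) := APL.toSubmodule ⊓ Sh.homog Gam.wt m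

/-- The subalgebra `A^PL_{[≤ n]}` of `A^PL` generated by the elements of graded degree at most
`n`, the coordinate ring of the quotient `π^PL_{≥ -n}` of `π^PL`. -/
def APLle (n : ℕ) : Subalgebra ℚ (Sh Gam) :=
  Algebra.adjoin ℚ {f | ∃ m ≤ n, f ∈ APLdeg m}

lemma lsl_mem {n : ℕ} (u : List Gam) {f : Sh Gam} (hf : ∃ m ≤ n, f ∈ APLdeg m) :
    ∃ m ≤ n, Sh.lsl u f ∈ APLdeg m := by
  obtain ⟨m, hm, hf, hd⟩ := hf
  refine ⟨m - (u.map Gam.wt).sum, by omega, fun x hx => ?_, fun w hw => ?_⟩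
  · rw [Sh.pairing_lsl]
    exact hf _ (by rw [map_mul, hx, mul_zero])
  · have := hd (u ++ w) (by rwa [Sh.coeff_lsl] at hw)
    rw [List.map_append, List.sum_append] at this
    omega

lemma rsl_mem {n : ℕ} (u : List Gam) {f : Sh Gam} (hf : ∃ m ≤ n, f ∈ APLdeg m) :
    ∃ m ≤ n, Sh.rsl u f ∈ APLdeg m := by
  obtain ⟨m, hm, hf, hd⟩ := hf
  refine ⟨m - (u.map Gam.wt).sum, by omega, fun x hx => ?_, fun w hw => ?_⟩
  · rw [Sh.pairing_rsl]
    exact hf _ (by rw [map_mul, hx, zero_mul])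
  · have := hd (w ++ u) (by rwa [Sh.coeff_rsl] at hw)
    rw [List.map_append, List.sum_append] at this
    omega

lemma comul_mem_APLle (n : ℕ) (x : Sh Gam) (hx : x ∈ APLle n) :
    Coalgebra.comul (R := ℚ) x ∈
      (Algebra.TensorProduct.map (APLle n).val (APLle n).val).range := by
  let V : Submodule ℚ (Sh Gam) := Submodule.span ℚ {f | ∃ m ≤ n, f ∈ APLdeg m}
  have hV : V ≤ (APLle n).toSubmodule := Algebra.span_le_adjoin ℚ _
  have hl : ∀ u, ∀ f ∈ V, Sh.lsl u f ∈ V := fun u f hf =>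
    (Submodule.span_le (p := V.comap (Sh.lsl u))).mpr
      (fun f hf => Submodule.subset_span (lsl_mem u hf)) hf
  have hr : ∀ u, ∀ f ∈ V, Sh.rsl u f ∈ V := fun u f hf =>
    (Submodule.span_le (p := V.comap (Sh.rsl u))).mpr
      (fun f hf => Submodule.subset_span (rsl_mem u hf)) hf
  have key : APLle n ≤ (Algebra.TensorProduct.map (APLle n).val (APLle n).val).range.comap
      (Bialgebra.comulAlgHom ℚ (Sh Gam)) := by
    apply Algebra.adjoin_le
    intro f hf
    obtain ⟨t, ht⟩ := Sh.comulL_mem V hl hr (Submodule.subset_span hf)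
    refine ⟨TensorProduct.map (Submodule.inclusion hV) (Submodule.inclusion hV) t, ?_⟩
    change TensorProduct.map (APLle n).val.toLinearMap (APLle n).val.toLinearMap _ =
      Sh.comulL f
    rw [← ht, ← LinearMap.comp_apply, ← TensorProduct.map_comp]
    rfl
  exact key hx

/-- The bialgebra structure of the Hopf algebra `A^PL_{[≤ n]}`, restricted from that of the
coordinate ring of the free prounipotent group on `Γ`. -/
instance (n : ℕ) : Bialgebra ℚ (APLle n) := Subalgebra.toBialgebra _ (comul_mem_APLle n)

/-- The grading of `A^PL_{[≤ n]}`. -/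
def APLleDeg (n m : ℕ) : Submodule ℚ (APLle n) :=
  (Sh.homog Gam.wt m).comap (APLle n).val.toLinearMap


end PL

/-! ### Functors on algebras -/

/-- The functor of points of the affine `k`-scheme `Spec B`. -/
def pts (k : Type) [CommRing k] (B : Type) [CommRing B] [Algebra k B] :
    CommAlgCat.{u} k ⥤ Type u where
  obj R := B →ₐ[k] R
  map φ := ↾fun x => φ.hom.comp x
  map_id _ := by ext; rfl
  map_comp _ _ := by ext; rfl

/-- The value of a function `b ∈ B` at an `R`-point of `Spec B`. -/
def value {k : Type} [CommRing k] {B : Type} [CommRing B] [Algebra k B] {R : CommAlgCat.{u} k}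
    (b : B) (x : (pts.{u} k B).obj R) : R :=
  DFunLike.coe (F := B →ₐ[k] R) x b

/-- The morphism `Spec θ : Spec C → Spec B` on functors of points. -/
def ptsMap {k : Type} [CommRing k] {B C : Type} [CommRing B] [Algebra k B] [CommRing C]
    [Algebra k C] (θ : B →ₐ[k] C) : pts.{u} k C ⟶ pts.{u} k B where
  app R := ↾fun x => AlgHom.comp (x : C →ₐ[k] R) θ
  naturality _ _ _ := by ext; rfl

/-- Restriction of scalars from `K`-algebras to `k`-algebras. For a functor `F` on `k`-algebras,
the composite `resScalars k K ⋙ F` is the base change `F_K`. -/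
def resScalars (k K : Type) [CommRing k] [CommRing K] [Algebra k K] :
    CommAlgCat.{u} K ⥤ CommAlgCat.{u} k where
  obj R := letI := Algebra.compHom R (algebraMap k K); CommAlgCat.of k R
  map {R S} φ :=
    letI := Algebra.compHom R (algebraMap k K)
    letI := Algebra.compHom S (algebraMap k K)
    CommAlgCat.ofHom { φ.hom.toRingHom with commutes' := fun r => φ.hom.commutes (algebraMap k K r) }
  map_id _ := rfl
  map_comp _ _ := rfl

section Cocycles

variable {A B : Type} [CommRing A] [CommRing B] [Bialgebra ℚ A] [Bialgebra ℚ B]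

/-- The map `R ⊗ A → S ⊗ A` induced by a map `R → S` of algebras. -/
def chg {R S : Type u} [CommRing R] [CommRing S] [Algebra ℚ R] [Algebra ℚ S] (φ : R →ₐ[ℚ] S)
    (A : Type) [CommRing A] [Algebra ℚ A] : R ⊗[ℚ] A →ₐ[ℚ] S ⊗[ℚ] A :=
  Algebra.TensorProduct.map φ (.id ℚ A)

section

variable {R S : Type u} [CommRing R] [CommRing S] [Algebra ℚ R] [Algebra ℚ S] (φ : R →ₐ[ℚ] S)

/-- The base change along `R → S` of an `R`-algebra map `R ⊗ B → R ⊗ A`. -/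
def bcAlg (c : R ⊗[ℚ] B →ₐ[R] R ⊗[ℚ] A) : S ⊗[ℚ] B →ₐ[S] S ⊗[ℚ] A :=
  Algebra.TensorProduct.lift (Algebra.ofId S _)
    (((chg φ A).comp (c.restrictScalars ℚ)).comp Algebra.TensorProduct.includeRight)
    fun _ _ => Commute.all _ _

lemma bcAlg_tmul (c : R ⊗[ℚ] B →ₐ[R] R ⊗[ℚ] A) (s : S) (b : B) :
    bcAlg φ c (s ⊗ₜ b) = s • chg φ A (c (1 ⊗ₜ b)) := by
  simp [bcAlg, Algebra.ofId_apply, Algebra.smul_def]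

lemma chg_smul (r : R) (x : R ⊗[ℚ] A) : chg φ A (r • x) = φ r • chg φ A x := by
  induction x with
  | zero => simp
  | add x y hx hy => simp only [smul_add, map_add, hx, hy]
  | tmul s a => simp [chg, TensorProduct.smul_tmul']

lemma bcAlg_chg (c : R ⊗[ℚ] B →ₐ[R] R ⊗[ℚ] A) (x : R ⊗[ℚ] B) :
    bcAlg φ c (chg φ B x) = chg φ A (c x) := by
  induction x with
  | zero => simp
  | add x y hx hy => simp only [map_add, hx, hy]
  | tmul r b =>
    have : r ⊗ₜ[ℚ] b = r • ((1 : R) ⊗ₜ[ℚ] b) := by simp [TensorProduct.smul_tmul']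
    rw [this, chg_smul, map_smul (bcAlg φ c), map_smul c, chg_smul]
    congr 1
    simp [chg, bcAlg_tmul]

/-- The map `(R ⊗ A) ⊗ (R ⊗ A) → (S ⊗ A) ⊗ (S ⊗ A)` induced by a map `R → S` of algebras. -/
def chg2 (A : Type) [CommRing A] [Algebra ℚ A] :
    (R ⊗[ℚ] A) ⊗[R] (R ⊗[ℚ] A) →+* (S ⊗[ℚ] A) ⊗[S] (S ⊗[ℚ] A) :=
  Algebra.TensorProduct.mapRingHom φ.toRingHom (chg φ A).toRingHom (chg φ A).toRingHom
    (by ext r; simp [chg, Algebra.TensorProduct.algebraMap_apply])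
    (by ext r; simp [chg, Algebra.TensorProduct.algebraMap_apply])

lemma chg2_tmul (x y : R ⊗[ℚ] A) : chg2 φ A (x ⊗ₜ y) = chg φ A x ⊗ₜ chg φ A y := by
  simp [chg2]

lemma chg2_smul (r : R) (x : (R ⊗[ℚ] A) ⊗[R] (R ⊗[ℚ] A)) :
    chg2 φ A (r • x) = φ r • chg2 φ A x := by
  induction x with
  | zero => simp
  | add x y hx hy => simp only [smul_add, map_add, hx, hy]
  | tmul s a => rw [TensorProduct.smul_tmul', chg2_tmul, chg2_tmul, chg_smul,
      TensorProduct.smul_tmul']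

lemma counit_chg (x : R ⊗[ℚ] A) :
    Coalgebra.counit (R := S) (chg φ A x) = φ (Coalgebra.counit (R := R) x) := by
  induction x with
  | zero => simp
  | add x y hx hy => simp only [map_add, hx, hy]
  | tmul r a => simp [chg]

lemma comul_chg (x : R ⊗[ℚ] A) :
    Coalgebra.comul (R := S) (chg φ A x) = chg2 φ A (Coalgebra.comul (R := R) x) := by
  induction x with
  | zero => simp
  | add x y hx hy => simp only [map_add, hx, hy]
  | tmul r a =>
    have h : r ⊗ₜ[ℚ] a = r • ((1 : R) ⊗ₜ[ℚ] a) := by simp [TensorProduct.smul_tmul']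
    rw [h, chg_smul, map_smul, map_smul, chg2_smul]
    congr 1
    have hR := DFunLike.congr_fun (Bialgebra.comul_includeRight (R := ℚ) (A := R) (B := A)) a
    have hS := DFunLike.congr_fun (Bialgebra.comul_includeRight (R := ℚ) (A := S) (B := A)) a
    have hc : chg φ A (1 ⊗ₜ a) = 1 ⊗ₜ a := by simp [chg]
    rw [hc]
    change Coalgebra.comul (R := R) ((1 : R) ⊗ₜ[ℚ] a) = _ at hR
    change Coalgebra.comul (R := S) ((1 : S) ⊗ₜ[ℚ] a) = _ at hS
    rw [hR, hS]
    simp only [RingHom.comp_apply]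
    change _ = chg2 φ A (Algebra.TensorProduct.mapRingHom _ _ _ _ _ (Coalgebra.comul (R := ℚ) a))
    change Algebra.TensorProduct.mapRingHom _ _ _ _ _ (Coalgebra.comul (R := ℚ) a) = _
    generalize Coalgebra.comul (R := ℚ) a = t
    induction t with
    | zero => simp
    | add x y hx hy => simp only [map_add, hx, hy]
    | tmul y z => simp [chg2_tmul, chg]

/-- Base change of homomorphisms of `R`-group schemes. -/
def bc (c : R ⊗[ℚ] B →ₐc[R] R ⊗[ℚ] A) : S ⊗[ℚ] B →ₐc[S] S ⊗[ℚ] A :=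
  .ofAlgHom (bcAlg φ (c : R ⊗[ℚ] B →ₐ[R] R ⊗[ℚ] A))
    (by
      ext b
      have hb : (1 : S) ⊗ₜ[ℚ] b = chg φ B (1 ⊗ₜ b) := by simp [chg]
      change Coalgebra.counit (R := S)
          (bcAlg φ (c : R ⊗[ℚ] B →ₐ[R] R ⊗[ℚ] A) ((1 : S) ⊗ₜ[ℚ] b)) =
        Coalgebra.counit (R := S) ((1 : S) ⊗ₜ[ℚ] b)
      rw [hb, bcAlg_chg, counit_chg, counit_chg]
      congr 1
      exact CoalgHomClass.counit_comp_apply c _)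
    (by
      ext b
      have h : ∀ t, Algebra.TensorProduct.map (bcAlg φ (c : R ⊗[ℚ] B →ₐ[R] R ⊗[ℚ] A))
          (bcAlg φ (c : R ⊗[ℚ] B →ₐ[R] R ⊗[ℚ] A)) (chg2 φ B t) =
          chg2 φ A (Algebra.TensorProduct.map (c : R ⊗[ℚ] B →ₐ[R] R ⊗[ℚ] A)
            (c : R ⊗[ℚ] B →ₐ[R] R ⊗[ℚ] A) t) := by
        intro t
        induction t with
        | zero => simp
        | add x y hx hy => simp only [map_add, hx, hy]
        | tmul y z => simp only [chg2_tmul, Algebra.TensorProduct.map_tmul, bcAlg_chg]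
      have hb : (1 : S) ⊗ₜ[ℚ] b = chg φ B (1 ⊗ₜ b) := by simp [chg]
      change Algebra.TensorProduct.map (bcAlg φ (c : R ⊗[ℚ] B →ₐ[R] R ⊗[ℚ] A))
        (bcAlg φ (c : R ⊗[ℚ] B →ₐ[R] R ⊗[ℚ] A)) (Coalgebra.comul (R := S) ((1 : S) ⊗ₜ[ℚ] b)) =
        Coalgebra.comul (R := S) (bcAlg φ (c : R ⊗[ℚ] B →ₐ[R] R ⊗[ℚ] A) ((1 : S) ⊗ₜ[ℚ] b))
      rw [hb, comul_chg, bcAlg_chg, comul_chg, h]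
      congr 1
      exact CoalgHomClass.map_comp_comul_apply c _)

lemma bc_apply (c : R ⊗[ℚ] B →ₐc[R] R ⊗[ℚ] A) (x : S ⊗[ℚ] B) :
    bc φ c x = bcAlg φ (c : R ⊗[ℚ] B →ₐ[R] R ⊗[ℚ] A) x := rfl

lemma bc_one_tmul (c : R ⊗[ℚ] B →ₐc[R] R ⊗[ℚ] A) (b : B) :
    bc φ c (1 ⊗ₜ b) = chg φ A (c (1 ⊗ₜ b)) := by
  rw [bc_apply, bcAlg_tmul, one_smul]; rfl

lemma chg_mem (M : Submodule ℚ A) {x : R ⊗[ℚ] A} (hx : x ∈ M.baseChange R) :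
    chg φ A x ∈ M.baseChange S := by
  rw [Submodule.baseChange_eq_span] at hx
  induction hx using Submodule.span_induction with
  | mem x h =>
    obtain ⟨a, ha, rfl⟩ := h
    simpa [chg] using Submodule.tmul_mem_baseChange_of_mem (1 : S) ha
  | zero => simp
  | add x y _ _ hx hy => rw [map_add]; exact add_mem hx hy
  | smul r x _ hx => rw [chg_smul]; exact Submodule.smul_mem _ _ hx

lemma bialgHom_ext {c d : R ⊗[ℚ] B →ₐc[R] R ⊗[ℚ] A}
    (h : ∀ b : B, c (1 ⊗ₜ b) = d (1 ⊗ₜ b)) : c = d := by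
  apply DFunLike.ext
  intro x
  induction x with
  | zero => simp
  | add x y hx hy => simp only [map_add, hx, hy]
  | tmul r b =>
    have : r ⊗ₜ[ℚ] b = r • ((1 : R) ⊗ₜ[ℚ] b) := by simp [TensorProduct.smul_tmul']
    rw [this, map_smul, map_smul, h]

end

/-- The equivariant cocycles of `G = Spec A` with values in `H = Spec B` over `R`, for the trivial
action of `G` on `H`, where `A` and `B` are graded (that is, `G` and `H` carry actions of the
multiplicative group). For the trivial action the cocycle condition `c(gh) = c(g) · g(c(h))` says
that `c : G_R → H_R` is a homomorphism of group schemes, i.e. that `c♯ : R ⊗ B → R ⊗ A` is a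
homomorphism of bialgebras; equivariance says that `c♯` preserves the grading. -/
def EqCocycle (𝒜 : ℕ → Submodule ℚ A) (ℬ : ℕ → Submodule ℚ B)
    (R : Type u) [CommRing R] [Algebra ℚ R] : Type u :=
  {c : R ⊗[ℚ] B →ₐc[R] R ⊗[ℚ] A // ∀ n, ∀ b ∈ ℬ n, c (1 ⊗ₜ b) ∈ (𝒜 n).baseChange R}

/-- The functor `Z¹(G, H)^{𝔾ₘ}` on `ℚ`-algebras, sending `R` to the set of equivariant
`R`-cocycles. -/
def Z1 (𝒜 : ℕ → Submodule ℚ A) (ℬ : ℕ → Submodule ℚ B) : CommAlgCat.{u} ℚ ⥤ Type u where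
  obj R := EqCocycle 𝒜 ℬ R
  map φ := ↾fun c => ⟨bc φ.hom c.1, fun n b hb => by
    rw [bc_one_tmul]; exact chg_mem _ _ (c.2 n b hb)⟩
  map_id R := by
    ext c
    apply Subtype.ext
    apply bialgHom_ext
    intro b
    change bc (AlgHom.id ℚ R) c.1 (1 ⊗ₜ b) = c.1 (1 ⊗ₜ b)
    rw [bc_one_tmul]
    simp [chg]
  map_comp {R S T} φ ψ := by
    ext c
    apply Subtype.ext
    apply bialgHom_ext
    intro b
    change bc (ψ.hom.comp φ.hom) c.1 (1 ⊗ₜ b) = bc ψ.hom (bc φ.hom c.1) (1 ⊗ₜ b)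
    rw [bc_one_tmul, bc_one_tmul, bc_one_tmul]
    generalize c.1 (1 ⊗ₜ b) = x
    induction x with
    | zero => simp
    | add x y hx hy => simp only [map_add, hx, hy]
    | tmul r a => simp [chg]

/-- The value `c(γ) ∈ H(R)` of an `R`-cocycle `c` at a point `γ ∈ G(R)`. -/
def evalAt {R : Type u} [CommRing R] [Algebra ℚ R] {𝒜 : ℕ → Submodule ℚ A}
    {ℬ : ℕ → Submodule ℚ B} (γ : A →ₐ[ℚ] R) (c : EqCocycle 𝒜 ℬ R) : B →ₐ[ℚ] R :=
  ((Algebra.TensorProduct.lift (AlgHom.id ℚ R) γ fun _ _ => Commute.all _ _).comp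
    ((c.1 : R ⊗[ℚ] B →ₐ[R] R ⊗[ℚ] A).restrictScalars ℚ)).comp
      Algebra.TensorProduct.includeRight

/-- The evaluation map `ev : G × Z¹(G, H)^{𝔾ₘ} → G × H`, `(γ, c) ↦ (γ, c(γ))`. -/
def ev (𝒜 : ℕ → Submodule ℚ A) (ℬ : ℕ → Submodule ℚ B) :
    FunctorToTypes.prod (pts.{u} ℚ A) (Z1.{u} 𝒜 ℬ) ⟶
      FunctorToTypes.prod (pts.{u} ℚ A) (pts.{u} ℚ B) where
  app R := ↾fun p => (p.1, evalAt (R := R) p.1 p.2)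
  naturality R S φ := by
    ext p
    · rfl
    obtain ⟨(γ : A →ₐ[ℚ] R), c⟩ := p
    apply AlgHom.ext
    intro b
    change Algebra.TensorProduct.lift (AlgHom.id ℚ S) (φ.hom.comp γ)
        (fun _ _ => Commute.all _ _) (bc φ.hom c.1 (1 ⊗ₜ b)) =
      φ.hom (Algebra.TensorProduct.lift (AlgHom.id ℚ R) γ (fun _ _ => Commute.all _ _) (c.1 (1 ⊗ₜ b)))
    rw [bc_one_tmul]
    generalize c.1 (1 ⊗ₜ b) = x
    induction x with
    | zero => simp
    | add x y hx hy => simp only [map_add, hx, hy]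
    | tmul r a => simp [chg]

/-- The `R`-point of `Spec A` given by a map `A → K`, for a `K`-algebra `R`. -/
def basePt {K : Type} [CommRing K] [Algebra ℚ K] (η : A →ₐ[ℚ] K) (R : CommAlgCat.{u} K) :
    (pts.{u} ℚ A).obj ((resScalars ℚ K).obj R) :=
  letI := Algebra.compHom R (algebraMap ℚ K)
  ({ (algebraMap K R) with commutes' := fun _ => rfl } : K →ₐ[ℚ] R).comp η

/-- The morphism `ev_K : Z¹(G, H)^{𝔾ₘ}_K → H_K` obtained from `ev`, a morphism over `G`, by base
change along a `K`-point `η : Spec K → G`: it sends `c` to the `H`-component `c(η)` of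
`ev (η, c)`. -/
def evK (𝒜 : ℕ → Submodule ℚ A) (ℬ : ℕ → Submodule ℚ B) {K : Type} [CommRing K] [Algebra ℚ K]
    (η : A →ₐ[ℚ] K) :
    resScalars.{u} ℚ K ⋙ Z1.{u} 𝒜 ℬ ⟶ resScalars.{u} ℚ K ⋙ pts.{u} ℚ B where
  app R := ↾fun c => ((ev.{u} 𝒜 ℬ).app ((resScalars ℚ K).obj R) (basePt η R, c)).2
  naturality R S φ := by
    ext c
    have h := congrArg (fun F => (F (basePt η R, c)).2) (congrArg DFunLike.coe <|
      congrArg ConcreteCategory.hom ((ev.{u} 𝒜 ℬ).naturality ((resScalars ℚ K).map φ)))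
    refine Eq.trans ?_ h
    have h2 : basePt η S = (pts.{u} ℚ A).map ((resScalars ℚ K).map φ) (basePt η R) := by
      apply AlgHom.ext
      intro a
      exact (φ.hom.commutes (η a)).symm
    change ((ev.{u} 𝒜 ℬ).app ((resScalars ℚ K).obj S)
      (basePt η S, (Z1.{u} 𝒜 ℬ).map ((resScalars ℚ K).map φ) c)).2 = _
    rw [h2]
    rfl

end Cocycles

/-! ### The concrete situation -/

/-- The three generators `τ`, `υ`, `σ`. -/
inductive Sig : Type
  | tau | ups | sig
  deriving DecidableEq

/-- The half-weights (negatives of the weights) of `τ`, `υ`, `σ`. -/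
def Sig.wt : Sig → ℕ
  | .tau => 1
  | .ups => 1
  | .sig => 3

/-- The field `K(τ, υ, σ)`: the fraction field of the coordinate ring of the free prounipotent group
`π(τ, υ, σ)`. -/
abbrev Ktus : Type := FractionRing (Sh Sig)

/-- The generic point `Spec K(τ, υ, σ) → π(τ, υ, σ)`. -/
def genPt : Sh Sig →ₐ[ℚ] Ktus := IsScalarTower.toAlgHom ℚ (Sh Sig) Ktus

/-- The function `f_w` on `π(τ, υ, σ)`, as an element of `K(τ, υ, σ)`. -/
def fK (w : List Sig) : Ktus := algebraMap (Sh Sig) Ktus (Sh.word w)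

/-- Index set for the three families of elements of `Λ`. -/
inductive Fam : Type
  | f11 | f22 | f12
  deriving DecidableEq

/-- The initial letter `e₁₁`, `e₂₂`, `e₁₂` of the family. -/
def Fam.head : Fam → Gam
  | .f11 => .e11
  | .f22 => .e22
  | .f12 => .e12

/-- The element `e₁`, `e₂`, `e₁ + e₂` whose powers follow the initial letter. -/
def Fam.tail : Fam → FreeAlgebra ℚ Gam
  | .f11 => FreeAlgebra.ι ℚ .e1
  | .f22 => FreeAlgebra.ι ℚ .e2
  | .f12 => FreeAlgebra.ι ℚ .e1 + FreeAlgebra.ι ℚ .e2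

/-- The index set `Λ = Λ_{≥ -4}`: besides `e₁` and `e₂` it consists of
`pol .f11 n = e₁₁ e₁ⁿ`, `pol .f22 n = e₂₂ e₂ⁿ`, `pol .f12 n = e₁₂ (e₁ + e₂)ⁿ` for `0 ≤ n ≤ 3`. -/
inductive Lam : Type
  | e1 | e2
  | pol (j : Fam) (n : Fin 4)
  deriving DecidableEq

/-- The element of `ℚ⟨Γ⟩` given by an element of `Λ`. -/
def Lam.poly : Lam → FreeAlgebra ℚ Gam
  | .e1 => FreeAlgebra.ι ℚ .e1
  | .e2 => FreeAlgebra.ι ℚ .e2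
  | .pol j n => FreeAlgebra.ι ℚ j.head * j.tail ^ (n : ℕ)

/-- The half-weight of an element of `Λ`. -/
def Lam.wt : Lam → ℕ
  | .e1 => 1
  | .e2 => 1
  | .pol _ n => n + 1

/-- The index set of the variables `Φ^ρ_λ`: pairs `(ρ, λ)` of equal weight. -/
abbrev PhiIdx : Type := {p : Sig × Lam // p.1.wt = p.2.wt}

/-- The polynomial ring `𝒜 = K(τ, υ, σ)[{f_λ}]`. -/
abbrev Aring : Type := MvPolynomial Lam Ktus

/-- The polynomial ring `𝒮 = K(τ, υ, σ)[{Φ^ρ_λ}]`. -/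
abbrev Sring : Type := MvPolynomial PhiIdx Ktus

/-- The variable `Φ^ρ_λ` of `𝒮` if `ρ` and `λ` have the same weight (and `0` otherwise). -/
def Phi (r : Sig) (l : Lam) : Sring :=
  if h : r.wt = l.wt then MvPolynomial.X ⟨(r, l), h⟩ else 0

/-- `Φ^ρ_{e₁}`, `Φ^ρ_{e₂}`, and `Φ^ρ_{e₁ + e₂} = Φ^ρ_{e₁} + Φ^ρ_{e₂}`. -/
def PhiTail (r : Sig) : Fam → Sring
  | .f11 => Phi r .e1
  | .f22 => Phi r .e2
  | .f12 => Phi r .e1 + Phi r .e2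

/-- The generators `τ`, `υ` of weight `-1`. -/
def tu : Finset Sig := {.tau, .ups}

/-- The values `θ(f_λ)`. -/
def thetaVal : Lam → Sring
  | .e1 => fK [.tau] • Phi .tau .e1 + fK [.ups] • Phi .ups .e1
  | .e2 => fK [.tau] • Phi .tau .e2 + fK [.ups] • Phi .ups .e2
  | .pol j 0 => ∑ a ∈ tu, fK [a] • Phi a (.pol j 0)
  | .pol j 1 => ∑ a ∈ tu, ∑ b ∈ tu, fK [a, b] • (Phi a (.pol j 0) * PhiTail b j)
  | .pol j 2 =>
      ∑ a ∈ tu, ∑ b ∈ tu, ∑ c ∈ tu,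
        fK [a, b, c] • (Phi a (.pol j 0) * PhiTail b j * PhiTail c j) +
      fK [.sig] • Phi .sig (.pol j 2)
  | .pol j 3 =>
      ∑ a ∈ tu, ∑ b ∈ tu, ∑ c ∈ tu, ∑ d ∈ tu,
        fK [a, b, c, d] • (Phi a (.pol j 0) * PhiTail b j * PhiTail c j * PhiTail d j) +
      fK [.sig, .tau] • (Phi .sig (.pol j 2) * PhiTail .tau j) +
      fK [.sig, .ups] • (Phi .sig (.pol j 2) * PhiTail .ups j)

/-- The homomorphism `θ : 𝒜 → 𝒮` of `K(τ, υ, σ)`-algebras. -/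
def theta : Aring →ₐ[Ktus] Sring := MvPolynomial.aeval thetaVal

/-- The functor `Z¹(π(τ, υ, σ), π^PL_{≥ -4})^{𝔾ₘ}` on `ℚ`-algebras. -/
abbrev Z1PL : CommAlgCat.{u} ℚ ⥤ Type u := Z1 (Sh.homog Sig.wt) (PL.APLleDeg 4)

/-- The scheme `π^PL_{≥ -4}`, as a functor on `ℚ`-algebras. -/
abbrev piPL : CommAlgCat.{u} ℚ ⥤ Type u := pts ℚ (PL.APLle 4)

/-- The evaluation map `ev_K` over `K = K(τ, υ, σ)`. -/
abbrev evKtus : resScalars.{u} ℚ Ktus ⋙ Z1PL.{u} ⟶ resScalars.{u} ℚ Ktus ⋙ piPL.{u} :=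
  evK (Sh.homog Sig.wt) (PL.APLleDeg 4) genPt

/-- The coordinate `φ^w_b(c) = ⟨c♯ b, w⟩`: the coefficient of `f_w` in `c♯ b`, for an `R`-cocycle
`c`, a function `b` on `π^PL_{≥ -4}` and a word `w`. -/
def phiCoord {R : Type u} [CommRing R] [Algebra ℚ R] (w : List Sig) (b : PL.APLle 4)
    (c : EqCocycle (Sh.homog Sig.wt) (PL.APLleDeg 4) R) : R :=
  TensorProduct.AlgebraTensorModule.rid ℚ R R ((Sh.coeff w).baseChange R (c.1 (1 ⊗ₜ b)))

end

/-!
In `L^PL` the ideal generated by `e₁₁`, `e₂₂`, `e₁₂` becomes abelian, and the relations say that it is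
the module over `ℚ[e₁, e₂]` spanned by the iterated brackets of `h` with `t`, for the three pairs
`(h, t) = (e₁₁, e₁), (e₂₂, e₂), (e₁₂, e₁ + e₂)`. The functions `f_{e₁}`, `f_{e₂}`, `f_{h tⁿ}` are
coordinates on the corresponding group, and the proof consists in making this explicit in degrees at
most `4`, without the Poincaré-Birkhoff-Witt theorem.

* The generating function `∑ f_{h tⁿ} Xⁿ` is a matrix coefficient of a representation of `L^PL` by
  upper triangular `2 × 2` matrices over `ℚ[X]`; hence the `f_{h tⁿ}` descend to `π^PL`
  (`PL.mem_annih_of_rder`, `PL.fpol_mem_annih`).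
* The free Lie algebra acts on the shuffle algebra by derivations, a letter acting by its removal from
  the end of words (`PL.der`). On functions on `π^PL` this action factors through `L^PL`
  (`PL.der_congr`). The brackets `adHead j n` act by derivations dual to the `f_{h tⁿ}`
  (`PL.hder_fpol`), which yields algebraic independence of the `f_λ`
  (`PL.algebraicIndependent_fLam`).
* The `f_λ` generate: the Euler vector field, written through these derivations, multiplies a function
  of degree `m ≤ 4` by `m` (`PL.euler_eq`), and so expresses it through functions of lower degree
  (`PL.APLle_eq_adjoin`). Thus `A^PL_{[≤ 4]}` is the polynomial ring in the `f_λ` (`PL.polyEquiv`).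
* Let `φ^ρ` be the coefficient of `f_ρ` in `c♯`. Compatibility of `c♯` with coproducts says that the
  translate of `c♯ b` removing a final letter `ρ` is obtained from the coproduct of `b` by applying
  `c♯` to the first and `φ^ρ` to the second factor. As `φ^ρ` is a derivation over the counit, this is a
  recursion determining the `c♯ f_λ` from the coordinates `Φ^ρ_λ` (`PL.image_coords`). Conversely,
  the values given by the recursion, extended multiplicatively, are compatible with the coproducts
  (`PL.comul_coact`); here the Rota-Baxter identity of the operator `Sh.integ` is what identifies its
  iterates on `1` with divided powers (`iterate_one_of_rotaBaxter`). So cocycles correspond to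
  families of coordinates (`PL.cocycleEquiv`).
* Solving the recursion and evaluating at the generic point gives `θ` (`PL.evalPt_image`).
-/

open CategoryTheory
open scoped TensorProduct

noncomputable section

/-! ### Right translations of the shuffle algebra -/

namespace Sh

variable {α : Type}

lemma rsl_lsl (u v : List α) (f : Sh α) : rsl v (lsl u f) = lsl u (rsl v f) :=
  ext_coeff fun w => by simp only [coeff_rsl, coeff_lsl, List.append_assoc]

lemma coeff_letter (a : α) (f : Sh α) : coeff [a] f = coeff [] (lsl [a] f) := rfl

/-- The coefficient of a letter is a derivation over the counit. -/
lemma coeff_letter_mul (a : α) (f g : Sh α) :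
    coeff [a] (f * g) = coeff [a] f * coeff [] g + coeff [] f * coeff [a] g := by
  rw [coeff_letter, lsl_mul, map_add, coeff_nil_mul, coeff_nil_mul]; rfl

/-- Removing a final letter is a derivation of the shuffle product. -/
lemma rsl_mul (a : α) (f g : Sh α) :
    rsl [a] (f * g) = rsl [a] f * g + f * rsl [a] g := by
  apply ext_coeff
  intro w
  induction w generalizing f g with
  | nil =>
    rw [coeff_rsl, map_add, coeff_nil_mul, coeff_nil_mul]
    exact coeff_letter_mul a f g
  | cons b w ih =>
    simp only [coeff_cons, ← rsl_lsl, lsl_mul, map_add, ih]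
    ring

/-- Right translation by the letter `a`, that is removal of a final letter `a`, as a derivation
of the shuffle algebra. -/
def rder (a : α) : Derivation ℚ (Sh α) (Sh α) :=
  Derivation.mk' (rsl [a]) fun f g => by
    rw [rsl_mul, smul_eq_mul, smul_eq_mul, add_comm, mul_comm g]

lemma rder_apply (a : α) (f : Sh α) : rder a f = rsl [a] f := rfl

lemma coeff_rder (a : α) (w : List α) (f : Sh α) : coeff w (rder a f) = coeff (w ++ [a]) f := rfl

/-- An element is determined by its constant term and its right translates. -/
lemma ext_rder {f g : Sh α} (h0 : coeff [] f = coeff [] g) (h : ∀ a, rder a f = rder a g) :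
    f = g := by
  apply ext_coeff
  intro w
  rcases List.eq_nil_or_concat' w with rfl | ⟨v, a, rfl⟩
  · exact h0
  · rw [← coeff_rder, ← coeff_rder, h]

/-- Appending the letter `a` to every word. -/
def post (a : α) : Sh α →ₗ[ℚ] Sh α := (basis α).constr ℚ fun w => word (w ++ [a])

lemma post_word (a : α) (w : List α) : post a (word w) = word (w ++ [a]) := by
  simp [post, word]

lemma coeff_post_nil (a : α) (f : Sh α) : coeff [] (post a f) = 0 := by
  suffices h : coeff [] ∘ₗ post a = 0 from LinearMap.congr_fun h f
  apply hom_ext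
  intro w
  simp [post_word, coeff_word_ne]

lemma rder_post [DecidableEq α] (a b : α) (f : Sh α) :
    rder a (post b f) = if a = b then f else 0 := by
  suffices h : (rder a : Sh α →ₗ[ℚ] Sh α) ∘ₗ post b = if a = b then .id else 0 by
    have := LinearMap.congr_fun h f
    split_ifs at this ⊢ <;> exact this
  apply hom_ext
  intro w
  apply ext_coeff
  intro v
  change coeff v (rder a (post b (word w))) = _
  rw [post_word, coeff_rder, coeff_word]
  split_ifs with h1 h2 h2
  · simp_all [coeff_word]
  · simp_all
  · have : w ≠ v := by rintro rfl; simp_all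
    simp [coeff_word, this]
  · simp

lemma coeff_append_post [DecidableEq α] (a b : α) (w : List α) (f : Sh α) :
    coeff (w ++ [a]) (post b f) = if a = b then coeff w f else 0 := by
  rw [← coeff_rder, rder_post]; split_ifs <;> simp

/-- The operators `post a` satisfy the Rota-Baxter identity of integration. -/
lemma post_mul_post (a b : α) (f g : Sh α) :
    post a f * post b g = post a (f * post b g) + post b (post a f * g) := by
  classical
  apply ext_rder
  · simp [coeff_nil_mul, coeff_post_nil]
  · intro c
    simp only [Derivation.leibniz, map_add, rder_post, smul_eq_mul]
    split_ifs <;> ring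

lemma comulL_post (a : α) (f : Sh α) :
    comulL (post a f) = post a f ⊗ₜ 1 + (post a).lTensor (Sh α) (comulL f) := by
  suffices h : comulL ∘ₗ post a = (TensorProduct.mk ℚ (Sh α) (Sh α)).flip 1 ∘ₗ post a +
      (post a).lTensor (Sh α) ∘ₗ comulL from LinearMap.congr_fun h f
  apply hom_ext
  intro w
  simp only [LinearMap.comp_apply, LinearMap.add_apply, post_word, comulL_word, map_sum,
    LinearMap.lTensor_tmul, TensorProduct.mk_apply, LinearMap.flip_apply]
  rw [List.length_append, List.length_singleton, Finset.sum_range_succ, add_comm]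
  congr 1
  · rw [List.take_of_length_le (by simp), List.drop_of_length_le (by simp), one_eq]
  · apply Finset.sum_congr rfl
    intro i hi
    have hi : i ≤ w.length := by simpa [Nat.lt_succ_iff] using hi
    rw [List.take_append_of_le_length hi, List.drop_append_of_le_length hi]

lemma fn_mul_ι (x : FreeAlgebra ℚ α) (a : α) :
    fn (x * FreeAlgebra.ι ℚ a) = post a (fn x) := by
  suffices h : fn ∘ₗ LinearMap.mulRight ℚ (FreeAlgebra.ι ℚ a) = post a ∘ₗ fn from
    LinearMap.congr_fun h x
  apply asc_hom_ext
  intro w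
  have h1 : asc w * FreeAlgebra.ι ℚ a = asc (w ++ [a]) := by simp [asc]
  simp only [LinearMap.comp_apply, LinearMap.mulRight_apply, h1, fn_asc, post_word]

lemma fn_ι (a : α) : fn (FreeAlgebra.ι ℚ a) = word [a] := by
  rw [← fn_asc]; simp [asc]

lemma post_one (a : α) : post a 1 = word [a] := post_word a []

/-! #### Weights -/

lemma word_mem_homog (wt : α → ℕ) (w : List α) : word w ∈ homog wt (w.map wt).sum := by
  classical
  intro v hv
  rw [coeff_word] at hv
  have : w = v := by by_contra h; simp [h] at hv
  rw [this]

lemma one_mem_homog (wt : α → ℕ) : (1 : Sh α) ∈ homog wt 0 := word_mem_homog wt []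

lemma post_mem_homog {wt : α → ℕ} {n : ℕ} {f : Sh α} (a : α) (hf : f ∈ homog wt n) :
    post a f ∈ homog wt (n + wt a) := by
  classical
  intro w hw
  rcases List.eq_nil_or_concat' w with rfl | ⟨v, b, rfl⟩
  · exact absurd (coeff_post_nil a f) hw
  · rw [coeff_append_post] at hw
    split_ifs at hw with h
    · subst h; simp [hf v hw]
    · exact absurd rfl hw

lemma mul_mem_homog {wt : α → ℕ} {m n : ℕ} {f g : Sh α} (hf : f ∈ homog wt m)
    (hg : g ∈ homog wt n) : f * g ∈ homog wt (m + n) := by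
  intro w
  induction w generalizing f g m n with
  | nil =>
    intro hw
    rw [coeff_nil_mul] at hw
    have h1 := hf [] (left_ne_zero_of_mul hw)
    have h2 := hg [] (right_ne_zero_of_mul hw)
    simp_all
  | cons a w ih =>
    intro hw
    have key : ∀ {k : ℕ} {h : Sh α}, h ∈ homog wt k → lsl [a] h ∈ homog wt (k - wt a) ∧
        (lsl [a] h ≠ 0 → wt a ≤ k) := by
      intro k h hh
      refine ⟨fun v hv => ?_, fun hne => ?_⟩
      · have := hh (a :: v) hv
        simp at this; omega
      · by_contra hlt
        apply hne
        apply ext_coeff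
        intro v
        by_contra hv
        have := hh (a :: v) (by simpa [coeff_lsl] using hv)
        simp at this; omega
    rw [coeff_cons, lsl_mul, map_add] at hw
    by_cases h1 : coeff w (lsl [a] f * g) = 0
    · rw [h1, zero_add] at hw
      have h2 := ih hf (key hg).1 hw
      have h3 := (key hg).2 (by rintro h; simp [h] at hw)
      simp; omega
    · have h2 := ih (key hf).1 hg h1
      have h3 := (key hf).2 (by rintro h; simp [h] at h1)
      simp; omega

end Sh

/-! ### Functions that descend to the polylogarithmic quotient -/

instance : DecidableEq Gam := fun a b => by
  cases a <;> cases b <;> first | exact isTrue rfl | exact isFalse nofun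

namespace PL

section

attribute [local instance 100] LieRing.ofAssociativeRing

/-- A homomorphism from `ℚ⟨Γ⟩` to an algebra `T` factors through `U(L^PL)` if it respects the
relations of `L` and maps `N` to a commutative subalgebra. The latter is ensured by a homomorphism
`d` from `T` to a commutative algebra that kills the images of the generators of `N` and whose
kernel is commutative. -/
lemma lift_eq_zero_of_toU_eq_zero {T C : Type} [Ring T] [Algebra ℚ T] [CommRing C] [Algebra ℚ C]
    (d : T →ₐ[ℚ] C) (hd : ∀ x y, d x = 0 → d y = 0 → x * y = y * x) (c : Gam → T)
    (h11 : d (c .e11) = 0) (h22 : d (c .e22) = 0) (h12 : d (c .e12) = 0)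
    (r1 : Commute (c .e1) (c .e2)) (r2 : Commute (c .e11) (c .e2))
    (r3 : Commute (c .e1) (c .e22)) (r4 : Commute (c .e2 - c .e1) (c .e12))
    (x : FreeAlgebra ℚ Gam) (hx : toU x = 0) : FreeAlgebra.lift ℚ c x = 0 := by
  have hlie : ∀ {x y : T}, Commute x y → ⁅x, y⁆ = 0 := fun h => by
    rw [Ring.lie_def, h.eq, sub_self]
  have hcomm : ∀ x y, d x = 0 → d y = 0 → ⁅x, y⁆ = 0 := fun x y h h' => hlie (hd x y h h')
  have r4' : ⁅c .e2, c .e12⁆ - ⁅c .e1, c .e12⁆ = 0 := by rw [← sub_lie, hlie r4]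
  let φ : FL →ₗ⁅ℚ⁆ T := FreeLieAlgebra.lift ℚ c
  have hφ : ∀ a, φ (g a) = c a := fun a => FreeLieAlgebra.lift_of_apply c a
  have hrel : relIdeal ≤ φ.ker := by
    rw [LieSubmodule.lieSpan_le]
    rintro y (rfl | rfl | rfl | rfl | rfl | rfl) <;>
      simp only [SetLike.mem_coe, LieHom.mem_ker, LieHom.map_lie, map_sub, map_neg, hφ, hlie r1, hlie r2, hlie r3,
        hcomm _ _ h11 h22, hcomm _ _ h11 h12, hcomm _ _ h22 h12, neg_zero, sub_self,
        sub_lie, r4']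
  let φL : L →ₗ⁅ℚ⁆ T :=
    { (relIdeal.toSubmodule.liftQ φ.toLinearMap fun y hy => hrel hy) with
      map_lie' := by
        rintro ⟨y⟩ ⟨z⟩
        exact φ.map_lie y z }
  have hφL : ∀ a, φL (gL a) = c a := hφ
  -- The target of `d` is abelian as a Lie algebra, so that the kernel below is a Lie ideal.
  let I : LieIdeal ℚ L := (d.toLieHom.comp φL).ker
  have hN : N ≤ I := by
    rw [LieSubmodule.lieSpan_le]
    rintro y (rfl | rfl | rfl)
    · change d (φL _) = 0; rw [hφL, h11]
    · change d (φL _) = 0; rw [hφL, h22]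
    · change d (φL _) = 0; rw [hφL, h12]
  have hNN : (⁅N, N⁆ : LieIdeal ℚ L) ≤ φL.ker := by
    rw [LieSubmodule.lie_le_iff]
    intro y hy z hz
    rw [LieHom.mem_ker, LieHom.map_lie]
    exact hcomm _ _ (hN hy) (hN hz)
  let φP : LPL →ₗ⁅ℚ⁆ T :=
    { ((⁅N, N⁆ : LieIdeal ℚ L).toSubmodule.liftQ φL.toLinearMap fun y hy => hNN hy) with
      map_lie' := by
        rintro ⟨y⟩ ⟨z⟩
        exact φL.map_lie y z }
  have hφP : ∀ a, φP (gPL a) = c a := hφL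
  have key : FreeAlgebra.lift ℚ c = (UniversalEnvelopingAlgebra.lift ℚ φP).comp toU := by
    ext a
    simp [toU, hφP]
  rw [key, AlgHom.comp_apply, hx, map_zero]

end

open Polynomial in
/-- The algebra of upper triangular `2 × 2` matrices over `ℚ[X]`. -/
def upperTri : Subalgebra ℚ (Matrix (Fin 2) (Fin 2) ℚ[X]) where
  carrier := {m | m 1 0 = 0}
  mul_mem' := by
    intro a b (ha : a 1 0 = 0) (hb : b 1 0 = 0)
    simp [Matrix.mul_apply, ha, hb]
  add_mem' := by
    intro a b (ha : a 1 0 = 0) (hb : b 1 0 = 0)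
    simp [ha, hb]
  algebraMap_mem' r := by simp [Matrix.algebraMap_matrix_apply]

open Polynomial in
/-- The two diagonal entries of an upper triangular matrix. -/
def upperTri.diag : upperTri →ₐ[ℚ] ℚ[X] × ℚ[X] where
  toFun m := (m.1 0 0, m.1 1 1)
  map_one' := by simp
  map_mul' a b := by
    have ha : a.1 1 0 = 0 := a.2
    have hb : b.1 1 0 = 0 := b.2
    simp [Matrix.mul_apply, ha, hb]
  map_zero' := by simp
  map_add' a b := by simp
  commutes' r := by simp [Matrix.algebraMap_matrix_apply]

lemma upperTri.mul_comm_of_diag (x y : upperTri) (hx : upperTri.diag x = 0)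
    (hy : upperTri.diag y = 0) : x * y = y * x := by
  have hx0 : x.1 0 0 = 0 := congrArg Prod.fst hx
  have hx1 : x.1 1 1 = 0 := congrArg Prod.snd hx
  have hy0 : y.1 0 0 = 0 := congrArg Prod.fst hy
  have hy1 : y.1 1 1 = 0 := congrArg Prod.snd hy
  have hx2 : x.1 1 0 = 0 := x.2
  have hy2 : y.1 1 0 = 0 := y.2
  apply Subtype.ext
  ext i j : 1
  fin_cases i <;> fin_cases j <;> simp [Matrix.mul_apply, *]

open Polynomial in
/-- The matrix with first row `(0, b)` and second row `(0, s X)`. -/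
def letterMat (b s : ℚ) : upperTri := ⟨!![0, C b; 0, C s * X], by simp [upperTri]⟩

open Polynomial in
lemma mul_letterMat (m : upperTri) (b s : ℚ) :
    (m * letterMat b s).1 0 0 = 0 ∧
      (m * letterMat b s).1 0 1 = C b * m.1 0 0 + C s * X * m.1 0 1 := by
  simp [letterMat, Matrix.mul_apply, mul_comm (C b), mul_comm (C s * X)]

/-- Two of these matrices commute as soon as the commutator, which is strictly upper triangular,
vanishes. -/
lemma letterMat_mul_comm (b s b' s' : ℚ) (h : b * s' = b' * s) :
    letterMat b s * letterMat b' s' = letterMat b' s' * letterMat b s := by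
  have h' : Polynomial.C b * Polynomial.C s' = Polynomial.C b' * Polynomial.C s := by
    rw [← map_mul, ← map_mul, h]
  apply Subtype.ext
  ext i j : 1
  fin_cases i <;> fin_cases j
  · simp [letterMat]
  · simpa [letterMat, ← mul_assoc] using congrArg (· * Polynomial.X) h'
  · simp [letterMat]
  · simp [letterMat]; ring

/-- A family of functions `f 0, f 1, …` whose right translates are governed by scalars `b`, `s`
attached to the letters: the generating function `∑ f n Xⁿ` is a matrix coefficient of a
representation of `L^PL` by upper triangular matrices, so that the `f n` descend to `π^PL`. -/
lemma mem_annih_of_rder (b s : Gam → ℚ) (f : ℕ → Sh Gam)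
    (h0 : ∀ n, Sh.coeff [] (f n) = 0) (hz : ∀ a, Sh.rder a (f 0) = b a • 1)
    (hs : ∀ a n, Sh.rder a (f (n + 1)) = s a • f n)
    (s11 : s .e11 = 0) (s22 : s .e22 = 0) (s12 : s .e12 = 0)
    (r1 : b .e1 * s .e2 = b .e2 * s .e1) (r2 : b .e11 * s .e2 = 0) (r3 : b .e22 * s .e1 = 0)
    (r4 : b .e12 * (s .e2 - s .e1) = 0) (n : ℕ) : f n ∈ annih := by
  let c : Gam → upperTri := fun a => letterMat (b a) (s a)
  have hdiag : ∀ a, s a = 0 → upperTri.diag (c a) = 0 := by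
    intro a ha
    apply Prod.ext
    · rfl
    · change Polynomial.C (s a) * Polynomial.X = (0 : Polynomial ℚ)
      rw [ha, map_zero, zero_mul]
  have hsub : c .e2 - c .e1 = letterMat (b .e2 - b .e1) (s .e2 - s .e1) := by
    apply Subtype.ext
    ext i j : 1
    fin_cases i <;> fin_cases j <;> simp [c, letterMat, sub_mul]
  let coef : Matrix (Fin 2) (Fin 2) (Polynomial ℚ) →ₗ[ℚ] ℚ :=
    Polynomial.lcoeff ℚ n ∘ₗ Matrix.entryLinearMap ℚ (Polynomial ℚ) 0 1
  -- The first row of the matrix of a word `w` is `(coeff w 1, ∑ coeff w (f n) Xⁿ)`.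
  have key : ∀ w : List Gam, (FreeAlgebra.lift ℚ c (Sh.asc w)).1 0 0 = Polynomial.C (Sh.coeff w 1) ∧
      ∀ n, ((FreeAlgebra.lift ℚ c (Sh.asc w)).1 0 1).coeff n = Sh.coeff w (f n) := by
    intro w
    induction w using List.reverseRecOn with
    | nil => simp [Sh.asc, h0, Sh.one_eq, Sh.coeff_word_self]
    | append_singleton w a ih =>
      have hw : FreeAlgebra.lift ℚ c (Sh.asc (w ++ [a])) =
          FreeAlgebra.lift ℚ c (Sh.asc w) * letterMat (b a) (s a) := by
        rw [Sh.asc_append, map_mul]; simp [Sh.asc, c]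
      rw [hw]
      refine ⟨?_, fun n => ?_⟩
      · rw [(mul_letterMat _ _ _).1, Sh.one_eq, Sh.coeff_word_ne (by simp), map_zero]
      · rw [(mul_letterMat _ _ _).2, ih.1, ← Sh.coeff_rder]
        rcases n with _ | n
        · simp [hz]
        · rw [hs, Polynomial.coeff_add, mul_assoc, Polynomial.coeff_C_mul, Polynomial.coeff_C_mul,
            Polynomial.coeff_X_mul, ih.2, Polynomial.coeff_C_succ]
          simp
  have hpair : Sh.pairing (f n) = coef ∘ₗ upperTri.val.toLinearMap ∘ₗ
      (FreeAlgebra.lift ℚ c).toLinearMap := by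
    apply Sh.asc_hom_ext
    intro w
    rw [Sh.pairing_asc]
    exact ((key w).2 n).symm
  intro x hx
  have hlie := letterMat_mul_comm
  have h := lift_eq_zero_of_toU_eq_zero upperTri.diag upperTri.mul_comm_of_diag c
    (hdiag _ s11) (hdiag _ s22) (hdiag _ s12)
    (hlie _ _ _ _ r1) (hlie _ _ _ _ (by rw [r2, s11, mul_zero]))
    (hlie _ _ _ _ (by rw [r3, s22, mul_zero]))
    (by rw [hsub]; exact hlie _ _ _ _ (by rw [r4, s12, mul_zero])) x hx
  rw [hpair]
  simp [h]

end PL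

/-- The coefficient of a letter in the element `e₁`, `e₂`, `e₁ + e₂` attached to the family. -/
def Fam.slope : Fam → Gam → ℚ
  | .f11, .e1 => 1
  | .f22, .e2 => 1
  | .f12, .e1 => 1
  | .f12, .e2 => 1
  | _, _ => 0

namespace PL

open Sh

/-- The function `f_{h tⁿ}`, where `h` and `t` are the initial letter and the tail of the
family. -/
def fpol (j : Fam) (n : ℕ) : Sh Gam := fn (FreeAlgebra.ι ℚ j.head * j.tail ^ n)

/-- The function `f_t`, where `t` is the tail of the family. -/
def ftail (j : Fam) : Sh Gam := fn j.tail

lemma ftail_eq (j : Fam) :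
    ftail j = j.slope .e1 • word [.e1] + j.slope .e2 • word [.e2] := by
  cases j <;> simp [ftail, Fam.tail, Fam.slope, fn_ι]

lemma fpol_zero (j : Fam) : fpol j 0 = word [j.head] := by simp [fpol, fn_ι]

lemma fpol_succ (j : Fam) (n : ℕ) :
    fpol j (n + 1) = j.slope .e1 • post .e1 (fpol j n) + j.slope .e2 • post .e2 (fpol j n) := by
  cases j <;>
    simp only [fpol, pow_succ, ← mul_assoc, Fam.tail, Fam.slope, mul_add, map_add, fn_mul_ι,
      one_smul, zero_smul, add_zero, zero_add]

lemma rder_fpol_zero (a : Gam) (j : Fam) :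
    rder a (fpol j 0) = if a = j.head then 1 else 0 := by
  rw [fpol_zero, ← post_one, rder_post]

lemma rder_fpol_succ (a : Gam) (j : Fam) (n : ℕ) :
    rder a (fpol j (n + 1)) = j.slope a • fpol j n := by
  rw [fpol_succ, map_add, Derivation.map_smul, Derivation.map_smul, rder_post, rder_post]
  cases j <;> cases a <;> simp [Fam.slope]

lemma rder_ftail (a : Gam) (j : Fam) : rder a (ftail j) = j.slope a • 1 := by
  rw [ftail_eq, map_add, Derivation.map_smul, Derivation.map_smul, ← post_one, ← post_one, rder_post, rder_post]
  cases j <;> cases a <;> simp [Fam.slope]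

lemma coeff_nil_fpol (j : Fam) (n : ℕ) : coeff [] (fpol j n) = 0 := by
  cases n with
  | zero => rw [fpol_zero, coeff_word_ne (by simp)]
  | succ n => rw [fpol_succ, map_add, map_smul, map_smul, coeff_post_nil, coeff_post_nil]; simp

lemma coeff_nil_ftail (j : Fam) : coeff [] (ftail j) = 0 := by
  rw [ftail_eq, map_add, map_smul, map_smul, coeff_word_ne (by simp), coeff_word_ne (by simp)]
  simp

lemma fpol_mem_annih (j : Fam) (n : ℕ) : fpol j n ∈ annih := by
  apply mem_annih_of_rder (fun a => if a = j.head then 1 else 0) j.slope (fpol j)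
    (coeff_nil_fpol j) (fun a => by rw [rder_fpol_zero]; split_ifs <;> simp)
    (fun a n => rder_fpol_succ a j n)
  all_goals cases j <;> simp [Fam.slope, Fam.head]

lemma word_mem_annih (a : Gam) : word [a] ∈ annih := by
  -- With `s = 0` the representation is the additive character dual to the letter `a`.
  refine mem_annih_of_rder (fun c => if c = a then 1 else 0) 0
    (fun n => if n = 0 then word [a] else 0) (fun n => ?_) (fun c => ?_) (fun c n => ?_)
    rfl rfl rfl ?_ ?_ ?_ ?_ 0
  · split_ifs <;> simp [coeff_word_ne]
  · rw [if_pos rfl, ← post_one, rder_post]; split_ifs <;> simp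
  all_goals simp

lemma fpol_mem_homog (j : Fam) (n : ℕ) : fpol j n ∈ homog Gam.wt (n + 1) := by
  induction n with
  | zero => rw [fpol_zero]; exact word_mem_homog _ _
  | succ n ih =>
    rw [fpol_succ]
    exact add_mem (Submodule.smul_mem _ _ (post_mem_homog _ ih))
      (Submodule.smul_mem _ _ (post_mem_homog _ ih))

/-- The function `f_λ` for `λ ∈ Λ`. -/
def fLam (l : Lam) : Sh Gam := fn l.poly

lemma fLam_e1 : fLam .e1 = word [.e1] := fn_ι _

lemma fLam_e2 : fLam .e2 = word [.e2] := fn_ι _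

lemma fLam_pol (j : Fam) (n : Fin 4) : fLam (.pol j n) = fpol j n := rfl

lemma fLam_mem_APLdeg (l : Lam) : fLam l ∈ APLdeg l.wt := by
  cases l with
  | e1 => exact fLam_e1 ▸ ⟨word_mem_annih _, word_mem_homog _ _⟩
  | e2 => exact fLam_e2 ▸ ⟨word_mem_annih _, word_mem_homog _ _⟩
  | pol j n => exact ⟨fpol_mem_annih j n, fpol_mem_homog j n⟩

lemma wt_le_four (l : Lam) : l.wt ≤ 4 := by
  cases l with
  | e1 => simp [Lam.wt]
  | e2 => simp [Lam.wt]
  | pol j n => simp only [Lam.wt]; omega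

lemma fLam_mem_APLle (l : Lam) : fLam l ∈ APLle 4 :=
  Algebra.subset_adjoin ⟨l.wt, wt_le_four l, fLam_mem_APLdeg l⟩

end PL

/-! ### The differentiation action of the polylogarithmic Lie algebra -/

/-- The letter whose iterated adjoint action on the initial letter of the family produces the
elements of `L^PL` dual to the functions of the family. -/
def Fam.dir : Fam → Gam
  | .f11 => .e1
  | .f22 => .e2
  | .f12 => .e1

namespace PL

open Sh

section

attribute [local instance 100] LieRing.ofAssociativeRing

/-- The action of the free Lie algebra on the functions by right invariant differentiation. -/
def der : FL →ₗ⁅ℚ⁆ Derivation ℚ (Sh Gam) (Sh Gam) := FreeLieAlgebra.lift ℚ rder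

lemma der_g (a : Gam) : der (g a) = rder a := FreeLieAlgebra.lift_of_apply _ _

lemma der_lie (x y : FL) (f : Sh Gam) : der ⁅x, y⁆ f = der x (der y f) - der y (der x f) := by
  rw [LieHom.map_lie, Derivation.commutator_apply]

/-- The embedding of the free Lie algebra into `ℚ⟨Γ⟩`. -/
def toFree : FL →ₗ⁅ℚ⁆ FreeAlgebra ℚ Gam := FreeLieAlgebra.lift ℚ (FreeAlgebra.ι ℚ)

lemma toFree_g (a : Gam) : toFree (g a) = FreeAlgebra.ι ℚ a := FreeLieAlgebra.lift_of_apply _ _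

/-- Differentiation is the transpose of right multiplication. -/
lemma pairing_der (x : FL) (f : Sh Gam) (y : FreeAlgebra ℚ Gam) :
    pairing (der x f) y = pairing f (y * toFree x) := by
  let S : LieSubalgebra ℚ FL :=
    { carrier := {x | ∀ f y, pairing (der x f) y = pairing f (y * toFree x)}
      add_mem' := by
        intro x x' hx hx' f y
        rw [map_add, Derivation.add_apply, map_add, LinearMap.add_apply, hx, hx', map_add,
          mul_add, map_add]
      zero_mem' := by intro f y; simp
      smul_mem' := by
        intro r x hx f y
        rw [map_smul, Derivation.smul_apply, map_smul, LinearMap.smul_apply, hx, map_smul,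
          mul_smul_comm, map_smul]
      lie_mem' := by
        intro x x' hx hx' f y
        rw [der_lie, map_sub, LinearMap.sub_apply, hx, hx', hx', hx, LieHom.map_lie, Ring.lie_def,
          mul_sub, map_sub, mul_assoc, mul_assoc] }
  have hg : ∀ a, g a ∈ S := by
    intro a f y
    rw [der_g, rder_apply, pairing_rsl, toFree_g]
    simp [asc]
  let F : FL →ₗ⁅ℚ⁆ S := FreeLieAlgebra.lift ℚ fun a => ⟨g a, hg a⟩
  have hF : S.incl.comp F = LieHom.id := by
    apply FreeLieAlgebra.hom_ext
    intro a
    change S.incl (F (g a)) = g a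
    rw [FreeLieAlgebra.lift_of_apply]; rfl
  have hx : S.incl (F x) = x := DFunLike.congr_fun hF x
  exact (hx ▸ (F x).2 : x ∈ S) f y

/-- The projection of the free Lie algebra onto `L^PL`. -/
def toLPL : FL →ₗ⁅ℚ⁆ LPL :=
  { toFun := fun x => LieSubmodule.Quotient.mk (N := (⁅N, N⁆ : LieIdeal ℚ L))
      (LieSubmodule.Quotient.mk (N := relIdeal) x)
    map_add' := fun _ _ => rfl
    map_smul' := fun _ _ => rfl
    map_lie' := rfl }

lemma toU_toFree (x : FL) : toU (toFree x) = UniversalEnvelopingAlgebra.ι ℚ (toLPL x) := by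
  suffices h : toU.toLieHom.comp toFree = (UniversalEnvelopingAlgebra.ι ℚ).comp toLPL from
    DFunLike.congr_fun h x
  apply FreeLieAlgebra.hom_ext
  intro a
  change toU (toFree (g a)) = UniversalEnvelopingAlgebra.ι ℚ (gPL a)
  rw [toFree_g]; simp [toU]

lemma der_mem_annih {f : Sh Gam} (hf : f ∈ annih) (x : FL) : der x f ∈ annih := by
  intro y hy
  rw [pairing_der]
  exact hf _ (by rw [map_mul, hy, zero_mul])

lemma rder_mem_annih {f : Sh Gam} (hf : f ∈ annih) (a : Gam) : rder a f ∈ annih := by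
  rw [← der_g]; exact der_mem_annih hf _

/-- On functions on `π^PL` the differentiation action factors through `L^PL`. -/
lemma der_congr {x y : FL} (h : toLPL x = toLPL y) {f : Sh Gam} (hf : f ∈ annih) :
    der x f = der y f := by
  rw [← sub_eq_zero, ← Derivation.sub_apply, ← map_sub]
  apply ext_coeff
  intro w
  rw [← pairing_asc, pairing_der, map_zero]
  apply hf
  rw [map_mul, toU_toFree, map_sub, h, sub_self, map_zero, mul_zero]

/-- The iterated brackets `[…[[h, a], a], …, a]` of the initial letter `h` of the family with the
letter `a`; they span the part of `L^PL` coming from `h`. -/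
def adHead (j : Fam) : ℕ → FL
  | 0 => g j.head
  | n + 1 => ⁅adHead j n, g j.dir⁆

lemma toLPL_of_relator {x : FL} (hx : x ∈ relators) : toLPL x = 0 := by
  have : (LieSubmodule.Quotient.mk (N := relIdeal) x : L) = 0 :=
    LieSubmodule.Quotient.mk_eq_zero'.mpr (LieSubmodule.subset_lieSpan hx)
  change LieSubmodule.Quotient.mk (N := (⁅N, N⁆ : LieIdeal ℚ L)) _ = 0
  rw [this]; rfl

lemma mk_adHead_mem (j : Fam) (n : ℕ) :
    (LieSubmodule.Quotient.mk (N := relIdeal) (adHead j n) : L) ∈ N := by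
  induction n with
  | zero => cases j <;> exact LieSubmodule.subset_lieSpan (by simp [adHead, Fam.head])
  | succ n ih => exact lie_mem_left ℚ L N _ (gL j.dir) ih

lemma toLPL_lie_adHead (j k : Fam) (m n : ℕ) : toLPL ⁅adHead j m, adHead k n⁆ = 0 :=
  LieSubmodule.Quotient.mk_eq_zero'.mpr
    (LieSubmodule.lie_mem_lie (mk_adHead_mem j m) (mk_adHead_mem k n))

lemma toLPL_e1_e2 : ⁅toLPL (g .e1), toLPL (g .e2)⁆ = 0 := by
  rw [← LieHom.map_lie]; exact toLPL_of_relator (by simp [relators])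

lemma toLPL_lie_head (j : Fam) {a : Gam} (ha : a = .e1 ∨ a = .e2) :
    ⁅toLPL (g j.head), toLPL (g a)⁆ = j.slope a • ⁅toLPL (g j.head), toLPL (g j.dir)⁆ := by
  have h1 : ⁅toLPL (g .e11), toLPL (g .e2)⁆ = 0 := by
    rw [← LieHom.map_lie]; exact toLPL_of_relator (by simp [relators])
  have h2 : ⁅toLPL (g .e22), toLPL (g .e1)⁆ = 0 := by
    rw [← lie_skew, ← LieHom.map_lie, neg_eq_zero]; exact toLPL_of_relator (by simp [relators])
  have h3 : ⁅toLPL (g .e12), toLPL (g .e2)⁆ = ⁅toLPL (g .e12), toLPL (g .e1)⁆ := by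
    have h4 : toLPL (⁅g .e22, g .e12⁆ - ⁅g .e2 - g .e1, g .e12⁆) = 0 :=
      toLPL_of_relator (by simp [relators])
    have h5 : toLPL ⁅g .e22, g .e12⁆ = 0 := toLPL_lie_adHead .f22 .f12 0 0
    rw [map_sub, h5, zero_sub, neg_eq_zero, LieHom.map_lie, map_sub, sub_lie, ← lie_skew,
      ← lie_skew (toLPL (g .e1)), sub_neg_eq_add, neg_add_eq_zero] at h4
    exact h4
  rcases ha with rfl | rfl <;> cases j <;>
    simp only [Fam.head, Fam.slope, Fam.dir, one_smul, zero_smul, h1, h2, h3]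

/-- In `L^PL` the letters `e₁` and `e₂` act on the part coming from the family through the slopes
of its tail. -/
lemma toLPL_lie_adHead_g (j : Fam) (n : ℕ) {a : Gam} (ha : a = .e1 ∨ a = .e2) :
    toLPL ⁅adHead j n, g a⁆ = j.slope a • toLPL (adHead j (n + 1)) := by
  have hd : ⁅toLPL (g j.dir), toLPL (g a)⁆ = 0 := by
    have h12 := toLPL_e1_e2
    have h21 : ⁅toLPL (g .e2), toLPL (g .e1)⁆ = 0 := by rw [← lie_skew, h12, neg_zero]
    rcases ha with rfl | rfl <;> cases j <;> simp only [Fam.dir, lie_self, h12, h21]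
  induction n with
  | zero => simp only [adHead, LieHom.map_lie]; exact toLPL_lie_head j ha
  | succ n ih =>
    have e1 : toLPL (adHead j (n + 1)) = ⁅toLPL (adHead j n), toLPL (g j.dir)⁆ :=
      LieHom.map_lie _ _ _
    have e2 : toLPL (adHead j (n + 2)) = ⁅toLPL (adHead j (n + 1)), toLPL (g j.dir)⁆ :=
      LieHom.map_lie _ _ _
    rw [LieHom.map_lie] at ih ⊢
    rw [e2, e1, lie_lie, hd, lie_zero, zero_sub, ih, ← lie_skew, neg_neg, smul_lie, e1]

end

/-- The derivation given by the element `adHead j n` of `L^PL`. -/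
def hder (j : Fam) (n : ℕ) : Derivation ℚ (Sh Gam) (Sh Gam) := der (adHead j n)

lemma hder_zero (j : Fam) : hder j 0 = rder j.head := der_g _

lemma hder_succ (j : Fam) (n : ℕ) (f : Sh Gam) :
    hder j (n + 1) f = hder j n (rder j.dir f) - rder j.dir (hder j n f) := by
  rw [hder, adHead, der_lie, der_g]; rfl

lemma gam_cases (a : Gam) : (a = .e1 ∨ a = .e2) ∨ ∃ k : Fam, a = k.head := by
  cases a
  · exact .inl (.inl rfl)
  · exact .inr ⟨.f11, rfl⟩
  · exact .inl (.inr rfl)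
  · exact .inr ⟨.f22, rfl⟩
  · exact .inr ⟨.f12, rfl⟩

lemma slope_head (j k : Fam) : j.slope k.head = 0 := by cases j <;> cases k <;> rfl

lemma slope_dir (j : Fam) : j.slope j.dir = 1 := by cases j <;> rfl

lemma head_injective {j k : Fam} (h : j.head = k.head) : j = k := by
  cases j <;> cases k <;> simp_all [Fam.head]

lemma rder_hder {f : Sh Gam} (hf : f ∈ annih) (a : Gam) (j : Fam) (n : ℕ) :
    rder a (hder j n f) = hder j n (rder a f) - j.slope a • hder j (n + 1) f := by
  have h0 : hder j n (rder a f) - rder a (hder j n f) = der ⁅adHead j n, g a⁆ f := by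
    rw [der_lie, der_g]; rfl
  have h1 : der ⁅adHead j n, g a⁆ f = j.slope a • hder j (n + 1) f := by
    rcases gam_cases a with ha | ⟨k, rfl⟩
    · rw [der_congr (y := j.slope a • adHead j (n + 1)) (by
        rw [toLPL_lie_adHead_g j n ha, map_smul]) hf, map_smul]; rfl
    · rw [slope_head, zero_smul, der_congr (y := 0) (by
        rw [map_zero]; exact toLPL_lie_adHead j k n 0) hf, map_zero]; rfl
  rw [← h1, ← h0]; abel

lemma rder_e1_e2 {f : Sh Gam} (hf : f ∈ annih) : rder .e1 (rder .e2 f) = rder .e2 (rder .e1 f) := by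
  rw [← sub_eq_zero, ← der_g, ← der_g, ← der_lie, der_congr (y := 0) _ hf, map_zero]
  · rfl
  · rw [map_zero, LieHom.map_lie, toLPL_e1_e2]

lemma rder_head_rder {f : Sh Gam} (hf : f ∈ annih) (k : Fam) (a : Gam) :
    rder k.head (rder a f) = rder a (rder k.head f) + k.slope a • hder k 1 f := by
  have := rder_hder hf a k 0
  rw [hder_zero] at this
  rw [this]; abel

/-! #### Values on the generators -/

lemma hder_ftail (k : Fam) (n : ℕ) (j : Fam) : hder k n (ftail j) = 0 := by
  induction n with
  | zero => rw [hder_zero, rder_ftail, slope_head, zero_smul]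
  | succ n ih =>
    rw [hder_succ, ih, map_zero, rder_ftail, Derivation.map_smul, Derivation.map_one_eq_zero,
      smul_zero, sub_zero]

lemma hder_word_e (k : Fam) (n : ℕ) {a : Gam} (ha : a = .e1 ∨ a = .e2) :
    hder k n (word [a]) = 0 := by
  have h1 : ftail .f11 = word [.e1] := by simp [ftail_eq, Fam.slope]
  have h2 : ftail .f22 = word [.e2] := by simp [ftail_eq, Fam.slope]
  rcases ha with rfl | rfl
  · rw [← h1, hder_ftail]
  · rw [← h2, hder_ftail]

/-- The derivations `hder k n` are dual to the functions `f_{h tⁿ}`. -/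
lemma hder_fpol (k : Fam) (n : ℕ) (j : Fam) (m : ℕ) :
    hder k n (fpol j m) = if k = j ∧ n = m then 1 else 0 := by
  induction n generalizing m with
  | zero =>
    rw [hder_zero]
    cases m with
    | zero =>
      rw [rder_fpol_zero]
      simp only [and_true]
      exact if_congr ⟨head_injective, congrArg _⟩ rfl rfl
    | succ m => rw [rder_fpol_succ, slope_head]; simp
  | succ n ih =>
    have h0 : rder k.dir (hder k n (fpol j m)) = 0 := by
      rw [ih]; split_ifs
      · exact (rder _).map_one_eq_zero
      · exact map_zero _
    rw [hder_succ, h0, sub_zero]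
    cases m with
    | zero =>
      have : k.dir ≠ j.head := by cases j <;> cases k <;> simp [Fam.dir, Fam.head]
      rw [rder_fpol_zero, if_neg this]; simp
    | succ m =>
      rw [rder_fpol_succ, Derivation.map_smul, ih]
      by_cases h : k = j
      · subst h; simp [slope_dir]
      · simp [h]

end PL

/-! ### The coordinate ring is a polynomial ring -/

namespace PL

open Sh

/-- The contribution of the functions of the family to the Euler vector field, in degrees at
most `4`. -/
def eulerFam (j : Fam) (f : Sh Gam) : Sh Gam :=
  ∑ n ∈ Finset.range 4, ((n : Sh Gam) + 1) * (fpol j n * hder j n f) -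
    ftail j * ∑ n ∈ Finset.range 3, fpol j n * hder j (n + 1) f

/-- The Euler vector field of `π^PL` in degrees at most `4`, written in terms of the right
invariant vector fields. -/
def euler (f : Sh Gam) : Sh Gam :=
  word [.e1] * rder .e1 f + word [.e2] * rder .e2 f +
    (eulerFam .f11 f + eulerFam .f22 f + eulerFam .f12 f)

/-- The commutator of a letter with the contribution of the family: for the letters `e₁`, `e₂` the
sums telescope, and what remains involves only `hder j 4`. -/
lemma rder_eulerFam (a : Gam) (j : Fam) {f : Sh Gam} (hf : f ∈ annih) (h4 : hder j 4 f = 0) :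
    rder a (eulerFam j f) = eulerFam j (rder a f) +
      if a = j.head then hder j 0 f - ftail j * hder j 1 f else 0 := by
  have hn : ∀ n : ℕ, rder a (n : Sh Gam) = 0 := fun n => (rder a).map_natCast n
  simp only [eulerFam, Finset.sum_range_succ, Finset.sum_range_zero, zero_add, map_add, map_sub,
    Derivation.leibniz, rder_fpol_zero, rder_fpol_succ, rder_ftail, rder_hder hf, smul_eq_mul, hn,
    h4, (rder a).map_one_eq_zero]
  rcases gam_cases a with ha | ⟨k, rfl⟩
  · have : a ≠ j.head := by rcases ha with rfl | rfl <;> cases j <;> simp [Fam.head]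
    simp only [if_neg this, Algebra.smul_def]
    push_cast
    ring
  · simp only [slope_head, zero_smul]
    split_ifs <;> (push_cast; ring)

/-- In degrees at most `4` the Euler field satisfies `[∂ₐ, E] = ∂ₐ` for every letter `a`. -/
lemma rder_euler (a : Gam) {f : Sh Gam} (hf : f ∈ annih) (h4 : ∀ j, hder j 4 f = 0) :
    rder a (euler f) = euler (rder a f) + rder a f := by
  have hw : ∀ b c : Gam, rder b (word [c]) = if b = c then 1 else 0 := fun b c => by
    rw [← post_one, rder_post]
  have h1 := fun k => rder_head_rder hf k .e1
  have h2 := fun k => rder_head_rder hf k .e2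
  simp only [euler, map_add, Derivation.leibniz, smul_eq_mul, hw, rder_eulerFam a _ hf (h4 _)]
  rcases gam_cases a with (rfl | rfl) | ⟨k, rfl⟩
  · simp [Fam.head, rder_e1_e2 hf]; ring
  · simp [Fam.head, rder_e1_e2 hf]; ring
  · rw [h1 k, h2 k]
    cases k <;>
      simp [Fam.head, Fam.slope, ftail_eq, hder_zero] <;> ring

lemma rder_mem_homog {m : ℕ} {f : Sh Gam} (hf : f ∈ homog Gam.wt m) (a : Gam) :
    rder a f ∈ homog Gam.wt (m - 1) := by
  intro w hw
  have := hf (w ++ [a]) (by rwa [← coeff_rder])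
  simp [Gam.wt] at this ⊢
  omega

lemma eq_smul_one_of_homog {f : Sh Gam} (hf : f ∈ homog Gam.wt 0) : f = coeff [] f • 1 := by
  apply ext_coeff
  intro w
  rw [map_smul, one_eq]
  rcases w with _ | ⟨a, w⟩
  · simp [coeff_word_self]
  · rw [coeff_word_ne (by simp), smul_zero]
    by_contra h
    have := hf _ h
    simp [Gam.wt] at this

lemma rder_eq_zero_of_homog {f : Sh Gam} (hf : f ∈ homog Gam.wt 0) (a : Gam) : rder a f = 0 := by
  rw [eq_smul_one_of_homog hf, Derivation.map_smul, Derivation.map_one_eq_zero, smul_zero]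

lemma rder_mem_APLdeg {m : ℕ} {f : Sh Gam} (hf : f ∈ APLdeg m) (a : Gam) :
    rder a f ∈ APLdeg (m - 1) :=
  ⟨rder_mem_annih hf.1 a, rder_mem_homog hf.2 a⟩

lemma hder_mem_APLdeg (j : Fam) (n : ℕ) {m : ℕ} {f : Sh Gam} (hf : f ∈ APLdeg m) :
    hder j n f ∈ APLdeg (m - (n + 1)) := by
  induction n generalizing m f with
  | zero => rw [hder_zero]; exact rder_mem_APLdeg hf _
  | succ n ih =>
    rw [hder_succ]
    have h1 : m - 1 - (n + 1) = m - (n + 1 + 1) := by omega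
    have h2 : m - (n + 1) - 1 = m - (n + 1 + 1) := by omega
    exact sub_mem (h1 ▸ ih (rder_mem_APLdeg hf _)) (h2 ▸ rder_mem_APLdeg (ih hf) _)

lemma hder_eq_zero (j : Fam) {n m : ℕ} (h : m ≤ n) {f : Sh Gam} (hf : f ∈ APLdeg m) :
    hder j n f = 0 := by
  induction n generalizing m f with
  | zero =>
    obtain rfl : m = 0 := by omega
    rw [hder_zero, rder_eq_zero_of_homog hf.2]
  | succ n ih =>
    have h1 : hder j n f ∈ APLdeg 0 := by
      have := hder_mem_APLdeg j n hf
      rwa [Nat.sub_eq_zero_of_le (by omega)] at this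
    rw [hder_succ, ih (by omega) (rder_mem_APLdeg hf _), rder_eq_zero_of_homog h1.2, sub_zero]

/-- Euler's identity for functions on `π^PL` of degree at most `4`. Both sides have the same right
translates by induction, and no constant term in positive degree. -/
lemma euler_eq {m : ℕ} (hm : m ≤ 4) {f : Sh Gam} (hf : f ∈ APLdeg m) : euler f = m * f := by
  induction m generalizing f with
  | zero =>
    have h : ∀ j n, hder j n f = 0 := fun j n => hder_eq_zero j (Nat.zero_le n) hf
    simp [euler, eulerFam, h, rder_eq_zero_of_homog hf.2]
  | succ m ih =>
    apply ext_rder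
    · have h0 : coeff [] f = 0 := by
        by_contra h
        have := hf.2 [] h
        simp at this
      simp [euler, eulerFam, coeff_nil_mul, coeff_nil_ftail, coeff_nil_fpol, coeff_word_ne, h0]
    · intro a
      have hn : rder a ((m + 1 : ℕ) : Sh Gam) = 0 := (rder a).map_natCast _
      rw [rder_euler a hf.1 (fun j => hder_eq_zero j hm hf),
        ih (by omega) (rder_mem_APLdeg hf a), Derivation.leibniz, hn]
      simp
      ring

/-- Euler's identity expresses a function of degree `m > 0` through the `f_λ` and functions of lower
degree. -/
lemma APLdeg_le_adjoin {m : ℕ} (hm : m ≤ 4) {f : Sh Gam} (hf : f ∈ APLdeg m) :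
    f ∈ Algebra.adjoin ℚ (Set.range fLam) := by
  induction m using Nat.strong_induction_on generalizing f with
  | _ m ih =>
    set P := Algebra.adjoin ℚ (Set.range fLam)
    have hz : ∀ l, fLam l ∈ P := fun l => Algebra.subset_adjoin ⟨l, rfl⟩
    have hu : ∀ j, ∀ n < 4, fpol j n ∈ P := fun j n hn => hz (.pol j ⟨n, hn⟩)
    have ht : ∀ j, ftail j ∈ P := fun j => by
      rw [ftail_eq, ← fLam_e1, ← fLam_e2]
      exact add_mem (P.smul_mem (hz _) _) (P.smul_mem (hz _) _)
    rcases Nat.eq_zero_or_pos m with rfl | hpos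
    · rw [eq_smul_one_of_homog hf.2]
      exact P.smul_mem P.one_mem _
    have hr : ∀ a, rder a f ∈ P := fun a => ih (m - 1) (by omega) (by omega) (rder_mem_APLdeg hf a)
    have hd : ∀ j n, hder j n f ∈ P := fun j n =>
      ih (m - (n + 1)) (by omega) (by omega) (hder_mem_APLdeg j n hf)
    have hE : ∀ j, eulerFam j f ∈ P := fun j =>
      sub_mem (sum_mem fun n hn => mul_mem (add_mem (natCast_mem P n) P.one_mem)
        (mul_mem (hu j n (Finset.mem_range.mp hn)) (hd j n)))
        (mul_mem (ht j) (sum_mem fun n hn =>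
          mul_mem (hu j n ((Finset.mem_range.mp hn).trans (by norm_num))) (hd j (n + 1))))
    have hmem : euler f ∈ P := by
      refine add_mem (add_mem (mul_mem ?_ (hr _)) (mul_mem ?_ (hr _)))
        (add_mem (add_mem (hE _) (hE _)) (hE _))
      · rw [← fLam_e1]; exact hz _
      · rw [← fLam_e2]; exact hz _
    rw [euler_eq hm hf] at hmem
    have : f = (m : ℚ)⁻¹ • ((m : Sh Gam) * f) := by
      rw [← nsmul_eq_mul, ← Nat.cast_smul_eq_nsmul ℚ, smul_smul,
        inv_mul_cancel₀ (by positivity), one_smul]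
    rw [this]
    exact P.smul_mem hmem _

lemma APLle_eq_adjoin : APLle 4 = Algebra.adjoin ℚ (Set.range fLam) := by
  apply le_antisymm
  · exact Algebra.adjoin_le fun f ⟨m, hm, hf⟩ => APLdeg_le_adjoin hm hf
  · exact Algebra.adjoin_le fun f ⟨l, hl⟩ => hl ▸ fLam_mem_APLle l

/-! #### Algebraic independence -/

/-- The derivation `∂/∂f_{eᵢ}`, in the coordinates `f_λ`. -/
def dLamE (a : Gam) : Derivation ℚ (Sh Gam) (Sh Gam) :=
  rder a - ∑ j ∈ {Fam.f11, Fam.f22, Fam.f12}, ∑ n ∈ Finset.range 3,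
    (j.slope a • fpol j n) • hder j (n + 1)

/-- Derivations of the shuffle algebra restricting to the partial derivatives `∂/∂f_λ`. -/
def dLam : Lam → Derivation ℚ (Sh Gam) (Sh Gam)
  | .e1 => dLamE .e1
  | .e2 => dLamE .e2
  | .pol j n => hder j n

lemma dLamE_apply (a : Gam) (f : Sh Gam) : dLamE a f = rder a f -
    ∑ j ∈ {Fam.f11, Fam.f22, Fam.f12}, ∑ n ∈ Finset.range 3,
      (j.slope a • fpol j n) * hder j (n + 1) f := by
  have hs : ∀ (s : Finset ℕ) (F : ℕ → Derivation ℚ (Sh Gam) (Sh Gam)),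
      (∑ n ∈ s, F n) f = ∑ n ∈ s, F n f := fun s F => by
    rw [← Derivation.coeFnAddMonoidHom_apply, map_sum, Finset.sum_apply]; rfl
  simp [dLamE, Derivation.sub_apply, hs]

lemma dLamE_fpol {a : Gam} (ha : a = .e1 ∨ a = .e2) (j : Fam) (n : Fin 4) :
    dLamE a (fpol j n) = 0 := by
  have h0 : a ≠ j.head := by rcases ha with rfl | rfl <;> cases j <;> simp [Fam.head]
  rw [dLamE_apply]
  simp only [hder_fpol]
  fin_cases n
  · simp [rder_fpol_zero, h0]
  · simp only [rder_fpol_succ]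
    cases j <;> simp [Finset.sum_range_succ]
  · simp only [rder_fpol_succ]
    cases j <;> simp [Finset.sum_range_succ]
  · simp only [rder_fpol_succ]
    cases j <;> simp [Finset.sum_range_succ]

lemma dLamE_word (a : Gam) {b : Gam} (hb : b = .e1 ∨ b = .e2) :
    dLamE a (word [b]) = if a = b then 1 else 0 := by
  rw [dLamE_apply]
  simp only [hder_word_e _ _ hb]
  simp [← post_one, rder_post]

lemma dLam_fLam (l m : Lam) : dLam l (fLam m) = if l = m then 1 else 0 := by
  rcases l with _ | _ | ⟨j, n⟩ <;> rcases m with _ | _ | ⟨k, m⟩ <;>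
    simp only [dLam, fLam_e1, fLam_e2, fLam_pol, dLamE_word _ (.inl rfl), dLamE_word _ (.inr rfl),
      dLamE_fpol (.inl rfl), dLamE_fpol (.inr rfl), hder_word_e _ _ (.inl rfl),
      hder_word_e _ _ (.inr rfl), hder_fpol] <;> simp [Fin.ext_iff]

/-- Elements in the kernel of an augmentation for which there are dual derivations are algebraically
independent: the derivations and the augmentation recover the coefficients of a polynomial. -/
lemma algebraicIndependent_of_derivation {A ι : Type} [CommRing A] [Algebra ℚ A]
    [DecidableEq ι] (z : ι → A) (ε : A →ₐ[ℚ] ℚ) (hε : ∀ i, ε (z i) = 0)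
    (d : ι → Derivation ℚ A A)
    (h : ∀ i j, d i (z j) = if i = j then 1 else 0) : AlgebraicIndependent ℚ z := by
  rw [algebraicIndependent_iff]
  -- The derivations act on polynomial expressions as the partial derivatives.
  have hd : ∀ (i : ι) (p : MvPolynomial ι ℚ),
      d i (MvPolynomial.aeval z p) = MvPolynomial.aeval z (MvPolynomial.pderiv i p) := by
    intro i p
    induction p using MvPolynomial.induction_on with
    | C a => simp
    | add p q hp hq => simp only [map_add, hp, hq]
    | mul_X p j hp =>
      simp only [map_mul, Derivation.leibniz, MvPolynomial.aeval_X, hp, h, smul_eq_mul, map_add,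
        MvPolynomial.pderiv_X, Pi.single_apply]
      by_cases hij : i = j
      · simp [hij]
      · simp [hij, Ne.symm hij]
  suffices H : ∀ n, ∀ m : ι →₀ ℕ, m.degree = n → ∀ p : MvPolynomial ι ℚ,
      MvPolynomial.aeval z p = 0 → p.coeff m = 0 from
    fun p hp => MvPolynomial.ext _ _ fun m => H _ m rfl p hp
  intro n
  induction n with
  | zero =>
    intro m hm p hp
    rw [Finsupp.degree_eq_zero_iff] at hm
    have h1 := congrArg ε hp
    rw [map_zero, ← AlgHom.comp_apply, MvPolynomial.comp_aeval] at h1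
    have h2 : (fun i => ε (z i)) = 0 := funext hε
    rw [h2, MvPolynomial.aeval_zero] at h1
    rw [hm]
    exact h1
  | succ n ih =>
    intro m hm p hp
    obtain ⟨i, hi⟩ : ∃ i, m i ≠ 0 := by
      by_contra! h0
      have : m = 0 := Finsupp.ext h0
      simp [this] at hm
    have hle : Finsupp.single i 1 ≤ m := by
      rw [Finsupp.single_le_iff]; omega
    have hsub : m - Finsupp.single i 1 + Finsupp.single i 1 = m := tsub_add_cancel_of_le hle
    have hdeg : (m - Finsupp.single i 1).degree = n := by
      have := congrArg Finsupp.degree hsub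
      rw [map_add, Finsupp.degree_single, hm] at this
      omega
    have h1 := ih _ hdeg (MvPolynomial.pderiv i p) (by rw [← hd, hp, map_zero])
    rw [MvPolynomial.coeff_pderiv, hsub] at h1
    exact (mul_eq_zero.mp h1).resolve_right (by positivity)

lemma algebraicIndependent_fLam : AlgebraicIndependent ℚ fLam := by
  refine algebraicIndependent_of_derivation fLam counitA (fun l => ?_) dLam dLam_fLam
  change coeff [] (fLam l) = 0
  cases l with
  | e1 => rw [fLam_e1, coeff_word_ne (by simp)]
  | e2 => rw [fLam_e2, coeff_word_ne (by simp)]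
  | pol j n => exact coeff_nil_fpol j n

/-- `f_λ` as an element of `A^PL_{[≤ 4]}`. -/
def fPL (l : Lam) : APLle 4 := ⟨fLam l, fLam_mem_APLle l⟩

/-- `A^PL_{[≤ 4]}` is the polynomial ring in the `f_λ`. -/
def polyEquiv : MvPolynomial Lam ℚ ≃ₐ[ℚ] APLle 4 :=
  algebraicIndependent_fLam.aevalEquiv.trans (Subalgebra.equivOfEq _ _ APLle_eq_adjoin.symm)

lemma polyEquiv_X (l : Lam) : polyEquiv (MvPolynomial.X l) = fPL l := by
  apply Subtype.ext
  change ((algebraicIndependent_fLam.aevalEquiv (MvPolynomial.X l) :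
    Algebra.adjoin ℚ (Set.range fLam)) : Sh Gam) = fLam l
  simp

lemma polyEquiv_eq_aeval (p : MvPolynomial Lam ℚ) : polyEquiv p = MvPolynomial.aeval fPL p := by
  have : (polyEquiv : MvPolynomial Lam ℚ →ₐ[ℚ] APLle 4) = MvPolynomial.aeval fPL :=
    MvPolynomial.algHom_ext fun l => by simp [polyEquiv_X]
  exact DFunLike.congr_fun this p

/-- Homomorphisms out of `A^PL_{[≤ 4]}` are determined by their values on the `f_λ`. -/
lemma algHom_ext_fPL {T : Type*} [Semiring T] [Algebra ℚ T] {F G : APLle 4 →ₐ[ℚ] T}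
    (h : ∀ l, F (fPL l) = G (fPL l)) : F = G := by
  have : F.comp (polyEquiv : MvPolynomial Lam ℚ →ₐ[ℚ] APLle 4) =
      G.comp (polyEquiv : MvPolynomial Lam ℚ →ₐ[ℚ] APLle 4) :=
    MvPolynomial.algHom_ext fun l => by simp [polyEquiv_X, h]
  ext b
  obtain ⟨p, rfl⟩ := polyEquiv.surjective b
  exact DFunLike.congr_fun this p

/-- The homomorphism out of `A^PL_{[≤ 4]}` with prescribed values on the `f_λ`. -/
def liftPL {T : Type*} [CommRing T] [Algebra ℚ T] (v : Lam → T) : APLle 4 →ₐ[ℚ] T :=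
  (MvPolynomial.aeval v).comp (polyEquiv.symm : APLle 4 →ₐ[ℚ] MvPolynomial Lam ℚ)

lemma liftPL_fPL {T : Type*} [CommRing T] [Algebra ℚ T] (v : Lam → T) (l : Lam) :
    liftPL v (fPL l) = v l := by
  have : polyEquiv.symm (fPL l) = MvPolynomial.X l := by rw [← polyEquiv_X]; simp
  simp [liftPL, this]

end PL

/-! ### Shuffle algebras over a base ring -/

namespace Sh

section BaseChange

variable {α : Type} (R : Type u) [CommRing R] [Algebra ℚ R]

/-- The coefficient of `f_w`, with values in a `ℚ`-algebra `R`. -/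
def coeffR (w : List α) : R ⊗[ℚ] Sh α →ₗ[R] R :=
  (TensorProduct.AlgebraTensorModule.rid ℚ R R).toLinearMap ∘ₗ (coeff w).baseChange R

/-- Appending the letter `a`, over `R`. -/
def postR (a : α) : R ⊗[ℚ] Sh α →ₗ[R] R ⊗[ℚ] Sh α := (post a).baseChange R

/-- Removing a final letter `a`, over `R`. -/
def rslR (a : α) : R ⊗[ℚ] Sh α →ₗ[R] R ⊗[ℚ] Sh α := (rsl [a]).baseChange R

/-- The function `f_w`, over `R`. -/
def wordR (w : List α) : R ⊗[ℚ] Sh α := 1 ⊗ₜ word w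

variable {R}

lemma coeffR_tmul (w : List α) (r : R) (f : Sh α) : coeffR R w (r ⊗ₜ f) = coeff w f • r := by
  simp [coeffR]

lemma linearMap_extR {M : Type*} [AddCommMonoid M] [Module R M] {F G : R ⊗[ℚ] Sh α →ₗ[R] M}
    (h : ∀ f : Sh α, F (1 ⊗ₜ f) = G (1 ⊗ₜ f)) : F = G := by
  apply LinearMap.ext
  intro x
  induction x with
  | zero => simp
  | add x y hx hy => rw [map_add, map_add, hx, hy]
  | tmul r f =>
    have hr : r ⊗ₜ[ℚ] f = r • ((1 : R) ⊗ₜ[ℚ] f) := by simp [TensorProduct.smul_tmul']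
    rw [hr, map_smul, map_smul, h]

lemma ext_coeffR {x y : R ⊗[ℚ] Sh α} (h : ∀ w, coeffR R w x = coeffR R w y) : x = y := by
  apply (Algebra.TensorProduct.basis R (basis α)).ext_elem
  intro w
  have key : ∀ z : R ⊗[ℚ] Sh α,
      (Algebra.TensorProduct.basis R (basis α)).repr z w = coeffR R w z := by
    intro z
    induction z with
    | zero => simp
    | add x y hx hy => simp only [map_add, Finsupp.add_apply, hx, hy]
    | tmul r f =>
      rw [Algebra.TensorProduct.basis_repr_tmul, coeffR_tmul]
      simp [coeff, Algebra.smul_def, mul_comm]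
  rw [key, key, h]

lemma coeffR_rslR (w : List α) (a : α) (x : R ⊗[ℚ] Sh α) :
    coeffR R w (rslR R a x) = coeffR R (w ++ [a]) x := by
  suffices h : coeffR R w ∘ₗ rslR R a = coeffR R (w ++ [a]) from LinearMap.congr_fun h x
  apply linearMap_extR
  intro f
  simp [rslR, coeffR_tmul, coeff_rsl]

lemma ext_rslR {x y : R ⊗[ℚ] Sh α} (h0 : coeffR R [] x = coeffR R [] y)
    (h : ∀ a, rslR R a x = rslR R a y) : x = y := by
  apply ext_coeffR
  intro w
  rcases List.eq_nil_or_concat' w with rfl | ⟨v, a, rfl⟩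
  · exact h0
  · rw [← coeffR_rslR, ← coeffR_rslR, h]

lemma coeffR_nil_mul (x y : R ⊗[ℚ] Sh α) :
    coeffR R [] (x * y) = coeffR R [] x * coeffR R [] y := by
  induction x with
  | zero => simp
  | add x x' hx hx' => simp only [add_mul, map_add, hx, hx']
  | tmul r f =>
    induction y with
    | zero => simp
    | add y y' hy hy' => simp only [mul_add, map_add, hy, hy']
    | tmul s g =>
      simp only [Algebra.TensorProduct.tmul_mul_tmul, coeffR_tmul, coeff_nil_mul,
        smul_mul_smul_comm]

lemma coeffR_letter_mul (a : α) (x y : R ⊗[ℚ] Sh α) :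
    coeffR R [a] (x * y) = coeffR R [a] x * coeffR R [] y + coeffR R [] x * coeffR R [a] y := by
  induction x with
  | zero => simp
  | add x x' hx hx' => simp only [add_mul, map_add, hx, hx']; ring
  | tmul r f =>
    induction y with
    | zero => simp
    | add y y' hy hy' => simp only [mul_add, map_add, hy, hy']; ring
    | tmul s g =>
      simp only [Algebra.TensorProduct.tmul_mul_tmul, coeffR_tmul, coeff_letter_mul,
        smul_mul_smul_comm, add_smul]

lemma coeffR_one_nil : coeffR R ([] : List α) 1 = 1 := by
  rw [Algebra.TensorProduct.one_def, coeffR_tmul, one_eq, coeff_word_self, one_smul]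

lemma coeffR_one_letter (a : α) : coeffR R [a] 1 = 0 := by
  rw [Algebra.TensorProduct.one_def, coeffR_tmul, one_eq, coeff_word_ne (by simp), zero_smul]

lemma coeffR_letter_pow {x : R ⊗[ℚ] Sh α} (hx : coeffR R [] x = 0) (a : α) (n : ℕ) :
    coeffR R [a] (x ^ n) = if n = 1 then coeffR R [a] x else 0 := by
  rcases n with _ | _ | n
  · simp [coeffR_one_letter]
  · simp
  · rw [pow_succ, pow_succ, coeffR_letter_mul, coeffR_nil_mul, hx]; simp

lemma coeffR_postR_nil (a : α) (x : R ⊗[ℚ] Sh α) : coeffR R [] (postR R a x) = 0 := by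
  suffices h : coeffR R [] ∘ₗ postR R a = 0 from LinearMap.congr_fun h x
  apply linearMap_extR
  intro f
  simp [postR, coeffR_tmul, coeff_post_nil]

lemma rslR_postR [DecidableEq α] (a b : α) (x : R ⊗[ℚ] Sh α) :
    rslR R a (postR R b x) = if a = b then x else 0 := by
  suffices h : rslR R a ∘ₗ postR R b = if a = b then .id else 0 by
    have := LinearMap.congr_fun h x
    split_ifs at this ⊢ <;> exact this
  apply linearMap_extR
  intro f
  have h := rder_post a b f
  rw [rder_apply] at h
  simp only [LinearMap.comp_apply, postR, rslR, LinearMap.baseChange_tmul, h]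
  split_ifs <;> simp

lemma postR_mul_postR (a b : α) (x y : R ⊗[ℚ] Sh α) :
    postR R a x * postR R b y = postR R a (x * postR R b y) + postR R b (postR R a x * y) := by
  induction x with
  | zero => simp
  | add x x' hx hx' => simp only [add_mul, map_add, hx, hx']; abel
  | tmul r f =>
    induction y with
    | zero => simp
    | add y y' hy hy' => simp only [mul_add, map_add, hy, hy']; abel
    | tmul s g =>
      simp only [postR, LinearMap.baseChange_tmul, Algebra.TensorProduct.tmul_mul_tmul,
        post_mul_post, TensorProduct.tmul_add]

lemma postR_wordR (a : α) (w : List α) : postR R a (wordR R w) = wordR R (w ++ [a]) := by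
  simp [postR, wordR, post_word]

lemma wordR_nil : wordR R ([] : List α) = 1 := rfl

/-! #### The coproduct over `R` -/

variable (R) in
/-- The map `A ⊗ A → (R ⊗ A) ⊗ (R ⊗ A)` through which the coproduct of `A` induces that of
`R ⊗ A`. -/
def incl2 (A : Type) [CommRing A] [Algebra ℚ A] :
    A ⊗[ℚ] A →+* (R ⊗[ℚ] A) ⊗[R] (R ⊗[ℚ] A) :=
  Algebra.TensorProduct.mapRingHom (algebraMap ℚ R)
    (Algebra.TensorProduct.includeRight : A →ₐ[ℚ] R ⊗[ℚ] A).toRingHom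
    (Algebra.TensorProduct.includeRight : A →ₐ[ℚ] R ⊗[ℚ] A).toRingHom
    (by ext r; simp [Algebra.TensorProduct.algebraMap_apply])
    (by ext r; simp [Algebra.TensorProduct.algebraMap_apply])

lemma incl2_tmul {A : Type} [CommRing A] [Algebra ℚ A] (a b : A) :
    incl2 R A (a ⊗ₜ b) = (1 ⊗ₜ a) ⊗ₜ (1 ⊗ₜ b) := by
  simp [incl2]

lemma comul_one_tmul {A : Type} [CommRing A] [Bialgebra ℚ A] (a : A) :
    Coalgebra.comul (R := R) ((1 : R) ⊗ₜ[ℚ] a) = incl2 R A (Coalgebra.comul (R := ℚ) a) :=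
  DFunLike.congr_fun (Bialgebra.comul_includeRight (R := ℚ) (A := R) (B := A)) a

lemma comul_postR (a : α) (x : R ⊗[ℚ] Sh α) :
    Coalgebra.comul (R := R) (postR R a x) =
      postR R a x ⊗ₜ 1 + (postR R a).lTensor (R ⊗[ℚ] Sh α) (Coalgebra.comul (R := R) x) := by
  suffices h : Coalgebra.comul (R := R) ∘ₗ postR R a =
      (TensorProduct.mk R (R ⊗[ℚ] Sh α) (R ⊗[ℚ] Sh α)).flip 1 ∘ₗ postR R a +
        (postR R a).lTensor (R ⊗[ℚ] Sh α) ∘ₗ Coalgebra.comul (R := R) from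
    LinearMap.congr_fun h x
  apply linearMap_extR
  intro f
  have key : ∀ t : Sh α ⊗[ℚ] Sh α, incl2 R (Sh α) ((post a).lTensor (Sh α) t) =
      (postR R a).lTensor (R ⊗[ℚ] Sh α) (incl2 R (Sh α) t) := by
    intro t
    induction t with
    | zero => simp
    | add s t hs ht => simp only [map_add, hs, ht]
    | tmul f g => simp [incl2_tmul, postR]
  simp only [LinearMap.comp_apply, LinearMap.add_apply, LinearMap.flip_apply,
    TensorProduct.mk_apply]
  have hp : postR R a (1 ⊗ₜ f) = 1 ⊗ₜ post a f := by simp [postR]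
  rw [hp, comul_one_tmul, comul_one_tmul, comul_eq, comul_eq, comulL_post, map_add, incl2_tmul, key]
  rfl

/-- Contraction of the second factor with the coefficient of a letter. -/
def contract (a : α) :
    (R ⊗[ℚ] Sh α) ⊗[R] (R ⊗[ℚ] Sh α) →ₗ[R] R ⊗[ℚ] Sh α :=
  (TensorProduct.rid R (R ⊗[ℚ] Sh α)).toLinearMap ∘ₗ (coeffR R [a]).lTensor (R ⊗[ℚ] Sh α)

lemma contract_tmul (a : α) (x y : R ⊗[ℚ] Sh α) :
    contract a (x ⊗ₜ[R] y) = coeffR R [a] y • x := by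
  simp [contract]

lemma contract_comul (a : α) (x : R ⊗[ℚ] Sh α) :
    contract a (Coalgebra.comul (R := R) x) = rslR R a x := by
  suffices h : contract a ∘ₗ Coalgebra.comul (R := R) = rslR R a from LinearMap.congr_fun h x
  apply linearMap_extR
  intro f
  have key : ∀ t : Sh α ⊗[ℚ] Sh α, contract a (incl2 R (Sh α) t) =
      1 ⊗ₜ TensorProduct.rid ℚ (Sh α) ((coeff [a]).lTensor (Sh α) t) := by
    intro t
    induction t with
    | zero => simp
    | add s t hs ht => simp only [map_add, hs, ht, TensorProduct.tmul_add]
    | tmul f g =>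
      rw [incl2_tmul, contract_tmul, coeffR_tmul]
      simp [TensorProduct.smul_tmul']
  rw [LinearMap.comp_apply, comul_one_tmul, key, comul_eq, coeff_lTensor_comulL]
  simp [rslR]

lemma counit_eq_coeffR (x : R ⊗[ℚ] Sh α) : Coalgebra.counit (R := R) x = coeffR R [] x := by
  suffices h : Coalgebra.counit (R := R) = coeffR R ([] : List α) from LinearMap.congr_fun h x
  apply linearMap_extR
  intro f
  rw [coeffR_tmul, TensorProduct.counit_tmul]
  simp
  rfl

/-! #### Words with varying letters -/

variable [Fintype α]

/-- The operator `∑ v(a) post a` of integration against the form `∑ v(a) a`. -/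
def integ (v : α → R) : R ⊗[ℚ] Sh α →ₗ[R] R ⊗[ℚ] Sh α := ∑ a, v a • postR R a

lemma integ_apply (v : α → R) (x : R ⊗[ℚ] Sh α) : integ v x = ∑ a, v a • postR R a x := by
  simp [integ]

lemma integ_mul_integ (v w : α → R) (x y : R ⊗[ℚ] Sh α) :
    integ v x * integ w y = integ v (x * integ w y) + integ w (integ v x * y) := by
  have h0 : integ v x * integ w y = ∑ a, ∑ b, (v a * w b) • (postR R a x * postR R b y) := by
    rw [integ_apply, integ_apply, Finset.sum_mul_sum]
    simp only [smul_mul_smul_comm]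
  have h1 : integ v (x * integ w y) =
      ∑ a, ∑ b, (v a * w b) • postR R a (x * postR R b y) := by
    rw [integ_apply, integ_apply]
    simp only [Finset.mul_sum, map_sum, Finset.smul_sum, mul_smul_comm, map_smul, mul_smul]
  have h2 : integ w (integ v x * y) =
      ∑ a, ∑ b, (v a * w b) • postR R b (postR R a x * y) := by
    rw [integ_apply, integ_apply, Finset.sum_comm]
    simp only [Finset.sum_mul, map_sum, Finset.smul_sum, smul_mul_assoc, map_smul, smul_smul,
      mul_comm (w _) (v _)]
  rw [h0, h1, h2, ← Finset.sum_add_distrib]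
  refine Finset.sum_congr rfl fun a _ => ?_
  rw [← Finset.sum_add_distrib]
  exact Finset.sum_congr rfl fun b _ => by rw [postR_mul_postR, smul_add]

lemma comul_integ (v : α → R) (x : R ⊗[ℚ] Sh α) :
    Coalgebra.comul (R := R) (integ v x) =
      integ v x ⊗ₜ 1 + (integ v).lTensor (R ⊗[ℚ] Sh α) (Coalgebra.comul (R := R) x) := by
  have h : (integ v).lTensor (R ⊗[ℚ] Sh α) = ∑ a, v a • (postR R a).lTensor (R ⊗[ℚ] Sh α) := by
    rw [integ, ← LinearMap.coe_lTensorHom, map_sum]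
    simp only [map_smul]
  rw [h, integ_apply, map_sum, TensorProduct.sum_tmul]
  simp only [map_smul, comul_postR, smul_add, Finset.sum_add_distrib, LinearMap.sum_apply,
    LinearMap.smul_apply, TensorProduct.smul_tmul']

lemma rslR_integ [DecidableEq α] (a : α) (v : α → R) (x : R ⊗[ℚ] Sh α) :
    rslR R a (integ v x) = v a • x := by
  simp [integ_apply, rslR_postR]

lemma coeffR_integ_nil (v : α → R) (x : R ⊗[ℚ] Sh α) : coeffR R [] (integ v x) = 0 := by
  simp [integ_apply, coeffR_postR_nil]

lemma coeffR_integ_letter (a : α) (v : α → R) (x : R ⊗[ℚ] Sh α) :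
    coeffR R [a] (integ v x) = v a * coeffR R [] x := by
  classical
  rw [← List.nil_append [a], ← coeffR_rslR, rslR_integ, map_smul, smul_eq_mul]

end BaseChange

end Sh

/-- If `Q` is a Rota-Baxter operator of weight zero, then `Qⁿ 1` is the `n`-th divided power of
`Q 1`. -/
lemma iterate_one_of_rotaBaxter {A : Type*} [CommRing A] [Algebra ℚ A] (Q : A → A)
    (hQ : ∀ x y, Q x * Q y = Q (x * Q y) + Q (Q x * y))
    (hsmul : ∀ (n : ℕ) x, Q (n * x) = n * Q x) (n : ℕ) :
    Q^[n] 1 = (n.factorial : ℚ)⁻¹ • Q 1 ^ n := by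
  have key : ∀ n, Q 1 * Q^[n] 1 = ((n + 1 : ℕ) : A) * Q^[n + 1] 1 := by
    intro n
    induction n with
    | zero => simp
    | succ n ih =>
      rw [Function.iterate_succ_apply' Q n, hQ, ih, hsmul, one_mul,
        ← Function.iterate_succ_apply' Q n, ← Function.iterate_succ_apply' Q (n + 1)]
      push_cast
      ring
  have h : ∀ n : ℕ, (n.factorial : A) * Q^[n] 1 = Q 1 ^ n := by
    intro n
    induction n with
    | zero => simp
    | succ n ih =>
      rw [pow_succ, ← ih, mul_assoc, mul_comm _ (Q 1), key, Nat.factorial_succ]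
      push_cast
      ring
  rw [← h, ← nsmul_eq_mul, ← Nat.cast_smul_eq_nsmul ℚ, smul_smul,
    inv_mul_cancel₀ (by positivity), one_smul]

/-! ### Coproduct and grading of the generators -/

namespace PL

open Sh

/-- The function `f_{tⁿ}` on `π^PL`, a divided power of `f_t`. -/
def dpow (j : Fam) (n : ℕ) : Sh Gam := (n.factorial : ℚ)⁻¹ • ftail j ^ n

/-- Appending the tail `t` of the family to words. -/
def postTail (j : Fam) : Sh Gam →ₗ[ℚ] Sh Gam := j.slope .e1 • post .e1 + j.slope .e2 • post .e2

lemma fpol_succ' (j : Fam) (n : ℕ) : fpol j (n + 1) = postTail j (fpol j n) := fpol_succ j n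

lemma postTail_one (j : Fam) : postTail j 1 = ftail j := by
  simp [postTail, ftail_eq, post_one]

lemma postTail_mul_postTail (j : Fam) (f g : Sh Gam) :
    postTail j f * postTail j g = postTail j (f * postTail j g) + postTail j (postTail j f * g) := by
  simp only [postTail, LinearMap.add_apply, LinearMap.smul_apply, add_mul, mul_add, map_add,
    smul_mul_assoc, mul_smul_comm, map_smul, post_mul_post, smul_add, smul_smul]
  rw [mul_comm (j.slope .e2) (j.slope .e1)]
  abel

lemma postTail_iterate (j : Fam) (n : ℕ) : (postTail j)^[n] 1 = dpow j n := by
  rw [iterate_one_of_rotaBaxter (postTail j) (postTail_mul_postTail j)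
    (fun n x => by rw [← nsmul_eq_mul, map_nsmul, nsmul_eq_mul]), postTail_one, dpow]

lemma postTail_dpow (j : Fam) (n : ℕ) : postTail j (dpow j n) = dpow j (n + 1) := by
  rw [← postTail_iterate, ← postTail_iterate, Function.iterate_succ_apply']

lemma comulL_postTail (j : Fam) (f : Sh Gam) : comulL (postTail j f) =
    postTail j f ⊗ₜ 1 + (postTail j).lTensor (Sh Gam) (comulL f) := by
  simp only [postTail, LinearMap.add_apply, LinearMap.smul_apply, map_add, map_smul, comulL_post,
    LinearMap.lTensor_add, LinearMap.lTensor_smul, smul_add, TensorProduct.add_tmul,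
    TensorProduct.smul_tmul']
  abel

lemma comulL_word_letter (a : Gam) :
    comulL (word [a]) = 1 ⊗ₜ word [a] + word [a] ⊗ₜ 1 := by
  rw [← post_one, comulL_post, comulL_one, Algebra.TensorProduct.one_def, LinearMap.lTensor_tmul,
    add_comm]

lemma comulL_fpol (j : Fam) (n : ℕ) : comulL (fpol j n) =
    1 ⊗ₜ fpol j n + ∑ k ∈ Finset.range (n + 1), fpol j k ⊗ₜ dpow j (n - k) := by
  induction n with
  | zero => rw [fpol_zero, comulL_word_letter]; simp [dpow, fpol_zero]
  | succ n ih =>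
    rw [fpol_succ', comulL_postTail, ih, map_add, map_sum, Finset.sum_range_succ _ (n + 1)]
    simp only [LinearMap.lTensor_tmul, postTail_dpow]
    rw [Nat.sub_self, fpol_succ', dpow, Nat.factorial_zero, pow_zero, Nat.cast_one, inv_one,
      one_smul, add_comm, add_assoc]
    congr 2
    apply Finset.sum_congr rfl
    intro k hk
    rw [Nat.succ_sub (Nat.lt_succ_iff.mp (Finset.mem_range.mp hk))]

lemma map_val_comul (x : APLle 4) :
    TensorProduct.map (APLle 4).val.toLinearMap (APLle 4).val.toLinearMap
      (Coalgebra.comul (R := ℚ) x) = comulL (x : Sh Gam) :=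
  congrArg Subtype.val ((AlgEquiv.ofInjective (Algebra.TensorProduct.map (APLle 4).val (APLle 4).val)
    (TensorProduct.map_injective_of_flat_flat _ _ Subtype.val_injective
      Subtype.val_injective)).apply_symm_apply _)

lemma counit_fPL (l : Lam) : Coalgebra.counit (R := ℚ) (fPL l) = 0 := by
  change coeff [] (fLam l) = 0
  cases l with
  | e1 => rw [fLam_e1, coeff_word_ne (by simp)]
  | e2 => rw [fLam_e2, coeff_word_ne (by simp)]
  | pol j n => exact coeff_nil_fpol j n

lemma comul_ext {x : APLle 4} {t : APLle 4 ⊗[ℚ] APLle 4}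
    (h : comulL (x : Sh Gam) =
      TensorProduct.map (APLle 4).val.toLinearMap (APLle 4).val.toLinearMap t) :
    Coalgebra.comul (R := ℚ) x = t := by
  apply TensorProduct.map_injective_of_flat_flat (APLle 4).val.toLinearMap
    (APLle 4).val.toLinearMap Subtype.val_injective Subtype.val_injective
  rw [map_val_comul, h]

lemma comul_fPL_e {l : Lam} (hl : l = .e1 ∨ l = .e2) :
    Coalgebra.comul (R := ℚ) (fPL l) = 1 ⊗ₜ fPL l + fPL l ⊗ₜ 1 := by
  apply comul_ext
  have h : ∃ a, fLam l = word [a] := by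
    rcases hl with rfl | rfl
    · exact ⟨_, fLam_e1⟩
    · exact ⟨_, fLam_e2⟩
  obtain ⟨a, ha⟩ := h
  change comulL (fLam l) = _
  rw [map_add, TensorProduct.map_tmul, TensorProduct.map_tmul]
  change _ = (1 : Sh Gam) ⊗ₜ fLam l + fLam l ⊗ₜ (1 : Sh Gam)
  rw [ha, comulL_word_letter]

/-- The function `f_t` as an element of `A^PL_{[≤ 4]}`. -/
def ftailPL (j : Fam) : APLle 4 := j.slope .e1 • fPL .e1 + j.slope .e2 • fPL .e2

lemma ftailPL_val (j : Fam) : (ftailPL j : Sh Gam) = ftail j := by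
  rw [ftail_eq, ← fLam_e1, ← fLam_e2]; rfl

/-- The function `f_{h tⁿ}` as an element of `A^PL_{[≤ 4]}`, for `n < 4`. -/
def fpolPL (j : Fam) (n : ℕ) : APLle 4 := if h : n < 4 then fPL (.pol j ⟨n, h⟩) else 0

lemma fpolPL_val (j : Fam) {n : ℕ} (h : n < 4) : (fpolPL j n : Sh Gam) = fpol j n := by
  rw [fpolPL, dif_pos h]; rfl

lemma fPL_pol (j : Fam) (n : Fin 4) : fPL (.pol j n) = fpolPL j n := by
  rw [fpolPL, dif_pos n.2]

lemma comul_fpolPL (j : Fam) {n : ℕ} (hn : n < 4) : Coalgebra.comul (R := ℚ) (fpolPL j n) =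
    1 ⊗ₜ fpolPL j n + ∑ k ∈ Finset.range (n + 1),
      fpolPL j k ⊗ₜ (((n - k).factorial : ℚ)⁻¹ • ftailPL j ^ (n - k)) := by
  apply comul_ext
  rw [fpolPL_val j hn, comulL_fpol, map_add, map_sum]
  simp only [TensorProduct.map_tmul]
  congr 1
  · change _ = (1 : Sh Gam) ⊗ₜ (fpolPL j n : Sh Gam)
    rw [fpolPL_val j hn]
  · apply Finset.sum_congr rfl
    intro k hk
    have hk4 : k < 4 := by have := Finset.mem_range.mp hk; omega
    change _ = (fpolPL j k : Sh Gam) ⊗ₜ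
      ((((n - k).factorial : ℚ)⁻¹ • ftailPL j ^ (n - k) : APLle 4) : Sh Gam)
    rw [fpolPL_val j hk4]
    simp only [Subalgebra.coe_smul, Subalgebra.coe_pow, ftailPL_val, dpow]

/-! #### Gradings -/

lemma fPL_mem_APLleDeg (l : Lam) : fPL l ∈ APLleDeg 4 l.wt := (fLam_mem_APLdeg l).2

end PL

/-- The values of a weighted homogeneous polynomial at homogeneous elements of a graded algebra
are homogeneous. -/
lemma aeval_mem_graded {S ι : Type*} [CommRing S] [Algebra ℚ S] (H : ℕ → Submodule ℚ S)
    [SetLike.GradedMonoid H] (wt : ι → ℕ) (z : ι → S) (hz : ∀ i, z i ∈ H (wt i)) {n : ℕ}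
    {p : MvPolynomial ι ℚ} (hp : p.IsWeightedHomogeneous wt n) : MvPolynomial.aeval z p ∈ H n := by
  rw [MvPolynomial.aeval_def, MvPolynomial.eval₂_eq]
  apply sum_mem
  intro d hd
  rw [← Algebra.smul_def]
  apply Submodule.smul_mem
  have hw := hp (MvPolynomial.mem_support_iff.mp hd)
  rw [← hw, Finsupp.weight_apply, Finsupp.sum]
  exact SetLike.prod_mem_graded _ _ _ fun i _ => SetLike.pow_mem_graded _ (hz i)

namespace Sh

instance {α : Type} (wt : α → ℕ) : SetLike.GradedMonoid (homog wt) where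
  one_mem := one_mem_homog wt
  mul_mem _ _ _ _ := mul_mem_homog

/-- The grading of `R ⊗ A` induced by the grading of the shuffle algebra `A`. -/
def homogR {α : Type} (wt : α → ℕ) (R : Type u) [CommRing R] [Algebra ℚ R] (n : ℕ) :
    Submodule R (R ⊗[ℚ] Sh α) := (homog wt n).baseChange R

section

variable {α : Type} {wt : α → ℕ} {R : Type u} [CommRing R] [Algebra ℚ R]

lemma homogR_induction {n : ℕ} {p : R ⊗[ℚ] Sh α → Prop} {x : R ⊗[ℚ] Sh α}
    (hx : x ∈ homogR wt R n) (mem : ∀ f ∈ homog wt n, p (1 ⊗ₜ f)) (zero : p 0)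
    (add : ∀ x y, p x → p y → p (x + y)) (smul : ∀ (r : R) x, p x → p (r • x)) : p x := by
  rw [homogR, Submodule.baseChange_eq_span] at hx
  induction hx using Submodule.span_induction with
  | mem x h => obtain ⟨f, hf, rfl⟩ := h; exact mem f hf
  | zero => exact zero
  | add x y _ _ hx hy => exact add x y hx hy
  | smul r x _ hx => exact smul r x hx

lemma one_tmul_mem_homogR {n : ℕ} {f : Sh α} (hf : f ∈ homog wt n) :
    (1 : R) ⊗ₜ[ℚ] f ∈ homogR wt R n := Submodule.tmul_mem_baseChange_of_mem 1 hf

lemma mul_mem_homogR {m n : ℕ} {x y : R ⊗[ℚ] Sh α} (hx : x ∈ homogR wt R m)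
    (hy : y ∈ homogR wt R n) : x * y ∈ homogR wt R (m + n) := by
  refine homogR_induction (p := fun x => x * y ∈ homogR wt R (m + n)) hx (fun f hf => ?_)
    (by simp) (fun x x' hx hx' => by rw [add_mul]; exact add_mem hx hx')
    (fun r x hx => by rw [smul_mul_assoc]; exact Submodule.smul_mem _ _ hx)
  refine homogR_induction (p := fun y => (1 ⊗ₜ f) * y ∈ homogR wt R (m + n)) hy
    (fun g hg => ?_) (by simp) (fun x x' hx hx' => by rw [mul_add]; exact add_mem hx hx')
    (fun r x hx => by rw [mul_smul_comm]; exact Submodule.smul_mem _ _ hx)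
  rw [Algebra.TensorProduct.tmul_mul_tmul, mul_one]
  exact one_tmul_mem_homogR (mul_mem_homog hf hg)

instance : SetLike.GradedMonoid fun n => (homogR wt R n).restrictScalars ℚ where
  one_mem := one_tmul_mem_homogR (one_mem_homog wt)
  mul_mem _ _ _ _ := mul_mem_homogR

lemma postR_mem_homogR {n : ℕ} (a : α) {x : R ⊗[ℚ] Sh α} (hx : x ∈ homogR wt R n) :
    postR R a x ∈ homogR wt R (n + wt a) := by
  refine homogR_induction (p := fun x => postR R a x ∈ homogR wt R (n + wt a)) hx
    (fun f hf => ?_) (by simp) (fun x x' hx hx' => by rw [map_add]; exact add_mem hx hx')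
    (fun r x hx => by rw [map_smul]; exact Submodule.smul_mem _ _ hx)
  rw [postR, LinearMap.baseChange_tmul]
  exact one_tmul_mem_homogR (post_mem_homog a hf)

lemma integ_mem_homogR [Fintype α] {m n k : ℕ} (h : n + k = m) {v : α → R}
    (hv : ∀ a, wt a ≠ k → v a = 0)
    {x : R ⊗[ℚ] Sh α} (hx : x ∈ homogR wt R n) : integ v x ∈ homogR wt R m := by
  rw [integ_apply]
  apply sum_mem
  intro a _
  by_cases ha : wt a = k
  · rw [← h, ← ha]; exact Submodule.smul_mem _ _ (postR_mem_homogR a hx)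
  · rw [hv a ha, zero_smul]; exact zero_mem _

lemma coeffR_eq_zero_of_mem_homogR {n : ℕ} {w : List α} (hw : (w.map wt).sum ≠ n)
    {x : R ⊗[ℚ] Sh α} (hx : x ∈ homogR wt R n) : coeffR R w x = 0 := by
  refine homogR_induction (p := fun x => coeffR R w x = 0) hx (fun f hf => ?_) (by simp)
    (fun x x' hx hx' => by rw [map_add, hx, hx', add_zero])
    (fun r x hx => by rw [map_smul, hx, smul_zero])
  rw [coeffR_tmul]
  have : coeff w f = 0 := by
    by_contra h; exact hw (hf w h)
  rw [this, zero_smul]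

end

end Sh

namespace PL

open Sh

/-- Homogeneous elements of `A^PL_{[≤ 4]}` are given by weighted homogeneous polynomials in the
`f_λ`. -/
lemma exists_isWeightedHomogeneous {n : ℕ} {b : APLle 4} (hb : b ∈ APLleDeg 4 n) :
    ∃ p : MvPolynomial Lam ℚ, p.IsWeightedHomogeneous Lam.wt n ∧
      MvPolynomial.aeval fPL p = b := by
  obtain ⟨p, rfl⟩ := polyEquiv.surjective b
  rw [polyEquiv_eq_aeval] at hb ⊢
  refine ⟨MvPolynomial.weightedHomogeneousComponent Lam.wt n p,
    MvPolynomial.weightedHomogeneousComponent_isWeightedHomogeneous n p, ?_⟩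
  have hval : ∀ q : MvPolynomial Lam ℚ,
      ((MvPolynomial.aeval fPL q : APLle 4) : Sh Gam) = MvPolynomial.aeval fLam q := by
    intro q
    have : (APLle 4).val.comp (MvPolynomial.aeval fPL) = MvPolynomial.aeval fLam :=
      MvPolynomial.algHom_ext fun l => by simp [fPL]
    exact DFunLike.congr_fun this q
  have hc : ∀ k, MvPolynomial.aeval fLam (MvPolynomial.weightedHomogeneousComponent Lam.wt k p) ∈
      homog Gam.wt k := fun k =>
    aeval_mem_graded (homog Gam.wt) Lam.wt fLam (fun l => (fLam_mem_APLdeg l).2)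
      (MvPolynomial.weightedHomogeneousComponent_isWeightedHomogeneous k p)
  have hfin := MvPolynomial.weightedHomogeneousComponent_finsupp (w := Lam.wt) p
  have hsum : MvPolynomial.aeval fLam p = ∑ k ∈ hfin.toFinset,
      MvPolynomial.aeval fLam (MvPolynomial.weightedHomogeneousComponent Lam.wt k p) := by
    conv_lhs => rw [← MvPolynomial.sum_weightedHomogeneousComponent Lam.wt p]
    rw [finsum_eq_sum _ hfin, map_sum]
  have hb' : MvPolynomial.aeval fLam p ∈ homog Gam.wt n := by rw [← hval]; exact hb
  apply Subtype.ext
  rw [hval, hval]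
  apply ext_coeff
  intro w
  by_cases hw : (w.map Gam.wt).sum = n
  · rw [hsum, map_sum, Finset.sum_eq_single n]
    · intro k _ hk
      by_contra h
      exact hk ((hc k w h).symm.trans hw)
    · intro hn
      have : MvPolynomial.weightedHomogeneousComponent Lam.wt n p = 0 := by
        by_contra h; exact hn (hfin.mem_toFinset.mpr h)
      rw [this, map_zero, map_zero]
  · have h1 : coeff w (MvPolynomial.aeval fLam p) = 0 := by
      by_contra h; exact hw (hb' w h)
    rw [h1]
    by_contra h
    exact hw (hc n w h)

end PL

/-! ### Equivariant cocycles -/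

instance : Fintype Sig := ⟨{.tau, .ups, .sig}, fun a => by cases a <;> simp⟩

namespace PL

open Sh

section

variable {R : Type u} [CommRing R]

/-- The scalars `Φ^ρ_λ`, extended by zero to the pairs `(ρ, λ)` of different weights. -/
def phiExt (v : PhiIdx → R) (l : Lam) (r : Sig) : R :=
  if h : r.wt = l.wt then v ⟨(r, l), h⟩ else 0

lemma phiExt_of_ne (v : PhiIdx → R) {l : Lam} {r : Sig} (h : r.wt ≠ l.wt) : phiExt v l r = 0 :=
  dif_neg h

/-- The scalars `Φ^ρ_{h tⁿ}`; zero by convention for `n ≥ 4`. -/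
def phiPol (v : PhiIdx → R) (j : Fam) (n : ℕ) (r : Sig) : R :=
  if h : n < 4 then phiExt v (.pol j ⟨n, h⟩) r else 0

lemma phiPol_of_ne (v : PhiIdx → R) (j : Fam) {n : ℕ} {r : Sig} (h : r.wt ≠ n + 1) :
    phiPol v j n r = 0 := by
  rw [phiPol]; split_ifs
  · exact phiExt_of_ne _ h
  · rfl

variable [Algebra ℚ R]

/-- The scalars `Φ^ρ_t` for the tail `t` of the family. -/
def phiTail (v : PhiIdx → R) (j : Fam) (r : Sig) : R :=
  j.slope .e1 • phiExt v .e1 r + j.slope .e2 • phiExt v .e2 r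

lemma phiTail_of_ne (v : PhiIdx → R) (j : Fam) {r : Sig} (h : r.wt ≠ 1) : phiTail v j r = 0 := by
  rw [phiTail, phiExt_of_ne _ h, phiExt_of_ne _ h]; simp

/-- The function `c♯ f_{h tⁿ}` for the cocycle `c` with coordinates `Φ^ρ_λ`. -/
def imagePol (v : PhiIdx → R) (j : Fam) : ℕ → R ⊗[ℚ] Sh Sig
  | 0 => integ (phiPol v j 0) 1
  | n + 1 => integ (phiPol v j (n + 1)) 1 + integ (phiTail v j) (imagePol v j n)

/-- The function `c♯ f_λ` for the cocycle `c` with coordinates `Φ^ρ_λ`. -/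
def image (v : PhiIdx → R) : Lam → R ⊗[ℚ] Sh Sig
  | .e1 => integ (phiExt v .e1) 1
  | .e2 => integ (phiExt v .e2) 1
  | .pol j n => imagePol v j n

lemma one_mem_homogR : (1 : R ⊗[ℚ] Sh Sig) ∈ homogR Sig.wt R 0 :=
  one_tmul_mem_homogR (one_mem_homog _)

lemma imagePol_mem_homogR (v : PhiIdx → R) (j : Fam) (n : ℕ) :
    imagePol v j n ∈ homogR Sig.wt R (n + 1) := by
  induction n with
  | zero => exact integ_mem_homogR (by omega) (fun a h => phiPol_of_ne v j h) one_mem_homogR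
  | succ n ih =>
    exact add_mem (integ_mem_homogR (by omega) (fun a h => phiPol_of_ne v j h) one_mem_homogR)
      (integ_mem_homogR rfl (fun a h => phiTail_of_ne v j h) ih)

lemma image_mem_homogR (v : PhiIdx → R) (l : Lam) : image v l ∈ homogR Sig.wt R l.wt := by
  cases l with
  | e1 => exact integ_mem_homogR (zero_add _) (fun a h => phiExt_of_ne v h) one_mem_homogR
  | e2 => exact integ_mem_homogR (zero_add _) (fun a h => phiExt_of_ne v h) one_mem_homogR
  | pol j n => exact imagePol_mem_homogR v j n

lemma coeffR_nil_image (v : PhiIdx → R) (l : Lam) : coeffR R [] (image v l) = 0 := by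
  refine coeffR_eq_zero_of_mem_homogR ?_ (image_mem_homogR v l)
  cases l <;> simp [Lam.wt]

lemma coeffR_imagePol (v : PhiIdx → R) (j : Fam) {n : ℕ} (r : Sig) :
    coeffR R [r] (imagePol v j n) = phiPol v j n r := by
  cases n with
  | zero => rw [imagePol, coeffR_integ_letter, coeffR_one_nil, mul_one]
  | succ n =>
    have : coeffR R [] (imagePol v j n) = 0 :=
      coeffR_eq_zero_of_mem_homogR (by simp) (imagePol_mem_homogR v j n)
    rw [imagePol, map_add, coeffR_integ_letter, coeffR_integ_letter, coeffR_one_nil, this]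
    ring

lemma coeffR_image (v : PhiIdx → R) (l : Lam) (r : Sig) :
    coeffR R [r] (image v l) = phiExt v l r := by
  cases l with
  | e1 => rw [image, coeffR_integ_letter, coeffR_one_nil, mul_one]
  | e2 => rw [image, coeffR_integ_letter, coeffR_one_nil, mul_one]
  | pol j n => rw [image, coeffR_imagePol, phiPol, dif_pos n.2]

lemma integ_iterate (v : Sig → R) (n : ℕ) :
    (integ v)^[n] 1 = (n.factorial : ℚ)⁻¹ • (integ v 1) ^ n :=
  iterate_one_of_rotaBaxter (integ v) (integ_mul_integ v v)
    (fun n x => by rw [← nsmul_eq_mul, map_nsmul, nsmul_eq_mul]) n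

lemma comul_integ_one (v : Sig → R) : Coalgebra.comul (R := R) (integ v (1 : R ⊗[ℚ] Sh Sig)) =
    1 ⊗ₜ integ v 1 + integ v 1 ⊗ₜ 1 := by
  have h : (1 : (R ⊗[ℚ] Sh Sig) ⊗[R] (R ⊗[ℚ] Sh Sig)) = 1 ⊗ₜ 1 := rfl
  rw [comul_integ, Bialgebra.comul_one, h, LinearMap.lTensor_tmul, add_comm]

/-- The coproduct of `c♯ f_{h tⁿ}` has the same shape as that of `f_{h tⁿ}`. -/
lemma comul_imagePol (v : PhiIdx → R) (j : Fam) (n : ℕ) :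
    Coalgebra.comul (R := R) (imagePol v j n) = 1 ⊗ₜ imagePol v j n +
      ∑ k ∈ Finset.range (n + 1), imagePol v j k ⊗ₜ (integ (phiTail v j))^[n - k] 1 := by
  induction n with
  | zero => simp [imagePol, comul_integ_one]
  | succ n ih =>
    rw [Finset.sum_range_succ _ (n + 1)]
    simp only [imagePol]
    rw [map_add, comul_integ_one, comul_integ (phiTail v j), ih, map_add, map_sum]
    simp only [LinearMap.lTensor_tmul]
    rw [Nat.sub_self, Function.iterate_zero, id, TensorProduct.tmul_add, TensorProduct.add_tmul]
    have : ∑ k ∈ Finset.range (n + 1), imagePol v j k ⊗ₜ[R]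
          integ (phiTail v j) ((integ (phiTail v j))^[n - k] 1) =
        ∑ k ∈ Finset.range (n + 1), imagePol v j k ⊗ₜ[R]
          (integ (phiTail v j))^[n + 1 - k] 1 := by
      apply Finset.sum_congr rfl
      intro k hk
      rw [Nat.succ_sub (Nat.lt_succ_iff.mp (Finset.mem_range.mp hk)),
        Function.iterate_succ_apply']
    rw [this]
    abel

/-- The algebra homomorphism `c♯` for the cocycle `c` with coordinates `Φ^ρ_λ`. -/
def coact (v : PhiIdx → R) : R ⊗[ℚ] APLle 4 →ₐ[R] R ⊗[ℚ] Sh Sig :=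
  Algebra.TensorProduct.lift (Algebra.ofId R _) (liftPL (image v)) fun _ _ => Commute.all _ _

lemma coact_one_tmul (v : PhiIdx → R) (b : APLle 4) : coact v (1 ⊗ₜ b) = liftPL (image v) b := by
  simp [coact, ← Algebra.TensorProduct.one_def]

lemma coact_fPL (v : PhiIdx → R) (l : Lam) : coact v (1 ⊗ₜ fPL l) = image v l := by
  rw [coact_one_tmul, liftPL_fPL]

lemma coact_fpolPL (v : PhiIdx → R) (j : Fam) {n : ℕ} (hn : n < 4) :
    coact v (1 ⊗ₜ fpolPL j n) = imagePol v j n := by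
  rw [fpolPL, dif_pos hn, coact_fPL]; rfl

lemma integ_phiTail (v : PhiIdx → R) (j : Fam) (x : R ⊗[ℚ] Sh Sig) :
    integ (phiTail v j) x =
      j.slope .e1 • integ (phiExt v .e1) x + j.slope .e2 • integ (phiExt v .e2) x := by
  simp only [integ_apply, Finset.smul_sum, ← Finset.sum_add_distrib, phiTail, add_smul, smul_assoc]

lemma coact_dpow (v : PhiIdx → R) (j : Fam) (n : ℕ) :
    coact v (1 ⊗ₜ ((n.factorial : ℚ)⁻¹ • ftailPL j ^ n)) = (integ (phiTail v j))^[n] 1 := by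
  rw [integ_iterate, coact_one_tmul, map_smul, map_pow, ftailPL, map_add, map_smul, map_smul,
    liftPL_fPL, liftPL_fPL, integ_phiTail]
  rfl

lemma counit_coact : ∀ (v : PhiIdx → R),
    (Bialgebra.counitAlgHom R (R ⊗[ℚ] Sh Sig)).comp (coact v) =
      Bialgebra.counitAlgHom R (R ⊗[ℚ] APLle 4) := by
  intro v
  apply Algebra.TensorProduct.ext
  · ext
  · apply algHom_ext_fPL
    intro l
    change Coalgebra.counit (R := R) (coact v (1 ⊗ₜ fPL l)) =
      Coalgebra.counit (R := R) ((1 : R) ⊗ₜ[ℚ] fPL l)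
    rw [coact_fPL, counit_eq_coeffR, coeffR_nil_image, TensorProduct.counit_tmul, counit_fPL,
      zero_smul]

lemma comul_coact_fPL (v : PhiIdx → R) (l : Lam) :
    Algebra.TensorProduct.map (coact v) (coact v)
        (Coalgebra.comul (R := R) ((1 : R) ⊗ₜ[ℚ] fPL l)) =
      Coalgebra.comul (R := R) (coact v (1 ⊗ₜ fPL l)) := by
  have h1 : coact v (1 ⊗ₜ 1) = 1 := map_one _
  have he : ∀ l, (l = .e1 ∨ l = .e2) → Algebra.TensorProduct.map (coact v) (coact v)
        (Coalgebra.comul (R := R) ((1 : R) ⊗ₜ[ℚ] fPL l)) =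
      Coalgebra.comul (R := R) (coact v (1 ⊗ₜ fPL l)) := by
    intro l hl
    rw [comul_one_tmul, comul_fPL_e hl, map_add, incl2_tmul, incl2_tmul, map_add,
      Algebra.TensorProduct.map_tmul, Algebra.TensorProduct.map_tmul, h1, coact_fPL]
    rcases hl with rfl | rfl <;> exact (comul_integ_one _).symm
  cases l with
  | e1 => exact he _ (.inl rfl)
  | e2 => exact he _ (.inr rfl)
  | pol j n =>
    rw [comul_one_tmul, fPL_pol, comul_fpolPL j n.2, map_add, map_sum, incl2_tmul, map_add, map_sum,
      Algebra.TensorProduct.map_tmul, h1, coact_fpolPL v j n.2, comul_imagePol]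
    congr 1
    apply Finset.sum_congr rfl
    intro k hk
    have hk4 : k < 4 := by have := Finset.mem_range.mp hk; omega
    rw [incl2_tmul, Algebra.TensorProduct.map_tmul, coact_fpolPL v j hk4, coact_dpow]

lemma comul_coact (v : PhiIdx → R) :
    (Algebra.TensorProduct.map (coact v) (coact v)).comp
        (Bialgebra.comulAlgHom R (R ⊗[ℚ] APLle 4)) =
      (Bialgebra.comulAlgHom R (R ⊗[ℚ] Sh Sig)).comp (coact v) := by
  apply Algebra.TensorProduct.ext
  · ext
  · apply algHom_ext_fPL
    exact comul_coact_fPL v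

/-- The cocycle with coordinates `Φ^ρ_λ`. -/
def cocycle (v : PhiIdx → R) : EqCocycle (homog Sig.wt) (APLleDeg 4) R :=
  ⟨.ofAlgHom (coact v) (counit_coact v) (comul_coact v), fun n b hb => by
    obtain ⟨p, hp, rfl⟩ := exists_isWeightedHomogeneous hb
    change coact v (1 ⊗ₜ MvPolynomial.aeval fPL p) ∈ homogR Sig.wt R n
    rw [coact_one_tmul, ← AlgHom.comp_apply, MvPolynomial.comp_aeval]
    simp only [liftPL_fPL]
    exact aeval_mem_graded (fun n => (homogR Sig.wt R n).restrictScalars ℚ) Lam.wt (image v)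
      (image_mem_homogR v) hp⟩

lemma cocycle_fPL (v : PhiIdx → R) (l : Lam) : (cocycle v).1 (1 ⊗ₜ fPL l) = image v l :=
  coact_fPL v l

lemma phiCoord_eq (w : List Sig) (b : APLle 4) (c : EqCocycle (homog Sig.wt) (APLleDeg 4) R) :
    phiCoord w b c = coeffR R w (c.1 (1 ⊗ₜ b)) := rfl

/-- The coordinates `Φ^ρ_λ` of a cocycle. -/
def coords (c : EqCocycle (homog Sig.wt) (APLleDeg 4) R) (i : PhiIdx) : R :=
  phiCoord [i.1.1] (fPL i.1.2) c

lemma coords_cocycle (v : PhiIdx → R) : coords (cocycle v) = v := by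
  funext i
  rw [coords, phiCoord_eq, cocycle_fPL, coeffR_image, phiExt, dif_pos i.2]

lemma cocycle_mem_homogR (c : EqCocycle (homog Sig.wt) (APLleDeg 4) R) (l : Lam) :
    c.1 (1 ⊗ₜ fPL l) ∈ homogR Sig.wt R l.wt := c.2 _ _ (fPL_mem_APLleDeg l)

lemma phiExt_coords (c : EqCocycle (homog Sig.wt) (APLleDeg 4) R) (l : Lam) (r : Sig) :
    phiExt (coords c) l r = coeffR R [r] (c.1 (1 ⊗ₜ fPL l)) := by
  by_cases h : r.wt = l.wt
  · rw [phiExt, dif_pos h]; rfl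
  · rw [phiExt, dif_neg h]
    exact (coeffR_eq_zero_of_mem_homogR (by simpa using h) (cocycle_mem_homogR c l)).symm

lemma coeffR_nil_cocycle (c : EqCocycle (homog Sig.wt) (APLleDeg 4) R) (l : Lam) :
    coeffR R [] (c.1 (1 ⊗ₜ fPL l)) = 0 := by
  refine coeffR_eq_zero_of_mem_homogR ?_ (cocycle_mem_homogR c l)
  cases l <;> simp [Lam.wt]

/-- The right translates of `c♯ b` are computed by the coproduct of `b`. -/
lemma rslR_cocycle (c : EqCocycle (homog Sig.wt) (APLleDeg 4) R) (r : Sig) (b : APLle 4) :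
    rslR R r (c.1 (1 ⊗ₜ b)) = contract r (TensorProduct.map (c.1 : R ⊗[ℚ] APLle 4 →ₗ[R] R ⊗[ℚ] Sh Sig)
      (c.1 : R ⊗[ℚ] APLle 4 →ₗ[R] R ⊗[ℚ] Sh Sig)
      (incl2 R (APLle 4) (Coalgebra.comul (R := ℚ) b))) := by
  rw [← contract_comul, ← comul_one_tmul]
  congr 1
  exact (CoalgHomClass.map_comp_comul_apply c.1 _).symm

lemma cocycle_smul (c : EqCocycle (homog Sig.wt) (APLleDeg 4) R) (q : ℚ) (b : APLle 4) :
    c.1 (1 ⊗ₜ (q • b)) = q • c.1 (1 ⊗ₜ b) := by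
  rw [TensorProduct.tmul_smul, map_rat_smul]

lemma cocycle_one (c : EqCocycle (homog Sig.wt) (APLleDeg 4) R) : c.1 (1 ⊗ₜ 1) = 1 := map_one c.1

lemma cocycle_pow (c : EqCocycle (homog Sig.wt) (APLleDeg 4) R) (b : APLle 4) (n : ℕ) :
    c.1 (1 ⊗ₜ (b ^ n)) = c.1 (1 ⊗ₜ b) ^ n := by
  rw [← map_pow, Algebra.TensorProduct.tmul_pow, one_pow]

lemma cocycle_ftailPL (c : EqCocycle (homog Sig.wt) (APLleDeg 4) R) (j : Fam) :
    c.1 (1 ⊗ₜ ftailPL j) =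
      j.slope .e1 • c.1 (1 ⊗ₜ fPL .e1) + j.slope .e2 • c.1 (1 ⊗ₜ fPL .e2) := by
  rw [ftailPL, TensorProduct.tmul_add, map_add, cocycle_smul, cocycle_smul]

lemma coeffR_rat_smul (w : List Sig) (q : ℚ) (x : R ⊗[ℚ] Sh Sig) :
    coeffR R w (q • x) = q • coeffR R w x :=
  (coeffR R w).map_smul_of_tower q x

lemma coeffR_cocycle_dpow (c : EqCocycle (homog Sig.wt) (APLleDeg 4) R) (j : Fam) (r : Sig)
    (n : ℕ) : coeffR R [r] (c.1 (1 ⊗ₜ ((n.factorial : ℚ)⁻¹ • ftailPL j ^ n))) =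
      if n = 1 then phiTail (coords c) j r else 0 := by
  have h0 : coeffR R [] (c.1 (1 ⊗ₜ ftailPL j)) = 0 := by
    rw [cocycle_ftailPL, map_add, coeffR_rat_smul, coeffR_rat_smul, coeffR_nil_cocycle,
      coeffR_nil_cocycle, smul_zero, smul_zero, add_zero]
  have h1 : coeffR R [r] (c.1 (1 ⊗ₜ ftailPL j)) = phiTail (coords c) j r := by
    rw [cocycle_ftailPL, map_add, coeffR_rat_smul, coeffR_rat_smul, phiTail, phiExt_coords,
      phiExt_coords]
  rw [cocycle_smul, cocycle_pow, coeffR_rat_smul, coeffR_letter_pow h0, h1]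
  split_ifs with h
  · simp [h]
  · rw [smul_zero]

/-- A cocycle is determined by its coordinates on `f_{h tⁿ}`: compatibility with the coproduct gives
the right translates of `c♯ f_{h tⁿ}`, and these satisfy the recursion defining `imagePol`. -/
lemma imagePol_coords (c : EqCocycle (homog Sig.wt) (APLleDeg 4) R) (j : Fam) {n : ℕ}
    (hn : n < 4) : imagePol (coords c) j n = c.1 (1 ⊗ₜ fpolPL j n) := by
  have hf : ∀ {n : ℕ} (hn : n < 4), fpolPL j n = fPL (.pol j ⟨n, hn⟩) := fun hn => dif_pos hn
  have hphi : ∀ {n : ℕ} (_ : n < 4) (r : Sig),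
      phiPol (coords c) j n r = coeffR R [r] (c.1 (1 ⊗ₜ fpolPL j n)) := fun hn r => by
    rw [phiPol, dif_pos hn, phiExt_coords, hf hn]
  -- Of the sum below only the term with `n - k = 1` survives, since the coefficient of a letter
  -- vanishes on proper powers.
  have hder : ∀ {n : ℕ} (_ : n < 4) (r : Sig), rslR R r (c.1 (1 ⊗ₜ fpolPL j n)) =
      phiPol (coords c) j n r • 1 + ∑ k ∈ Finset.range (n + 1),
        (if n - k = 1 then phiTail (coords c) j r else 0) • c.1 (1 ⊗ₜ fpolPL j k) := by
    intro n hn r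
    rw [rslR_cocycle, comul_fpolPL j hn, map_add, map_sum, incl2_tmul, map_add, map_sum, map_add,
      map_sum, TensorProduct.map_tmul, contract_tmul]
    simp only [incl2_tmul, TensorProduct.map_tmul, contract_tmul]
    rw [hphi hn]
    congr 1
    · exact congrArg _ (cocycle_one c)
    · exact Finset.sum_congr rfl fun k _ => congrArg (· • _) (coeffR_cocycle_dpow c j r (n - k))
  induction n with
  | zero =>
    apply ext_rslR
    · rw [imagePol, coeffR_integ_nil, hf hn, coeffR_nil_cocycle]
    · intro r
      rw [imagePol, rslR_integ, hder hn]
      simp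
  | succ n ih =>
    have hn' : n < 4 := by omega
    apply ext_rslR
    · rw [imagePol, map_add, coeffR_integ_nil, coeffR_integ_nil, hf hn, coeffR_nil_cocycle,
        add_zero]
    · intro r
      rw [imagePol, map_add, rslR_integ, rslR_integ, hder hn, ih hn', Finset.sum_eq_single n]
      · simp
      · intro k hk hkn
        have : n + 1 - k ≠ 1 := by omega
        rw [if_neg this, zero_smul]
      · simp

lemma image_coords (c : EqCocycle (homog Sig.wt) (APLleDeg 4) R) (l : Lam) :
    image (coords c) l = c.1 (1 ⊗ₜ fPL l) := by
  have he : ∀ l, (l = .e1 ∨ l = .e2) → integ (phiExt (coords c) l) 1 = c.1 (1 ⊗ₜ fPL l) := by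
    intro l hl
    apply ext_rslR
    · rw [coeffR_integ_nil, coeffR_nil_cocycle]
    · intro r
      rw [rslR_integ, rslR_cocycle, comul_fPL_e hl, map_add, incl2_tmul, incl2_tmul, map_add,
        map_add, TensorProduct.map_tmul, TensorProduct.map_tmul, contract_tmul, contract_tmul,
        phiExt_coords]
      change _ = coeffR R [r] (c.1 (1 ⊗ₜ fPL l)) • c.1 (1 ⊗ₜ 1) +
        coeffR R [r] (c.1 (1 ⊗ₜ 1)) • c.1 (1 ⊗ₜ fPL l)
      rw [cocycle_one, coeffR_one_letter, zero_smul, add_zero]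
  cases l with
  | e1 => exact he _ (.inl rfl)
  | e2 => exact he _ (.inr rfl)
  | pol j n => rw [fPL_pol]; exact imagePol_coords c j n.2

lemma cocycle_coords (c : EqCocycle (homog Sig.wt) (APLleDeg 4) R) : cocycle (coords c) = c := by
  apply Subtype.ext
  apply bialgHom_ext
  intro b
  have h : (((cocycle (coords c)).1 : R ⊗[ℚ] APLle 4 →ₐ[R] R ⊗[ℚ] Sh Sig).restrictScalars ℚ).comp
      Algebra.TensorProduct.includeRight =
      ((c.1 : R ⊗[ℚ] APLle 4 →ₐ[R] R ⊗[ℚ] Sh Sig).restrictScalars ℚ).comp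
        Algebra.TensorProduct.includeRight := by
    apply algHom_ext_fPL
    intro l
    exact (cocycle_fPL _ l).trans (image_coords c l)
  exact DFunLike.congr_fun h b

/-- An equivariant cocycle amounts to the family of its coordinates `Φ^ρ_λ`. -/
def cocycleEquiv : (PhiIdx → R) ≃ EqCocycle (homog Sig.wt) (APLleDeg 4) R where
  toFun := cocycle
  invFun := coords
  left_inv := coords_cocycle
  right_inv := cocycle_coords

end

end PL

/-! ### Evaluation at the generic point -/

namespace PL

open Sh

section

variable {R : Type u} [CommRing R]

lemma map_Phi [Algebra Ktus R] (x : Sring →ₐ[Ktus] R) (r : Sig) (l : Lam) :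
    x (Phi r l) = phiExt (fun i => x (MvPolynomial.X i)) l r := by
  rw [Phi, phiExt]; split_ifs
  · rfl
  · exact map_zero x

variable [Algebra ℚ R]

/-- The evaluation of functions over `R` at an `R`-point. -/
def evalPt (γ : Sh Sig →ₐ[ℚ] R) : R ⊗[ℚ] Sh Sig →ₐ[ℚ] R :=
  Algebra.TensorProduct.lift (AlgHom.id ℚ R) γ fun _ _ => Commute.all _ _

lemma evalPt_smul (γ : Sh Sig →ₐ[ℚ] R) (r : R) (x : R ⊗[ℚ] Sh Sig) :
    evalPt γ (r • x) = r * evalPt γ x := by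
  induction x with
  | zero => simp
  | add x y hx hy => rw [smul_add, map_add, map_add, hx, hy, mul_add]
  | tmul s f => simp [evalPt, TensorProduct.smul_tmul', mul_assoc]

lemma evalPt_wordR (γ : Sh Sig →ₐ[ℚ] R) (w : List Sig) : evalPt γ (wordR R w) = γ (word w) := by
  simp [evalPt, wordR]

lemma sum_sig {M : Type*} [AddCommMonoid M] (f : Sig → M) :
    ∑ a, f a = f .tau + f .ups + f .sig := by
  change ∑ a ∈ {Sig.tau, .ups, .sig}, f a = _
  rw [Finset.sum_insert (by simp), Finset.sum_insert (by simp), Finset.sum_singleton, add_assoc]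

lemma sum_tu {M : Type*} [AddCommMonoid M] (f : Sig → M) : ∑ a ∈ tu, f a = f .tau + f .ups :=
  Finset.sum_pair (by simp)

lemma integ_of_sig_eq_zero {v : Sig → R} (h : v .sig = 0) (x : R ⊗[ℚ] Sh Sig) :
    integ v x = v .tau • postR R .tau x + v .ups • postR R .ups x := by
  rw [integ_apply, sum_sig, h, zero_smul, add_zero]

lemma map_PhiTail [Algebra Ktus R] (x : Sring →ₐ[Ktus] R) (r : Sig) (j : Fam) :
    x (PhiTail r j) = phiTail (fun i => x (MvPolynomial.X i)) j r := by
  cases j <;> simp [PhiTail, phiTail, Fam.slope, map_Phi]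

/-- The homomorphism `θ` computes the value of a cocycle at the generic point. -/
lemma evalPt_image [Algebra Ktus R] (γ : Sh Sig →ₐ[ℚ] R)
    (hγ : ∀ w, γ (word w) = algebraMap Ktus R (fK w)) (x : Sring →ₐ[Ktus] R) (l : Lam) :
    evalPt γ (image (fun i => x (MvPolynomial.X i)) l) = x (thetaVal l) := by
  set v : PhiIdx → R := fun i => x (MvPolynomial.X i)
  have ht : ∀ j, phiTail v j .sig = 0 := fun j => phiTail_of_ne v j (by simp [Sig.wt])
  have h0 : ∀ j, phiPol v j 0 .sig = 0 := fun j => phiPol_of_ne v j (by simp [Sig.wt])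
  -- A primitive contribution `Φ^ρ_{h tⁿ}` with `n > 0` occurs only for `n = 2` and `ρ = σ`.
  have h1 : ∀ j, integ (phiPol v j 1) 1 = 0 := fun j => by
    rw [integ_apply, sum_sig, phiPol_of_ne v j (r := .tau) (by simp [Sig.wt]),
      phiPol_of_ne v j (r := .ups) (by simp [Sig.wt]),
      phiPol_of_ne v j (r := .sig) (by simp [Sig.wt])]
    simp
  have h2 : ∀ j, integ (phiPol v j 2) 1 = phiPol v j 2 .sig • wordR R [.sig] := fun j => by
    rw [integ_apply, sum_sig, phiPol_of_ne v j (r := .tau) (by simp [Sig.wt]),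
      phiPol_of_ne v j (r := .ups) (by simp [Sig.wt]), ← wordR_nil]
    simp [postR_wordR]
  have h3 : ∀ j, integ (phiPol v j 3) 1 = 0 := fun j => by
    rw [integ_apply, sum_sig, phiPol_of_ne v j (r := .tau) (by simp [Sig.wt]),
      phiPol_of_ne v j (r := .ups) (by simp [Sig.wt]),
      phiPol_of_ne v j (r := .sig) (by simp [Sig.wt])]
    simp
  have he : ∀ l, l.wt = 1 → evalPt γ (integ (phiExt v l) 1) =
      x (fK [.tau] • Phi .tau l + fK [.ups] • Phi .ups l) := by
    intro l hl
    rw [integ_of_sig_eq_zero (phiExt_of_ne v (by simp [Sig.wt, hl])), ← wordR_nil, postR_wordR,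
      postR_wordR]
    simp only [map_add, map_smul, map_Phi, evalPt_smul, evalPt_wordR, hγ, List.nil_append]
    simp only [Algebra.smul_def]
    ring
  have hp0 : ∀ j r, phiPol v j 0 r = phiExt v (.pol j 0) r := fun _ _ => rfl
  have hp2 : ∀ j r, phiPol v j 2 r = phiExt v (.pol j 2) r := fun _ _ => rfl
  have e0 : ∀ j, imagePol v j 0 = phiPol v j 0 .tau • wordR R [.tau] +
      phiPol v j 0 .ups • wordR R [.ups] := fun j => by
    rw [imagePol, integ_of_sig_eq_zero (h0 j), ← wordR_nil, postR_wordR, postR_wordR]; rfl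
  rcases l with _ | _ | ⟨j, n⟩
  · exact he .e1 rfl
  · exact he .e2 rfl
  · change evalPt γ (imagePol v j n) = _
    fin_cases n
    · change evalPt γ (imagePol v j 0) = x (thetaVal (.pol j 0))
      rw [e0, thetaVal]
      simp only [sum_tu, map_add, map_smul, map_Phi, evalPt_smul, evalPt_wordR, hγ, hp0]
      simp only [Algebra.smul_def]
      ring
    · change evalPt γ (imagePol v j 1) = x (thetaVal (.pol j 1))
      rw [imagePol, h1, e0, thetaVal]
      simp only [sum_tu, integ_of_sig_eq_zero (ht j), map_add, map_mul, map_smul, map_Phi,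
        map_PhiTail, postR_wordR, evalPt_smul, evalPt_wordR, hγ, hp0, zero_add,
        List.cons_append, List.nil_append]
      simp only [Algebra.smul_def]
      ring
    · change evalPt γ (imagePol v j 2) = x (thetaVal (.pol j 2))
      rw [imagePol, imagePol, h1, h2, e0, thetaVal]
      simp only [sum_tu, integ_of_sig_eq_zero (ht j), map_add, map_mul, map_smul, map_Phi,
        map_PhiTail, postR_wordR, evalPt_smul, evalPt_wordR, hγ, hp0, hp2, zero_add,
        List.cons_append, List.nil_append]
      simp only [Algebra.smul_def]
      ring
    · change evalPt γ (imagePol v j 3) = x (thetaVal (.pol j 3))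
      rw [imagePol, imagePol, imagePol, h1, h2, h3, e0, thetaVal]
      simp only [sum_tu, integ_of_sig_eq_zero (ht j), map_add, map_mul, map_smul, map_Phi,
        map_PhiTail, postR_wordR, evalPt_smul, evalPt_wordR, hγ, hp0, hp2, zero_add,
        List.cons_append, List.nil_append]
      simp only [Algebra.smul_def]
      ring

lemma evalAt_fPL (γ : Sh Sig →ₐ[ℚ] R) (v : PhiIdx → R) (l : Lam) :
    evalAt γ (cocycle v) (fPL l) = evalPt γ (image v l) :=
  congrArg (evalPt γ) (cocycle_fPL v l)

lemma coeffR_chg {S : Type u} [CommRing S] [Algebra ℚ S] (φ : R →ₐ[ℚ] S) (w : List Sig)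
    (x : R ⊗[ℚ] Sh Sig) : coeffR S w (chg φ (Sh Sig) x) = φ (coeffR R w x) := by
  induction x with
  | zero => simp
  | add x y hx hy => simp only [map_add, hx, hy]
  | tmul r f => simp [chg, coeffR_tmul]

end

lemma coords_map {R S : CommAlgCat.{u} ℚ} (φ : R ⟶ S) (c : Z1PL.{u}.obj R) :
    coords (R := S) (Z1PL.{u}.map φ c) = fun i => φ.hom (coords (R := R) c i) := by
  funext i
  change coeffR S [i.1.1] (bc φ.hom (Subtype.val c) (1 ⊗ₜ fPL i.1.2)) = _
  rw [bc_one_tmul, coeffR_chg]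
  rfl

/-- The points of an affine space. -/
def mvPtsEquiv {ι K : Type} [CommRing K] {R : Type u} [CommRing R] [Algebra K R] :
    (MvPolynomial ι K →ₐ[K] R) ≃ (ι → R) where
  toFun x i := x (MvPolynomial.X i)
  invFun := MvPolynomial.aeval
  left_inv x := MvPolynomial.algHom_ext fun i => by simp
  right_inv v := by funext i; simp

/-- The points of `π^PL_{≥ -4}` are given by the values of the functions `f_λ`. -/
def plPtsEquiv {R : Type u} [CommRing R] [Algebra ℚ R] : (APLle 4 →ₐ[ℚ] R) ≃ (Lam → R) where
  toFun x l := x (fPL l)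
  invFun := liftPL
  left_inv x := algHom_ext_fPL fun l => liftPL_fPL _ l
  right_inv v := by funext l; exact liftPL_fPL v l

/-- The isomorphism between affine space and the scheme of cocycles. -/
def cocycleIso : pts.{u} Ktus Sring ≅ resScalars.{u} ℚ Ktus ⋙ Z1PL.{u} :=
  NatIso.ofComponents
    (fun R => Equiv.toIso (mvPtsEquiv.trans (cocycleEquiv (R := (resScalars ℚ Ktus).obj R))))
    (by
      intro R S φ
      ext x
      apply (cocycleEquiv (R := (resScalars ℚ Ktus).obj S)).symm.injective
      refine (coords_cocycle (R := (resScalars ℚ Ktus).obj S) _).trans (Eq.symm ?_)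
      refine (coords_map ((resScalars ℚ Ktus).map φ) _).trans ?_
      funext i
      exact congrArg φ.hom (congrFun (coords_cocycle (R := (resScalars ℚ Ktus).obj R) _) i))

/-- The isomorphism between affine space and `π^PL_{≥ -4}`. -/
def plIso : pts.{u} Ktus Aring ≅ resScalars.{u} ℚ Ktus ⋙ piPL.{u} :=
  NatIso.ofComponents
    (fun R => Equiv.toIso (mvPtsEquiv.trans (plPtsEquiv (R := (resScalars ℚ Ktus).obj R)).symm))
    (by
      intro R S φ
      ext x
      apply (plPtsEquiv (R := (resScalars ℚ Ktus).obj S)).injective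
      funext l
      refine (liftPL_fPL (T := (resScalars ℚ Ktus).obj S) _ l).trans (Eq.symm ?_)
      exact congrArg φ.hom (liftPL_fPL (T := (resScalars ℚ Ktus).obj R) _ l))

/-- The evaluation morphism corresponds to `θ` under the two isomorphisms. -/
lemma cocycleIso_evK :
    cocycleIso.{u}.hom ≫ evKtus.{u} = ptsMap.{u} theta ≫ plIso.{u}.hom := by
  ext R x
  change Sring →ₐ[Ktus] R at x
  apply (plPtsEquiv (R := (resScalars ℚ Ktus).obj R)).injective
  funext l
  let _ : Algebra Ktus ((resScalars ℚ Ktus).obj R) := inferInstanceAs (Algebra Ktus R)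
  refine (evalAt_fPL (R := (resScalars ℚ Ktus).obj R) (basePt genPt R) _ l).trans
    (Eq.trans ?_ (liftPL_fPL (T := (resScalars ℚ Ktus).obj R) _ l).symm)
  let γ : Sh Sig →ₐ[ℚ] (resScalars ℚ Ktus).obj R := basePt genPt R
  refine (evalPt_image γ (fun w => rfl) x l).trans ?_
  exact congrArg x (MvPolynomial.aeval_X thetaVal l).symm

end PL

end

theorem proposition4p3 :
    ∃ fPL : Lam → PL.APLle 4, (∀ l, (fPL l : Sh Gam) = Sh.fn l.poly) ∧
      ∃ (α : pts.{u} Ktus Sring ≅ resScalars.{u} ℚ Ktus ⋙ Z1PL.{u})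
        (β : pts.{u} Ktus Aring ≅ resScalars.{u} ℚ Ktus ⋙ piPL.{u}),
        (∀ (R : CommAlgCat.{u} Ktus) (x : Sring →ₐ[Ktus] R) (i : PhiIdx),
          phiCoord (R := (resScalars.{u} ℚ Ktus).obj R) [i.1.1] (fPL i.1.2) (α.hom.app R x) =
            x (MvPolynomial.X i)) ∧
        (∀ (R : CommAlgCat.{u} Ktus) (x : Aring →ₐ[Ktus] R) (l : Lam),
          value (R := (resScalars.{u} ℚ Ktus).obj R) (fPL l) (β.hom.app R x) =
            x (MvPolynomial.X l)) ∧
        α.hom ≫ evKtus.{u} = ptsMap.{u} theta ≫ β.hom := by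
  refine ⟨PL.fPL, fun l => rfl, PL.cocycleIso, PL.plIso, fun R x i => ?_, fun R x l => ?_, ?_⟩
  · exact congrFun (PL.coords_cocycle (R := (resScalars.{u} ℚ Ktus).obj R) _) i
  · exact PL.liftPL_fPL (T := (resScalars.{u} ℚ Ktus).obj R) _ l
  · exact PL.cocycleIso_evK
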